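/- Let $X$ be a finite set and $F=F_X$ the free group on $X$. Graphs are graphs in the sense of Serre, labeled by $X\cup X^{-1}$ (reversing an edge inverts its label); a labeled graph is folded if distinct edges with the same initial vertex have distinct labels. A \emph{u-word} is a folded labeled graph homeomorphic to a (nondegenerate) compact line segment, i.e. a nontrivial reduced word up to inversion; a \emph{cyclic word} is a folded labeled graph homeomorphic to a circle, i.e. a nontrivial cyclically reduced word up to cyclic permutation and inversion. $\mathrm{Hom}$ denotes morphisms of labeled graphs, so $|\mathrm{Hom}(u,w)|$ is the number of occurrences of $u$ in $w$. For an automorphism $\varphi$ of $F$ and a labeled graph $\Delta$, let $\tilde{\mathcal F}_\varphi(\Delta)$ be the folded graph obtained from $\Delta$ by replacing each edge with label $x$ by a path labeled by the reduced word $\varphi(x)$ and then folding; this is a functor. For a u-word $v$ the graph $\tilde{\mathcal F}_\varphi(v)$ is a tree, and the u-word $\varphi(v)$ is the segment in it joining the images of the end points of $v$; for a cyclic word $w$ the cyclic word $\varphi(w)$ is the unique embedded circle in $\tilde{\mathcal F}_\varphi(w)$. Fix a u-word $u$ and an automorphism $\varphi$ of $F$. Consider pairs $(v,\, f:u\to\varphi(v))$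 of a u-word $v$ (the base word) and a morphism $f$, up to isomorphism. - A pair $(v,f)$ is an \emph{ideal preimage} of $u$ if for every u-word $w$ and every morphism $h:v\to w$ there is a morphism $u\to\varphi(w)$ such that $u\to\varphi(v)\subset\tilde{\mathcal F}_\varphi(v)\to\tilde{\mathcal F}_\varphi(w)$ equals $u\to\varphi(w)\subset\tilde{\mathcal F}_\varphi(w)$. - $(v_1,f_1)$ is a sub ideal preimage of $(v_2,f_2)$ if both are ideal preimages and some morphism $v_1\to v_2$ makes $u\to\tilde{\mathcal F}_\varphi(v_1)\to\tilde{\mathcal F}_\varphi(v_2)$ equal to $u\to\tilde{\mathcal F}_\varphi(v_2)$. An ideal preimage is \emph{minimal} if it is its only sub ideal preimage. - A set $S$ of ideal preimages is \emph{full} if for every cyclic word $w$ and every morphism $u\to\varphi(w)$ there is a unique $(v,f)\in S$ for which there is a morphism $v\to w$ such that $u\to\varphi(v)\subset\tilde{\mathcal F}_\varphi(v)\to\tilde{\mathcal F}_\varphi(w)$ equals $u\to\varphi(w)\subset\tilde{\mathcal F}_\varphi(w)$. - A \emph{full paradigm} of a pair $(v,f)$ consists of one pair $(vx,f_x)$ for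 each letter $x\in X\cup X^{-1}$ such that $vx$ is reduced (for an orientation of $v$), such that $u\to\tilde{\mathcal F}_\varphi(vx)$ equals $u\to\tilde{\mathcal F}_\varphi(v)\to\tilde{\mathcal F}_\varphi(vx)$, the latter map being induced by the embedding of $v$ as a prefix; or likewise with the words $xv$ and the embedding of $v$ as a suffix. - A full set is \emph{minimal} if it contains no full paradigm. **Theorem.** For every u-word $u$ and every automorphism $\varphi$ of $F$ there is a unique finite minimal full set of ideal preimages of $u$, and it is exactly the set of all minimal ideal preimages of $u$. Consequently there is a unique finite multiset $S_{u,\varphi}$ of u-words which is the multiset of base words of a finite minimal full set and which satisfies, for every cyclic word $w$, $$|\mathrm{Hom}(u,\varphi(w))|=\sum_{v\in S_{u,\varphi}}|\mathrm{Hom}(v,w)|.$$ -/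

import Mathlib

/-- An `X`-labeled graph in the sense of Serre. The label `(x, true)` stands for the generator `x`
and `(x, false)` for its formal inverse. Since the label function commutes with the involution,
`bar e ≠ e` holds automatically. -/
structure LabeledGraph (X : Type*) where
  /-- vertices -/
  V : Type
  /-- oriented edges -/
  E : Type
  /-- initial vertex -/
  ι : E → V
  /-- edge reversal -/
  bar : E → E
  bar_bar : ∀ e, bar (bar e) = e
  /-- label function, that is, a graph morphism to the rose on `X` -/
  label : E → X × Bool
  label_bar : ∀ e, label (bar e) = ((label e).1, !(label e).2)

namespace LabeledGraph

variable {X Y : Type*}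

/-- Morphisms of labeled graphs. -/
@[ext]
structure Hom (Γ Δ : LabeledGraph X) where
  onV : Γ.V → Δ.V
  onE : Γ.E → Δ.E
  map_ι : ∀ e, onV (Γ.ι e) = Δ.ι (onE e)
  map_bar : ∀ e, onE (Γ.bar e) = Δ.bar (onE e)
  map_label : ∀ e, Δ.label (onE e) = Γ.label e

/-- Composition of morphisms (first `f`, then `g`). -/
def Hom.comp {Γ Δ Ξ : LabeledGraph X} (g : Hom Δ Ξ) (f : Hom Γ Δ) : Hom Γ Ξ where
  onV := fun v => g.onV (f.onV v)
  onE := fun e => g.onE (f.onE e)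
  map_ι := fun e => by rw [f.map_ι, g.map_ι]
  map_bar := fun e => by rw [f.map_bar, g.map_bar]
  map_label := fun e => by rw [g.map_label, f.map_label]

/-! ### Segments and circles -/

/-- The segment whose consecutive edges spell the word `L`. The edge `(i, true)` runs from vertex
`i` to vertex `i + 1`, and `(i, false)` is its reverse. -/
def line (L : List (X × Bool)) : LabeledGraph X where
  V := Fin (L.length + 1)
  E := Fin L.length × Bool
  ι := fun e => if e.2 then e.1.castSucc else e.1.succ
  bar := fun e => (e.1, !e.2)
  bar_bar := fun e => by simp
  label := fun e => ((L.get e.1).1, if e.2 then (L.get e.1).2 else !(L.get e.1).2)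
  label_bar := fun e => by rcases e with ⟨i, _ | _⟩ <;> simp

/-- The circle whose consecutive edges spell the cyclic word `L`. The edge `(i, true)` runs from
vertex `i` to vertex `i + 1` modulo the length of `L`, and `(i, false)` is its reverse. -/
def circle (L : List (X × Bool)) : LabeledGraph X where
  V := Fin L.length
  E := Fin L.length × Bool
  ι := fun e => if e.2 then e.1 else ⟨(e.1 + 1) % L.length, Nat.mod_lt _ e.1.pos⟩
  bar := fun e => (e.1, !e.2)
  bar_bar := fun e => by simp
  label := fun e => ((L.get e.1).1, if e.2 then (L.get e.1).2 else !(L.get e.1).2)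
  label_bar := fun e => by rcases e with ⟨i, _ | _⟩ <;> simp

/-! ### Folding -/

/-- Two vertices are identified in the folded graph. -/
inductive FoldRel (Γ : LabeledGraph X) : Γ.V → Γ.V → Prop
  | refl (v : Γ.V) : FoldRel Γ v v
  | symm {v w : Γ.V} : FoldRel Γ v w → FoldRel Γ w v
  | trans {u v w : Γ.V} : FoldRel Γ u v → FoldRel Γ v w → FoldRel Γ u w
  | step {e f : Γ.E} : FoldRel Γ (Γ.ι e) (Γ.ι f) → Γ.label e = Γ.label f →
      FoldRel Γ (Γ.ι (Γ.bar e)) (Γ.ι (Γ.bar f))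

/-- The identification of vertices under folding. -/
def foldVSetoid (Γ : LabeledGraph X) : Setoid Γ.V where
  r := FoldRel Γ
  iseqv := ⟨FoldRel.refl, FoldRel.symm, FoldRel.trans⟩

/-- The identification of edges under folding: two edges are identified when they have the same
label and their initial vertices are identified. -/
def foldESetoid (Γ : LabeledGraph X) : Setoid Γ.E where
  r := fun e f => FoldRel Γ (Γ.ι e) (Γ.ι f) ∧ Γ.label e = Γ.label f
  iseqv := ⟨fun _ => ⟨.refl _, rfl⟩, fun h => ⟨h.1.symm, h.2.symm⟩,
    fun h k => ⟨h.1.trans k.1, h.2.trans k.2⟩⟩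

/-- The folded graph obtained from `Γ` by performing all foldings. -/
def fold (Γ : LabeledGraph X) : LabeledGraph X where
  V := Quotient Γ.foldVSetoid
  E := Quotient Γ.foldESetoid
  ι := Quotient.map' (s₁ := Γ.foldESetoid) (s₂ := Γ.foldVSetoid) Γ.ι fun _ _ h => h.1
  bar := Quotient.map' (s₁ := Γ.foldESetoid) (s₂ := Γ.foldESetoid) Γ.bar fun e f h =>
    ⟨FoldRel.step h.1 h.2, by rw [Γ.label_bar, Γ.label_bar, h.2]⟩
  bar_bar := by
    rintro ⟨e⟩
    exact congrArg (Quotient.mk Γ.foldESetoid) (Γ.bar_bar e)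
  label := Quotient.lift (s := Γ.foldESetoid) Γ.label fun _ _ h => h.2
  label_bar := by
    rintro ⟨e⟩
    exact Γ.label_bar e

/-- The folding morphism. -/
def foldMk (Γ : LabeledGraph X) : Hom Γ Γ.fold where
  onV := Quotient.mk Γ.foldVSetoid
  onE := Quotient.mk Γ.foldESetoid
  map_ι := fun _ => rfl
  map_bar := fun _ => rfl
  map_label := fun _ => rfl

theorem FoldRel.map {Γ Δ : LabeledGraph X} (f : Hom Γ Δ) {v w : Γ.V} (h : FoldRel Γ v w) :
    FoldRel Δ (f.onV v) (f.onV w) := by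
  induction h with
  | refl v => exact .refl _
  | symm _ ih => exact ih.symm
  | trans _ _ ih₁ ih₂ => exact ih₁.trans ih₂
  | step _ hl ih =>
    rw [f.map_ι, f.map_ι] at ih
    rw [f.map_ι, f.map_ι, f.map_bar, f.map_bar]
    exact .step ih (by rw [f.map_label, f.map_label, hl])

/-- Functoriality of folding. -/
def foldMap {Γ Δ : LabeledGraph X} (f : Hom Γ Δ) : Hom Γ.fold Δ.fold where
  onV := Quotient.map' (s₁ := Γ.foldVSetoid) (s₂ := Δ.foldVSetoid) f.onV fun _ _ h => h.map f
  onE := Quotient.map' (s₁ := Γ.foldESetoid) (s₂ := Δ.foldESetoid) f.onE fun a b h =>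
    ⟨by rw [← f.map_ι, ← f.map_ι]; exact h.1.map f, by rw [f.map_label, f.map_label, h.2]⟩
  map_ι := by
    rintro ⟨e⟩
    exact congrArg (Quotient.mk Δ.foldVSetoid) (f.map_ι e)
  map_bar := by
    rintro ⟨e⟩
    exact congrArg (Quotient.mk Δ.foldESetoid) (f.map_bar e)
  map_label := by
    rintro ⟨e⟩
    exact f.map_label e

/-! ### Substituting a homomorphism of free groups -/

section Subst

variable [DecidableEq X]

/-- The reduced word of the image of a generator. -/
def substWord (φ : FreeGroup Y →* FreeGroup X) (y : Y) : List (X × Bool) :=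
  (φ (FreeGroup.of y)).toWord

/-- The `i`-th vertex on the path that replaces the edge `e`, which is labeled by a generator. -/
def substPoint (φ : FreeGroup Y →* FreeGroup X) (Δ : LabeledGraph Y) (e : Δ.E)
    (he : (Δ.label e).2 = true) (i : ℕ) :
    Δ.V ⊕ {p : Δ.E × ℕ // (Δ.label p.1).2 = true ∧ 0 < p.2 ∧
      p.2 < (substWord φ (Δ.label p.1).1).length} :=
  if h : 0 < i ∧ i < (substWord φ (Δ.label e).1).length then Sum.inr ⟨(e, i), he, h⟩
  else if i = 0 then Sum.inl (Δ.ι e) else Sum.inl (Δ.ι (Δ.bar e))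

/-- The (in general not folded) `X`-labeled graph obtained from the `Y`-labeled graph `Δ` by
replacing every edge with label `y` by a path that spells the reduced word `φ y`; here `φ y ≠ 1`
is understood. Each pair `e, bar e` of edges of `Δ` is represented by its member `e` that is
labeled by a generator. The vertices are those of `Δ` and the interior vertices `(e, i)`, with
`0 < i < |φ y|`, of the new paths; the edge `((e, i), true)` is the `i`-th edge of the path that
replaces `e`. -/
def subst (φ : FreeGroup Y →* FreeGroup X) (Δ : LabeledGraph Y) : LabeledGraph X where
  V := Δ.V ⊕ {p : Δ.E × ℕ // (Δ.label p.1).2 = true ∧ 0 < p.2 ∧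
      p.2 < (substWord φ (Δ.label p.1).1).length}
  E := {p : Δ.E × ℕ // (Δ.label p.1).2 = true ∧
      p.2 < (substWord φ (Δ.label p.1).1).length} × Bool
  ι := fun a => substPoint φ Δ a.1.1.1 a.1.2.1 (if a.2 then a.1.1.2 else a.1.1.2 + 1)
  bar := fun a => (a.1, !a.2)
  bar_bar := fun a => by simp
  label := fun a =>
    (((substWord φ (Δ.label a.1.1.1).1)[a.1.1.2]'a.1.2.2).1,
      if a.2 then ((substWord φ (Δ.label a.1.1.1).1)[a.1.1.2]'a.1.2.2).2
      else !((substWord φ (Δ.label a.1.1.1).1)[a.1.1.2]'a.1.2.2).2)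
  label_bar := fun a => by rcases a with ⟨p, _ | _⟩ <;> simp

/-- Functoriality of the substitution: the path replacing `e` is sent identically onto the path
replacing the image of `e`. -/
def substMap (φ : FreeGroup Y →* FreeGroup X) {Δ Ξ : LabeledGraph Y} (f : Hom Δ Ξ) :
    Hom (subst φ Δ) (subst φ Ξ) where
  onV := Sum.map f.onV fun p => ⟨(f.onE p.1.1, p.1.2), by
    simpa only [f.map_label] using p.2⟩
  onE := fun a => (⟨(f.onE a.1.1.1, a.1.1.2), by simpa only [f.map_label] using a.1.2⟩, a.2)
  map_ι := by
    rintro ⟨⟨⟨e, i⟩, he, hi⟩, b⟩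
    simp only [subst, substPoint, f.map_label]
    split_ifs <;> simp_all [f.map_ι, f.map_bar]
  map_bar := fun _ => rfl
  map_label := by
    rintro ⟨⟨⟨e, i⟩, he, hi⟩, b⟩
    simp only [subst, f.map_label]

/-- Substitution followed by folding. -/
def foldSubst (φ : FreeGroup Y →* FreeGroup X) (Δ : LabeledGraph Y) : LabeledGraph X :=
  (subst φ Δ).fold

/-- Functoriality of substitution followed by folding. -/
def foldSubstMap (φ : FreeGroup Y →* FreeGroup X) {Δ Ξ : LabeledGraph Y} (f : Hom Δ Ξ) :
    Hom (foldSubst φ Δ) (foldSubst φ Ξ) :=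
  foldMap (substMap φ f)

/-- The image of a vertex of `Δ` in the folded graph. -/
def foldSubstVertex (φ : FreeGroup Y →* FreeGroup X) (Δ : LabeledGraph Y) (v : Δ.V) :
    (foldSubst φ Δ).V :=
  (foldMk (subst φ Δ)).onV (Sum.inl v)

end Subst

/-! ### Reduced paths and subgraphs -/

/-- The edge `f` can follow the edge `e` in a reduced path. -/
def Follows (Γ : LabeledGraph X) (e f : Γ.E) : Prop :=
  Γ.ι (Γ.bar e) = Γ.ι f ∧ f ≠ Γ.bar e

/-- The edges on reduced paths from `a` to `b`. -/
def geodesicEdges (Γ : LabeledGraph X) (a b : Γ.V) : Set Γ.E :=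
  {e | ∃ p : List Γ.E, p.IsChain Γ.Follows ∧ p.head?.map Γ.ι = some a ∧
    p.getLast?.map (fun c => Γ.ι (Γ.bar c)) = some b ∧ e ∈ p}

/-- The edges on cyclically reduced closed paths. -/
def coreEdges (Γ : LabeledGraph X) : Set Γ.E :=
  {e | ∃ p : List Γ.E, p.IsChain Γ.Follows ∧
    (∀ c ∈ p.getLast?, ∀ d ∈ p.head?, Γ.Follows c d) ∧ e ∈ p}

/-- The subgraph consisting of the edges in `A`, their reverses, and their end points. -/
def span (Γ : LabeledGraph X) (A : Set Γ.E) : LabeledGraph X where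
  V := {v : Γ.V // ∃ e, (e ∈ A ∨ Γ.bar e ∈ A) ∧ Γ.ι e = v}
  E := {e : Γ.E // e ∈ A ∨ Γ.bar e ∈ A}
  ι := fun e => ⟨Γ.ι e.1, e.1, e.2, rfl⟩
  bar := fun e => ⟨Γ.bar e.1, by rw [Γ.bar_bar]; exact e.2.symm⟩
  bar_bar := fun e => Subtype.ext (Γ.bar_bar e.1)
  label := fun e => Γ.label e.1
  label_bar := fun e => Γ.label_bar e.1

/-- The inclusion of a subgraph. -/
def spanIncl (Γ : LabeledGraph X) (A : Set Γ.E) : Hom (Γ.span A) Γ where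
  onV := Subtype.val
  onE := Subtype.val
  map_ι := fun _ => rfl
  map_bar := fun _ => rfl
  map_label := fun _ => rfl

end LabeledGraph

open LabeledGraph

/-! ### u-words -/

/-- The nontrivial elements `g` and `g⁻¹` of a free group define the same u-word. -/
def uWordSetoid (X : Type*) : Setoid {g : FreeGroup X // g ≠ 1} where
  r := fun g h => h.1 = g.1 ∨ h.1 = g.1⁻¹
  iseqv := ⟨fun _ => Or.inl rfl,
    fun {g h} k => by rcases k with k | k <;> simp [k],
    fun {a b c} k l => by rcases k with k | k <;> rcases l with l | l <;> simp [k, l]⟩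

/-- A u-word (unoriented word): a nontrivial reduced word up to inversion. -/
def UWord (X : Type*) := Quotient (uWordSetoid X)

namespace UWord

variable {X : Type*}

/-- A chosen orientation of a u-word. -/
noncomputable def word (v : UWord X) : FreeGroup X := (Quotient.out v).1

/-- `g` is an orientation of the u-word `v`. -/
def IsOrientation (v : UWord X) (g : FreeGroup X) : Prop := v.word = g ∨ v.word = g⁻¹

variable [DecidableEq X]

/-- The u-word as a labeled graph: a segment. Opposite orientations give isomorphic labeled graphs,
and a u-word has no automorphism but the identity, so each isomorphism class is represented exactly
once. -/
noncomputable def graph (v : UWord X) : LabeledGraph X := line v.word.toWord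

/-- The initial vertex of the segment in the chosen orientation. -/
noncomputable def first (v : UWord X) : v.graph.V := (0 : Fin (v.word.toWord.length + 1))

/-- The final vertex of the segment in the chosen orientation. -/
noncomputable def last (v : UWord X) : v.graph.V := Fin.last v.word.toWord.length

/-- The vertex is one of the two end points of the segment. -/
def IsEnd (v : UWord X) (a : v.graph.V) : Prop := a = v.first ∨ a = v.last

/-- The edges of the subgraph `φ(v)` of the folded graph of `v`: the latter is a tree, and `φ(v)` is
the segment of it that joins the images of the end points of `v`. -/
def imageEdges (φ : FreeGroup X ≃* FreeGroup X) (v : UWord X) :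
    Set (foldSubst φ.toMonoidHom v.graph).E :=
  geodesicEdges _ (foldSubstVertex φ.toMonoidHom v.graph v.first)
    (foldSubstVertex φ.toMonoidHom v.graph v.last)

/-- The u-word `φ(v)`, as a subgraph of the folded graph of `v`. -/
noncomputable def image (φ : FreeGroup X ≃* FreeGroup X) (v : UWord X) : LabeledGraph X :=
  span _ (imageEdges φ v)

/-- The inclusion of `φ(v)` in the folded graph of `v`. -/
noncomputable def imageIncl (φ : FreeGroup X ≃* FreeGroup X) (v : UWord X) :
    Hom (v.image φ) (foldSubst φ.toMonoidHom v.graph) :=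
  spanIncl _ (imageEdges φ v)

end UWord

/-! ### Cyclic words -/

/-- A cyclic word, given by a cyclically reduced representative. -/
structure CyclicWord (X : Type*) [DecidableEq X] where
  word : FreeGroup X
  word_ne_one : word ≠ 1
  cyclicallyReduced : FreeGroup.IsCyclicallyReduced word.toWord

namespace CyclicWord

variable {X : Type*} [DecidableEq X]

/-- The cyclic word as a labeled graph: a circle. -/
def graph (w : CyclicWord X) : LabeledGraph X := circle w.word.toWord

/-- The cyclic word `φ(w)`, represented by the cyclic reduction of `φ w`. -/
def map (φ : FreeGroup X ≃* FreeGroup X) (w : CyclicWord X) : CyclicWord X where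
  word := FreeGroup.mk (FreeGroup.reduceCyclically (φ w.word).toWord)
  word_ne_one := by
    intro h
    have h2 := FreeGroup.reduceCyclically.conj_conjugator_reduceCyclically (φ w.word).toWord
    have h3 := congrArg FreeGroup.mk h2
    rw [← FreeGroup.mul_mk, ← FreeGroup.mul_mk, h, mul_one, ← FreeGroup.inv_mk, mul_inv_cancel,
      FreeGroup.mk_toWord] at h3
    exact w.word_ne_one ((map_eq_one_iff φ φ.injective).1 h3.symm)
  cyclicallyReduced := by
    have h := FreeGroup.reduceCyclically.isCyclicallyReduced
      (FreeGroup.isReduced_toWord (x := φ w.word))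
    rw [FreeGroup.toWord_mk, h.isReduced.reduce_eq]
    exact h

/-- The edges of the subgraph `φ(w)` of the folded graph of `w`: the latter is a circle with trees
attached, and `φ(w)` is the circle. -/
def imageEdges (φ : FreeGroup X ≃* FreeGroup X) (w : CyclicWord X) :
    Set (foldSubst φ.toMonoidHom w.graph).E :=
  coreEdges _

/-- The cyclic word `φ(w)`, as a subgraph of the folded graph of `w`. -/
def image (φ : FreeGroup X ≃* FreeGroup X) (w : CyclicWord X) : LabeledGraph X :=
  span _ (imageEdges φ w)

/-- The inclusion of `φ(w)` in the folded graph of `w`. -/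
def imageIncl (φ : FreeGroup X ≃* FreeGroup X) (w : CyclicWord X) :
    Hom (w.image φ) (foldSubst φ.toMonoidHom w.graph) :=
  spanIncl _ (imageEdges φ w)

end CyclicWord

/-! ### Ideal preimages -/

/-- A pair consisting of a u-word `v`, the base word, and a graph morphism `u → φ(v)`. -/
structure MarkedUWord {X : Type*} [DecidableEq X] (φ : FreeGroup X ≃* FreeGroup X)
    (u : UWord X) where
  base : UWord X
  emb : Hom u.graph (base.image φ)

namespace MarkedUWord

variable {X : Type*} [DecidableEq X] {φ : FreeGroup X ≃* FreeGroup X} {u : UWord X}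

/-- The composition of `u → φ(v)` with the inclusion of `φ(v)` in the folded graph of `v`. -/
noncomputable def toFold (p : MarkedUWord φ u) :
    Hom u.graph (foldSubst φ.toMonoidHom p.base.graph) :=
  (p.base.imageIncl φ).comp p.emb

/-- The pair `u → φ(v)` is an ideal preimage of `u`: for every morphism `v → w` to a u-word there is
a morphism `u → φ(w)` that agrees with `u → φ(v)` in the folded graph of `w`. -/
def IsIdealPreimage (p : MarkedUWord φ u) : Prop :=
  ∀ (w : UWord X) (h : Hom p.base.graph w.graph), ∃ f : Hom u.graph (w.image φ),
    (foldSubstMap φ.toMonoidHom h).comp p.toFold = (w.imageIncl φ).comp f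

/-- The morphism `h` between base words is compatible with the morphisms from `u`. -/
def Compatible (p q : MarkedUWord φ u) (h : Hom p.base.graph q.base.graph) : Prop :=
  (foldSubstMap φ.toMonoidHom h).comp p.toFold = q.toFold

/-- `p` is a sub ideal preimage of `q` (used for ideal preimages). -/
def IsSub (p q : MarkedUWord φ u) : Prop :=
  ∃ h : Hom p.base.graph q.base.graph, Compatible p q h

/-- A minimal ideal preimage: one without nontrivial sub ideal preimages. -/
def IsMinimalIdealPreimage (p : MarkedUWord φ u) : Prop :=
  p.IsIdealPreimage ∧ ∀ q : MarkedUWord φ u, q.IsIdealPreimage → q.IsSub p → q = p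

/-- A full set of ideal preimages: every morphism `u → φ(w)`, with `w` a cyclic word, comes from
exactly one member of the set. -/
def IsFull (S : Set (MarkedUWord φ u)) : Prop :=
  (∀ p ∈ S, p.IsIdealPreimage) ∧
  ∀ (w : CyclicWord X) (f : Hom u.graph (w.image φ)),
    ∃! p : MarkedUWord φ u, p ∈ S ∧ ∃ h : Hom p.base.graph w.graph,
      (foldSubstMap φ.toMonoidHom h).comp p.toFold = (w.imageIncl φ).comp f

/-- `P` is a full paradigm of `p`, a pair with base word `v`: either it consists of one pair with
base word `vx`, compatible with `p` through the embedding of `v` as a prefix, for each letter `x`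
such that `vx` is reduced, or likewise with the words `xv` and the embedding of `v` as a suffix.
A morphism from `v` to a word longer by one letter is the prefix or the suffix embedding according
to which end point of `v` it sends to an end point. -/
def IsFullParadigm (p : MarkedUWord φ u) (P : Set (MarkedUWord φ u)) : Prop :=
  (∃ q : {x : X × Bool // FreeGroup.IsReduced (p.base.word.toWord ++ [x])} → MarkedUWord φ u,
    P = Set.range q ∧
    ∀ x, (q x).base.IsOrientation (p.base.word * FreeGroup.mk [x.1]) ∧
      ∃ h : Hom p.base.graph (q x).base.graph,
        (q x).base.IsEnd (h.onV p.base.first) ∧ Compatible p (q x) h) ∨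
  (∃ q : {x : X × Bool // FreeGroup.IsReduced ([x] ++ p.base.word.toWord)} → MarkedUWord φ u,
    P = Set.range q ∧
    ∀ x, (q x).base.IsOrientation (FreeGroup.mk [x.1] * p.base.word) ∧
      ∃ h : Hom p.base.graph (q x).base.graph,
        (q x).base.IsEnd (h.onV p.base.last) ∧ Compatible p (q x) h)

/-- A full set is minimal if it contains no full paradigm. -/
def IsMinimalFull (S : Set (MarkedUWord φ u)) : Prop :=
  IsFull S ∧ ¬ ∃ (p : MarkedUWord φ u) (P : Set (MarkedUWord φ u)), IsFullParadigm p P ∧ P ⊆ S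

end MarkedUWord

/-! Everything is read off in the Cayley tree of the free group. Place `u` as the segment from `1`
to `u.word`, and let A (`sourceSide`) and B (`targetSide`) be the sets of vertices that `φ` sends
behind the initial point and beyond the final point of this segment. If a u-word `v` is placed as
the segment from `a` to `b`, then its folded graph develops into a subtree that contains `φ a` and
`φ b`, and the copy of `u` at `1` lies in `φ(v)` exactly when one of `a`, `b` is in A and the other
in B. Hence the pairs `(v, f)` are the pairs of points in A × B (`exists_of_mem`, `ext_of_src_tgt`).
Sub ideal preimages are subsegments (`isSub_iff`), and a pair is ideal when all points behind `a`
are in A and all points beyond `b` are in B (`isIdealPreimage_iff`). In the same way a morphism `u →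
φ(w)` with `w` cyclic is a periodic line that covers `w` and joins A to B. So a set of ideal
preimages is full when each such line contains exactly one member.

The sets A and B have finite boundary in the tree, because an edge is crossed by only finitely many
translates of a given segment. Therefore a line from A to B contains ideal pairs. The conditions on
the two end points are independent and monotone along the line, so the ideal pairs on it are those
that contain a smallest one (`exists_isIdealPair_iff`). This makes the set M of minimal ideal
preimages full. It is finite because an end point of a minimal pair is close to the boundary of A or
B (`norm_le_of_left_minimal`). It contains no full paradigm: if all one-letter extensions of a
segment at one end are ideal, then so is the segment, and the extensions are not minimal.

Conversely, let S be a finite full set without full paradigm and let `p` be minimal. Each periodic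
line through `p` contains a member of S that contains `p` (`Covers`). Suppose that an ideal `p` with
this property is not in S. By fullness `p` has an end at which no member of S containing `p` stops
(`exists_free_end`), so all one-letter extensions of `p` at that end have the property again. They
are longer, and lengths in S are bounded, so by descending induction they lie in S and form a full
paradigm, a contradiction (`Covers.mem`). Thus M ⊆ S. Any member of S shares a line with a member of
M, and uniqueness on that line gives S = M.

The counting formula holds for each finite full set: pairs of a member and a morphism from its base
word to `w` correspond bijectively to morphisms `u → φ(w)`. -/

namespace FreeGroup

/-! ### Half trees and betweenness in the Cayley tree. -/

variable {X : Type*}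

/-- The inverse letter. -/
def barLetter (x : X × Bool) : X × Bool := (x.1, !x.2)

@[simp] theorem barLetter_barLetter (x : X × Bool) : barLetter (barLetter x) = x := by simp [barLetter]

theorem barLetter_ne (x : X × Bool) : barLetter x ≠ x := by
  rcases x with ⟨x, _ | _⟩ <;> simp [barLetter]

theorem ne_barLetter_iff {x y : X × Bool} : y ≠ barLetter x ↔ (x.1 = y.1 → x.2 = y.2) := by
  rcases x with ⟨x, _ | _⟩ <;> rcases y with ⟨y, _ | _⟩ <;> simp [barLetter, eq_comm]

theorem inv_mk_singleton (x : X × Bool) : (mk [x])⁻¹ = mk [barLetter x] := by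
  simp [inv_mk, invRev, barLetter]

theorem head?_invRev (L : List (X × Bool)) : (invRev L).head? = L.getLast?.map barLetter := by
  simp [invRev, List.head?_reverse, List.getLast?_map]; rfl

theorem isReduced_append {L₁ L₂ : List (X × Bool)} : IsReduced (L₁ ++ L₂) ↔
    IsReduced L₁ ∧ IsReduced L₂ ∧ ∀ a ∈ L₁.getLast?, ∀ b ∈ L₂.head?, b ≠ barLetter a := by
  simp only [IsReduced, List.isChain_append, ne_barLetter_iff]

theorem IsReduced.of_append_left {L₁ L₂ : List (X × Bool)} (h : IsReduced (L₁ ++ L₂)) :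
    IsReduced L₁ := (isReduced_append.1 h).1

theorem IsReduced.of_append_right {L₁ L₂ : List (X × Bool)} (h : IsReduced (L₁ ++ L₂)) :
    IsReduced L₂ := (isReduced_append.1 h).2.1

variable [DecidableEq X]

theorem IsReduced.toWord_mk_eq {L : List (X × Bool)} (h : IsReduced L) : (mk L).toWord = L := by
  rw [toWord_mk, h.reduce_eq]

theorem toWord_mul_of_head? {g h : FreeGroup X}
    (H : ∀ x, g⁻¹.toWord.head? = some x → h.toWord.head? ≠ some x) :
    (g * h).toWord = g.toWord ++ h.toWord := by
  have hr : IsReduced (g.toWord ++ h.toWord) := by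
    refine isReduced_append.2 ⟨isReduced_toWord, isReduced_toWord, ?_⟩
    rintro a ha b hb rfl
    refine H (barLetter a) ?_ hb
    rw [toWord_inv, head?_invRev, Option.mem_def.1 ha, Option.map_some]
  rw [toWord_mul, hr.reduce_eq]

/-- The vertices of the Cayley tree on the far side of the edge with label `x` that starts at
`g`. -/
def halfTree (g : FreeGroup X) (x : X × Bool) : Set (FreeGroup X) :=
  {c | (g⁻¹ * c).toWord.head? = some x}

theorem mem_halfTree {g c : FreeGroup X} {x : X × Bool} :
    c ∈ halfTree g x ↔ (g⁻¹ * c).toWord.head? = some x := Iff.rfl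

theorem mul_mem_halfTree {h g c : FreeGroup X} {x : X × Bool} :
    h * c ∈ halfTree (h * g) x ↔ c ∈ halfTree g x := by
  simp only [mem_halfTree, mul_inv_rev, mul_assoc, inv_mul_cancel_left]

theorem self_notMem_halfTree (g : FreeGroup X) (x : X × Bool) : g ∉ halfTree g x := by
  simp [mem_halfTree]

theorem exists_mem_halfTree {g c : FreeGroup X} (h : g ≠ c) : ∃ x, c ∈ halfTree g x := by
  rcases hw : (g⁻¹ * c).toWord with _ | ⟨x, L⟩
  · exact absurd (inv_mul_eq_one.1 (toWord_eq_nil_iff.1 hw)) h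
  · exact ⟨x, by simp [mem_halfTree, hw]⟩

theorem halfTree_letter_unique {g c : FreeGroup X} {x y : X × Bool} (hx : c ∈ halfTree g x)
    (hy : c ∈ halfTree g y) : x = y := by
  rw [mem_halfTree] at hx hy
  exact Option.some_injective _ (hx.symm.trans hy)

/-- The reduced word of `a⁻¹ * b` spells the geodesic from `a` to `b`. If the edge at `g` separates
the points in this direction, then the words of `a⁻¹ * g` and `g⁻¹ * b` concatenate without
cancellation. This is the dictionary between half trees and reduced words. -/
theorem crossing_iff {a b g : FreeGroup X} {x : X × Bool} :
    (a ∉ halfTree g x ∧ b ∈ halfTree g x) ↔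
      ∃ L₁ L₂, (a⁻¹ * b).toWord = L₁ ++ x :: L₂ ∧ a * mk L₁ = g := by
  constructor
  · rintro ⟨ha, hb⟩
    obtain ⟨L₂, hL⟩ : ∃ L₂, (g⁻¹ * b).toWord = x :: L₂ := by
      rw [mem_halfTree] at hb
      rcases hw : (g⁻¹ * b).toWord with _ | ⟨y, L⟩ <;> simp_all
    refine ⟨(a⁻¹ * g).toWord, L₂, ?_, by rw [mk_toWord]; group⟩
    rw [show a⁻¹ * b = (a⁻¹ * g) * (g⁻¹ * b) by group, toWord_mul_of_head?, hL]
    intro y hy hy'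
    rw [hL, List.head?_cons] at hy'
    apply ha
    rw [mem_halfTree, hy', ← hy]
    congr 2
    group
  · rintro ⟨L₁, L₂, hw, rfl⟩
    have hred : IsReduced (L₁ ++ x :: L₂) := hw ▸ isReduced_toWord
    have hb : a⁻¹ * b = mk L₁ * mk (x :: L₂) := by rw [mul_mk, ← hw, mk_toWord]
    constructor
    · rw [mem_halfTree, show (a * mk L₁)⁻¹ * a = (mk L₁)⁻¹ by group, toWord_inv,
        hred.of_append_left.toWord_mk_eq, head?_invRev]
      intro h
      obtain ⟨y, hy, hyx⟩ := Option.map_eq_some_iff.1 h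
      exact (isReduced_append.1 hred).2.2 y hy x (by simp) hyx.symm
    · rw [mem_halfTree, mul_inv_rev, mul_assoc, hb, inv_mul_cancel_left,
        hred.of_append_right.toWord_mk_eq, List.head?_cons]

/-- Removing an edge leaves exactly two components, which are exchanged by reversing the edge. -/
theorem mem_halfTree_barLetter {g c : FreeGroup X} {x : X × Bool} :
    c ∈ halfTree (g * mk [x]) (barLetter x) ↔ c ∉ halfTree g x := by
  constructor
  · intro h hc
    obtain ⟨L₁, L₂, hw, h1⟩ := crossing_iff.1 ⟨self_notMem_halfTree g x, hc⟩
    have h2 : c ∉ halfTree (g * mk [x]) (barLetter x) := by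
      have h1' : L₁ = [] := by
        have hr : IsReduced L₁ := by
          have : IsReduced (L₁ ++ x :: L₂) := hw ▸ isReduced_toWord
          exact this.of_append_left
        rw [← hr.toWord_mk_eq, toWord_eq_nil_iff]
        exact mul_eq_left.1 h1
      subst h1'
      rw [List.nil_append] at hw
      have hr : IsReduced ([x] ++ L₂) := by
        rw [List.singleton_append, ← hw]
        exact isReduced_toWord
      have hb : g⁻¹ * c = mk [x] * mk L₂ := by rw [mul_mk, List.singleton_append, ← hw, mk_toWord]
      rw [mem_halfTree, mul_inv_rev, mul_assoc, hb, inv_mul_cancel_left,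
        hr.of_append_right.toWord_mk_eq]
      intro h
      exact (isReduced_append.1 hr).2.2 x (by simp) _ h rfl
    exact h2 h
  · intro h
    rw [mem_halfTree, mul_inv_rev, mul_assoc, inv_mk_singleton, toWord_mul_of_head?,
      IsReduced.singleton.toWord_mk_eq, List.singleton_append, List.head?_cons]
    intro y hy hy'
    rw [inv_mk_singleton, barLetter_barLetter, IsReduced.singleton.toWord_mk_eq, List.head?_cons] at hy
    cases hy
    exact h hy'

theorem halfTree_barLetter (g : FreeGroup X) (x : X × Bool) :
    halfTree (g * mk [x]) (barLetter x) = (halfTree g x)ᶜ := by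
  ext c
  exact mem_halfTree_barLetter

theorem mul_letter_mem_halfTree (g : FreeGroup X) (x : X × Bool) : g * mk [x] ∈ halfTree g x := by
  by_contra h
  exact self_notMem_halfTree _ _ (mem_halfTree_barLetter.2 h)

theorem halfTree_subset {g : FreeGroup X} {x y : X × Bool} (h : y ≠ barLetter x) :
    halfTree (g * mk [x]) y ⊆ halfTree g x := by
  intro c hc
  by_contra hn
  exact h (halfTree_letter_unique hc (mem_halfTree_barLetter.2 hn))

/-- `g` lies on the segment that joins `a` and `b`. -/
def Between (a g b : FreeGroup X) : Prop := ∀ x, a ∈ halfTree g x → b ∉ halfTree g x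

theorem Between.symm {a g b : FreeGroup X} (h : Between a g b) : Between b g a :=
  fun x hb ha => h x ha hb

theorem between_left (a b : FreeGroup X) : Between a a b :=
  fun x h => absurd h (self_notMem_halfTree a x)

theorem between_right (a b : FreeGroup X) : Between a b b := (between_left b a).symm

theorem between_iff_of_mem {a g b : FreeGroup X} {x : X × Bool} (hb : b ∈ halfTree g x) :
    Between a g b ↔ a ∉ halfTree g x := by
  refine ⟨fun h ha => h x ha hb, fun h y hy hb' => h ?_⟩
  rwa [halfTree_letter_unique hb hb']

theorem between_iff_toWord {a g b : FreeGroup X} :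
    Between a g b ↔ (a⁻¹ * b).toWord = (a⁻¹ * g).toWord ++ (g⁻¹ * b).toWord := by
  constructor
  · intro h
    rw [show a⁻¹ * b = (a⁻¹ * g) * (g⁻¹ * b) by group, toWord_mul_of_head?]
    intro x hx hx'
    exact h x (by rw [mem_halfTree, ← hx]; congr 2; group) hx'
  · intro h x ha hb
    obtain ⟨L, hL⟩ : ∃ L, (g⁻¹ * b).toWord = x :: L := by
      rw [mem_halfTree] at hb
      rcases hw : (g⁻¹ * b).toWord with _ | ⟨y, L⟩ <;> simp_all
    rw [hL] at h
    exact (crossing_iff.2 ⟨_, _, h, by rw [mk_toWord]; group⟩).1 ha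

theorem between_iff_exists {a g b : FreeGroup X} :
    Between a g b ↔ ∃ L₁ L₂, (a⁻¹ * b).toWord = L₁ ++ L₂ ∧ a * mk L₁ = g := by
  constructor
  · intro h
    exact ⟨_, _, between_iff_toWord.1 h, by rw [mk_toWord]; group⟩
  · rintro ⟨L₁, L₂, hw, rfl⟩
    have hr : IsReduced (L₁ ++ L₂) := hw ▸ isReduced_toWord
    have hb : a⁻¹ * b = mk L₁ * mk L₂ := by rw [mul_mk, ← hw, mk_toWord]
    rw [between_iff_toWord, hw, inv_mul_cancel_left, hr.of_append_left.toWord_mk_eq, mul_inv_rev,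
      mul_assoc, hb, inv_mul_cancel_left, hr.of_append_right.toWord_mk_eq]

theorem Between.norm_eq {a g b : FreeGroup X} (h : Between a g b) :
    (a⁻¹ * b).norm = (a⁻¹ * g).norm + (g⁻¹ * b).norm := by
  simp only [norm, between_iff_toWord.1 h, List.length_append]

/-- Convexity of the complement of a half tree. If both ends were outside, the geodesics from `k` to
them would leave the half tree through the same edge, hence start with the same letter, and `k`
would not be between. -/
theorem Between.mem_or_mem {a k c g : FreeGroup X} {x : X × Bool} (h : Between a k c)
    (hk : k ∈ halfTree g x) : a ∈ halfTree g x ∨ c ∈ halfTree g x := by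
  by_contra! hn
  have key : ∀ {d}, d ∉ halfTree g x → ∃ L₁ L₂, (k⁻¹ * d).toWord = L₁ ++ barLetter x :: L₂ ∧
      k * mk L₁ = g * mk [x] := fun {d} hd =>
    crossing_iff.1 ⟨fun hk' => (mem_halfTree_barLetter.1 hk') hk, mem_halfTree_barLetter.2 hd⟩
  obtain ⟨L₁, L₂, h1, h2⟩ := key hn.1
  obtain ⟨M₁, M₂, h3, h4⟩ := key hn.2
  have hr1 : IsReduced (L₁ ++ barLetter x :: L₂) := h1 ▸ isReduced_toWord
  have hr2 : IsReduced (M₁ ++ barLetter x :: M₂) := h3 ▸ isReduced_toWord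
  have he : L₁ = M₁ := by
    rw [← hr1.of_append_left.toWord_mk_eq, ← hr2.of_append_left.toWord_mk_eq,
      mul_left_cancel (h2.trans h4.symm)]
  subst he
  obtain ⟨y, hy⟩ : ∃ y, (L₁ ++ [barLetter x]).head? = some y := by
    rcases L₁ with _ | ⟨y, L⟩ <;> simp
  refine h y ?_ ?_
  · rw [mem_halfTree, h1, ← hy]
    simp
  · rw [mem_halfTree, h3, ← hy]
    simp

theorem Between.mem_of_mem {a k c g : FreeGroup X} {x : X × Bool} (h : Between a k c)
    (ha : a ∈ halfTree g x) (hc : c ∈ halfTree g x) : k ∈ halfTree g x := by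
  by_contra hk
  rcases h.mem_or_mem (mem_halfTree_barLetter.2 hk) with h | h
  · exact mem_halfTree_barLetter.1 h ha
  · exact mem_halfTree_barLetter.1 h hc

/-! ### Sets of vertices with finite boundary. -/

/-- A translate of the segment from `p` to `q` that crosses the edge is determined by the position
of the crossing, that is, by a prefix of the word of `p⁻¹ * q`. -/
theorem finite_setOf_crossing (p q g : FreeGroup X) (x : X × Bool) :
    {t : FreeGroup X | t * p ∉ halfTree g x ∧ t * q ∈ halfTree g x}.Finite := by
  refine ((p⁻¹ * q).toWord.inits.toFinset.finite_toSet.image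
    fun L => g * (p * mk L)⁻¹).subset ?_
  rintro t ht
  obtain ⟨L₁, L₂, hw, h⟩ := crossing_iff.1 ht
  refine ⟨L₁, ?_, by rw [← h]; group⟩
  rw [show (t * p)⁻¹ * (t * q) = p⁻¹ * q by group] at hw
  simp [hw]

/-- The end points of the edges of the Cayley tree that leave or enter `C`. -/
def boundary (C : Set (FreeGroup X)) : Set (FreeGroup X) :=
  {h | ∃ y, ¬(h ∈ C ↔ h * mk [y] ∈ C)}

/-- Membership in `C` must change at some step of the geodesic from `a` to `b`. -/
theorem exists_between_mem_boundary {C : Set (FreeGroup X)} {a b : FreeGroup X}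
    (h : ¬(a ∈ C ↔ b ∈ C)) : ∃ k ∈ boundary C, Between a k b := by
  by_contra! hn
  have key : ∀ L₁ L₂, (a⁻¹ * b).toWord = L₁ ++ L₂ → (a ∈ C ↔ a * mk L₁ ∈ C) := by
    intro L₁
    induction L₁ using List.reverseRecOn with
    | nil => simp [← one_eq_mk]
    | append_singleton L y ih =>
      intro L₂ hL
      rw [List.append_assoc] at hL
      have h1 : a * mk L ∉ boundary C := fun hk =>
        hn _ hk (between_iff_exists.2 ⟨_, _, hL, rfl⟩)
      simp only [boundary, Set.mem_ofPred_eq, not_exists, not_not] at h1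
      rw [ih _ hL, h1 y, mul_assoc, mul_mk]
  refine h ((key (a⁻¹ * b).toWord [] (by simp)).trans ?_)
  rw [mk_toWord, mul_inv_cancel_left]

/-- A half tree is convex, so a geodesic inside it cannot meet a boundary that is disjoint from it.
This is how a finite boundary controls the ends of the tree. -/
theorem mem_iff_of_disjoint_boundary {C : Set (FreeGroup X)} {h : FreeGroup X} {y : X × Bool}
    (hK : ∀ k ∈ boundary C, k ∉ halfTree h y) {c d : FreeGroup X} (hc : c ∈ halfTree h y)
    (hd : d ∈ halfTree h y) : c ∈ C ↔ d ∈ C := by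
  by_contra hn
  obtain ⟨k, hk, hb⟩ := exists_between_mem_boundary hn
  exact hK k hk (hb.mem_of_mem hc hd)

omit [DecidableEq X] in
theorem boundary_compl (C : Set (FreeGroup X)) : boundary Cᶜ = boundary C := by
  simp [boundary, not_iff_not]

/-- An edge from `h` to `h * y` is sent to the translate by `φ h` of the segment from `1` to `φ y`.
For each of the finitely many letters only finitely many of these translates cross the given edge.
-/
theorem finite_boundary_preimage_halfTree [Finite X] (φ : FreeGroup X ≃* FreeGroup X)
    (g : FreeGroup X) (x : X × Bool) : (boundary (φ ⁻¹' halfTree g x)).Finite := by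
  have h : ∀ y : X × Bool, {h | ¬(h ∈ φ ⁻¹' halfTree g x ↔
      h * mk [y] ∈ φ ⁻¹' halfTree g x)}.Finite := by
    intro y
    refine (((finite_setOf_crossing 1 (φ (mk [y])) g x).union
      (finite_setOf_crossing (φ (mk [y])) 1 g x)).preimage
      (f := φ) φ.injective.injOn).subset ?_
    intro h hh
    simp only [Set.mem_preimage, Set.mem_ofPred_eq, _root_.map_mul, Set.mem_union, mul_one] at hh ⊢
    tauto
  refine (Set.finite_iUnion h).subset ?_
  rintro k ⟨y, hy⟩
  exact Set.mem_iUnion.2 ⟨y, hy⟩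

theorem finite_setOf_norm_le [Finite X] (n : ℕ) : {g : FreeGroup X | g.norm ≤ n}.Finite :=
  (List.finite_length_le (X × Bool) n).preimage toWord_injective.injOn

end FreeGroup

/-! ### Bi-infinite lines in the Cayley tree. -/

namespace FreeGroup

variable {X : Type*} [DecidableEq X]

theorem eq_of_between_self {a g : FreeGroup X} (h : Between a g a) : g = a := by
  by_contra hne
  obtain ⟨x, hx⟩ := exists_mem_halfTree hne
  exact h x hx hx

/-- A bi-infinite reduced path in the Cayley tree. -/
structure Line (X : Type*) where
  pt : ℤ → FreeGroup X
  letter : ℤ → X × Bool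
  step : ∀ i, pt (i + 1) = pt i * mk [letter i]
  red : ∀ i, letter (i + 1) ≠ barLetter (letter i)

namespace Line

variable (ℓ : Line X)

/-- The half tree that contains the points of the line after the `i`-th one. -/
def half (i : ℤ) : Set (FreeGroup X) := halfTree (ℓ.pt i) (ℓ.letter i)

theorem half_anti : Antitone ℓ.half := by
  refine antitone_int_of_succ_le fun i => ?_
  simp only [half, ℓ.step]
  exact halfTree_subset (ℓ.red i)

theorem pt_mem_half {i j : ℤ} : ℓ.pt j ∈ ℓ.half i ↔ i < j := by
  constructor
  · intro h
    by_contra! hji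
    exact self_notMem_halfTree _ _ (ℓ.half_anti hji h)
  · intro h
    have h1 : ℓ.pt (j - 1 + 1) ∈ ℓ.half (j - 1) := by
      rw [ℓ.step]
      exact mul_letter_mem_halfTree _ _
    rw [sub_add_cancel] at h1
    exact ℓ.half_anti (by omega) h1

theorem pt_injective : Function.Injective ℓ.pt := by
  intro i j h
  by_contra hne
  rcases lt_or_gt_of_ne hne with hlt | hlt
  · exact self_notMem_halfTree _ _ (h ▸ ℓ.pt_mem_half.2 hlt)
  · exact self_notMem_halfTree _ _ (h.symm ▸ ℓ.pt_mem_half.2 hlt)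

/-- The line with the opposite orientation. -/
def reverse : Line X where
  pt := fun i => ℓ.pt (-i)
  letter := fun i => barLetter (ℓ.letter (-i - 1))
  step := fun i => by
    have h := ℓ.step (-i - 1)
    rw [sub_add_cancel] at h
    rw [h, mul_assoc, ← inv_mk_singleton, mul_inv_cancel, mul_one]
    congr 1
    ring
  red := fun i h => by
    have h2 := ℓ.red (-(i + 1) - 1)
    rw [barLetter_barLetter] at h
    rw [h] at h2
    apply h2
    congr 1
    ring

omit [DecidableEq X] in
theorem mem_range_reverse {g : FreeGroup X} :
    g ∈ Set.range ℓ.reverse.pt ↔ g ∈ Set.range ℓ.pt := by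
  constructor
  · rintro ⟨i, rfl⟩
    exact ⟨-i, rfl⟩
  · rintro ⟨i, rfl⟩
    exact ⟨-i, by simp [reverse]⟩

theorem compl_half (i : ℤ) :
    halfTree (ℓ.pt i) (barLetter (ℓ.letter (i - 1))) = (ℓ.half (i - 1))ᶜ := by
  have h := ℓ.step (i - 1)
  rw [sub_add_cancel] at h
  rw [h, halfTree_barLetter]
  rfl

theorem between_pt {i j : ℤ} (h : i < j) {c : FreeGroup X} :
    Between c (ℓ.pt i) (ℓ.pt j) ↔ c ∉ ℓ.half i :=
  between_iff_of_mem (ℓ.pt_mem_half.2 h)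

theorem pt_between {i j : ℤ} (h : i < j) {d : FreeGroup X} :
    Between (ℓ.pt i) (ℓ.pt j) d ↔ d ∈ ℓ.half (j - 1) := by
  have h1 : ℓ.pt i ∈ halfTree (ℓ.pt j) (barLetter (ℓ.letter (j - 1))) := by
    rw [compl_half, Set.mem_compl_iff, pt_mem_half]
    omega
  refine (⟨Between.symm, Between.symm⟩ : _ ↔ Between d (ℓ.pt j) (ℓ.pt i)).trans ?_
  rw [between_iff_of_mem h1, compl_half, Set.mem_compl_iff, not_not]

theorem between_of_le {i k j : ℤ} (h₁ : i ≤ k) (h₂ : k ≤ j) :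
    Between (ℓ.pt i) (ℓ.pt k) (ℓ.pt j) := by
  rcases h₂.eq_or_lt with rfl | h
  · exact between_right _ _
  · rw [ℓ.between_pt h, pt_mem_half]
    omega

theorem exists_of_between {i j : ℤ} (h : i ≤ j) {g : FreeGroup X}
    (hg : Between (ℓ.pt i) g (ℓ.pt j)) : ∃ k, i ≤ k ∧ k ≤ j ∧ g = ℓ.pt k := by
  induction j, h using Int.leInduction with
  | base => exact ⟨i, le_rfl, le_rfl, eq_of_between_self hg⟩
  | succ j hij ih =>
    by_cases hne : g = ℓ.pt (j + 1)
    · exact ⟨j + 1, by omega, le_rfl, hne⟩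
    obtain ⟨k, h1, h2, h3⟩ := ih fun x hi hj => by
      obtain ⟨L₁, L₂, hw, h4⟩ := crossing_iff.1 ⟨hg x hi, hj⟩
      rw [ℓ.step, mul_inv_rev, inv_mul_cancel_right, inv_mk_singleton,
        IsReduced.singleton.toWord_mk_eq] at hw
      rcases L₁ with _ | ⟨y, L₁⟩
      · rw [← one_eq_mk, mul_one] at h4
        exact hne h4.symm
      · simp at hw
    exact ⟨k, h1, by omega, h3⟩

theorem between_iff {i j k : ℤ} (h : i ≤ j) :
    Between (ℓ.pt i) (ℓ.pt k) (ℓ.pt j) ↔ i ≤ k ∧ k ≤ j := by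
  refine ⟨fun hb => ?_, fun hk => ℓ.between_of_le hk.1 hk.2⟩
  obtain ⟨k', h1, h2, h3⟩ := ℓ.exists_of_between h hb
  rw [ℓ.pt_injective h3]
  exact ⟨h1, h2⟩

/-- While `k` stays ahead, each step along the line reduces its distance by one, which cannot go on
forever. -/
theorem eventually_notMem_half (k : FreeGroup X) : ∀ᶠ i in Filter.atTop, k ∉ ℓ.half i := by
  by_contra hn
  have hall : ∀ i, k ∈ ℓ.half i := by
    intro i
    by_contra hi
    exact hn (Filter.eventually_atTop.2 ⟨i, fun j hj hk => hi (ℓ.half_anti hj hk)⟩)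
  have hs : ∀ i, ((ℓ.pt i)⁻¹ * k).norm = 1 + ((ℓ.pt (i + 1))⁻¹ * k).norm := by
    intro i
    have hb : Between (ℓ.pt i) (ℓ.pt (i + 1)) k := by
      rw [ℓ.pt_between (by omega), add_sub_cancel_right]
      exact hall i
    rw [hb.norm_eq, ℓ.step, inv_mul_cancel_left, norm, IsReduced.singleton.toWord_mk_eq]
    rfl
  have hle : ∀ n : ℕ, n ≤ ((ℓ.pt 0)⁻¹ * k).norm ∧
      ((ℓ.pt 0)⁻¹ * k).norm = n + ((ℓ.pt n)⁻¹ * k).norm := by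
    intro n
    induction n with
    | zero => simp
    | succ n ih =>
      have := hs n
      push_cast
      omega
  have := (hle (((ℓ.pt 0)⁻¹ * k).norm + 1)).1
  omega

theorem eventually_disjoint_half {K : Set (FreeGroup X)} (hK : K.Finite) :
    ∀ᶠ i in Filter.atTop, ∀ k ∈ K, k ∉ ℓ.half i :=
  (Filter.eventually_all_finite hK).2 fun k _ => ℓ.eventually_notMem_half k

/-- Once `ℓ.half i` has left the finite boundary behind, it lies entirely inside or entirely outside
`B`, and one later point of the line in `B` decides which. -/
theorem exists_half_subset {B : Set (FreeGroup X)} (hK : (boundary B).Finite)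
    (hB : ∃ᶠ i in Filter.atTop, ℓ.pt i ∈ B) : ∃ i, ℓ.half i ⊆ B := by
  obtain ⟨i, hi⟩ := (ℓ.eventually_disjoint_half hK).exists
  obtain ⟨j, hj, hjB⟩ := (Filter.frequently_atTop.1 hB) (i + 1)
  exact ⟨i, fun c hc => (mem_iff_of_disjoint_boundary hi hc (ℓ.pt_mem_half.2 (by omega))).2 hjB⟩

theorem eventually_mem_of_frequently {B : Set (FreeGroup X)} (hK : (boundary B).Finite)
    (hB : ∃ᶠ i in Filter.atTop, ℓ.pt i ∈ B) : ∀ᶠ i in Filter.atTop, ℓ.pt i ∈ B := by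
  obtain ⟨i, hi⟩ := ℓ.exists_half_subset hK hB
  exact Filter.eventually_atTop.2 ⟨i + 1, fun j hj => hi (ℓ.pt_mem_half.2 (by omega))⟩

omit [DecidableEq X] in
theorem eventually_reverse {p : FreeGroup X → Prop} :
    (∀ᶠ i in Filter.atTop, p (ℓ.reverse.pt i)) ↔ ∀ᶠ i in Filter.atBot, p (ℓ.pt i) := by
  rw [← Filter.map_neg_atTop, Filter.eventually_map]
  rfl

omit [DecidableEq X] in
theorem eventually_reverse' {p : FreeGroup X → Prop} :
    (∀ᶠ i in Filter.atBot, p (ℓ.reverse.pt i)) ↔ ∀ᶠ i in Filter.atTop, p (ℓ.pt i) := by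
  rw [← Filter.map_neg_atBot, Filter.eventually_map]
  rfl

theorem eventually_mem_of_frequently_atBot {B : Set (FreeGroup X)} (hK : (boundary B).Finite)
    (hB : ∃ᶠ i in Filter.atBot, ℓ.pt i ∈ B) : ∀ᶠ i in Filter.atBot, ℓ.pt i ∈ B := by
  rw [← eventually_reverse]
  refine ℓ.reverse.eventually_mem_of_frequently hK fun h => hB ?_
  exact (ℓ.eventually_reverse (p := fun g => g ∉ B)).1 h

end Line

/-! ### Ideal pairs: smallest pair on a line, and bounds on minimal pairs. -/

/-- The segment from `a` to `b` is such that all points behind `a` lie in `A`, and all points beyond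
`b` lie in `B`. -/
structure IsIdealPair (A B : Set (FreeGroup X)) (a b : FreeGroup X) : Prop where
  left : ∀ c, Between c a b → c ∈ A
  right : ∀ d, Between a b d → d ∈ B

theorem IsIdealPair.left_mem {A B : Set (FreeGroup X)} {a b : FreeGroup X}
    (h : IsIdealPair A B a b) : a ∈ A := h.left a (between_left a b)

theorem IsIdealPair.right_mem {A B : Set (FreeGroup X)} {a b : FreeGroup X}
    (h : IsIdealPair A B a b) : b ∈ B := h.right b (between_right a b)

namespace Line

variable (ℓ : Line X) {A B : Set (FreeGroup X)}

/-- On a line the two conditions decouple, one depending on `i` alone and the other on `j` alone.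
The index `j - 1` is that of the edge which enters the `j`-th point. -/
theorem isIdealPair_iff {i j : ℤ} (h : i < j) :
    IsIdealPair A B (ℓ.pt i) (ℓ.pt j) ↔ (ℓ.half i)ᶜ ⊆ A ∧ ℓ.half (j - 1) ⊆ B := by
  constructor
  · intro hI
    exact ⟨fun c hc => hI.left c ((ℓ.between_pt h).2 hc),
      fun d hd => hI.right d ((ℓ.pt_between h).2 hd)⟩
  · rintro ⟨h1, h2⟩
    exact ⟨fun c hc => h1 ((ℓ.between_pt h).1 hc), fun d hd => h2 ((ℓ.pt_between h).1 hd)⟩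

theorem exists_compl_half_subset (hK : (boundary A).Finite)
    (hA : ∃ᶠ i in Filter.atBot, ℓ.pt i ∈ A) : ∃ i, (ℓ.half i)ᶜ ⊆ A := by
  obtain ⟨i, hi⟩ := ℓ.reverse.exists_half_subset hK (B := A)
    fun h => hA ((ℓ.eventually_reverse (p := fun g => g ∉ A)).1 h)
  have := ℓ.compl_half (-i)
  exact ⟨-i - 1, by rw [← this]; exact hi⟩

theorem IsIdealPair.lt (hAB : Disjoint A B) (hB : ∀ᶠ i in Filter.atTop, ℓ.pt i ∈ B) {i j : ℤ}
    (h : IsIdealPair A B (ℓ.pt i) (ℓ.pt j)) : i < j := by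
  by_contra! hji
  obtain ⟨k, hkB, hk⟩ := (hB.and (Filter.eventually_ge_atTop i)).exists
  exact Set.disjoint_left.1 hAB (h.left _ (ℓ.between_of_le hji hk).symm) hkB

/-- On a line with ends in `A` and `B` the ideal pairs are those that contain a certain one. -/
theorem exists_isIdealPair_iff (hAB : Disjoint A B) (hKA : (boundary A).Finite)
    (hKB : (boundary B).Finite) (hA : ∀ᶠ i in Filter.atBot, ℓ.pt i ∈ A)
    (hB : ∀ᶠ i in Filter.atTop, ℓ.pt i ∈ B) :
    ∃ i₀ j₀, i₀ < j₀ ∧ ∀ i j, IsIdealPair A B (ℓ.pt i) (ℓ.pt j) ↔ i ≤ i₀ ∧ j₀ ≤ j := by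
  obtain ⟨i₁, hi₁⟩ := ℓ.exists_compl_half_subset hKA hA.frequently
  obtain ⟨j₁, hj₁⟩ := ℓ.exists_half_subset hKB hB.frequently
  have hlt : ∀ i j, (ℓ.half i)ᶜ ⊆ A → ℓ.half (j - 1) ⊆ B → i < j := by
    intro i j hi hj
    by_contra! hji
    refine Set.disjoint_left.1 hAB (hi (a := ℓ.pt i) ?_) (hj (ℓ.pt_mem_half.2 (by omega)))
    rw [Set.mem_compl_iff, pt_mem_half]
    omega
  -- Disjointness of `A` and `B` bounds every admissible `i` by every admissible `j`, so the
  -- innermost choices exist.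
  obtain ⟨i₀, hi₀, hmax⟩ := Int.exists_greatest_of_bdd (P := fun i => (ℓ.half i)ᶜ ⊆ A)
    ⟨j₁ + 1, fun i hi => (hlt i (j₁ + 1) hi (by rwa [add_sub_cancel_right])).le⟩ ⟨i₁, hi₁⟩
  obtain ⟨j₀, hj₀, hmin⟩ := Int.exists_least_of_bdd (P := fun j => ℓ.half (j - 1) ⊆ B)
    ⟨i₁, fun j hj => (hlt i₁ j hi₁ hj).le⟩ ⟨j₁ + 1, by rwa [add_sub_cancel_right]⟩
  have h0 : i₀ < j₀ := hlt _ _ hi₀ hj₀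
  refine ⟨i₀, j₀, h0, fun i j => ⟨fun h => ?_, fun ⟨hi, hj⟩ => ?_⟩⟩
  · obtain ⟨h1, h2⟩ := (ℓ.isIdealPair_iff (IsIdealPair.lt ℓ hAB hB h)).1 h
    exact ⟨hmax i h1, hmin j h2⟩
  · refine (ℓ.isIdealPair_iff (by omega)).2 ⟨?_, ?_⟩
    · exact (Set.compl_subset_compl.2 (ℓ.half_anti hi)).trans hi₀
    · exact (ℓ.half_anti (by omega)).trans hj₀

end Line

/-- The segment from `a` to `b` meets the boundary of `C` in some `k₀`. If moving `a` one step
towards `b` is obstructed by `c`, there is also a boundary point `k` between `a` and `c`. Unless `a`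
is itself a boundary point, `a * mk [x]` lies between `k` and `k₀`. These have distance at most `2 *
N`, so `a * mk [x]` has norm at most `3 * N`, and the last step costs one more. -/
theorem norm_le_of_left_minimal {C : Set (FreeGroup X)} {N : ℕ} (hN : ∀ k ∈ boundary C, k.norm ≤ N)
    {a b : FreeGroup X} (ha : a ∈ C) (hb : b ∉ C) {x : X × Bool} (hx : b ∈ halfTree a x)
    (hmin : a * mk [x] ≠ b → ∃ c, Between c (a * mk [x]) b ∧ c ∉ C) : a.norm ≤ 3 * N + 1 := by
  by_cases hab : a * mk [x] = b
  · have := hN a ⟨x, by simp [ha, hab, hb]⟩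
    omega
  obtain ⟨c, hcb, hc⟩ := hmin hab
  obtain ⟨k₀, hk₀, hk₀b⟩ := exists_between_mem_boundary (C := C) (a := a) (b := b) (by simp [ha, hb])
  by_cases hk₀a : k₀ = a
  · have := hN k₀ hk₀
    subst hk₀a
    omega
  obtain ⟨k, hk, hkb⟩ := exists_between_mem_boundary (C := C) (a := a) (b := c) (by simp [ha, hc])
  have h1 : Between k (a * mk [x]) b := by
    intro y hky hby
    rcases hkb.mem_or_mem hky with h | h
    · have hy : y = barLetter x := by
        by_contra hy
        exact self_notMem_halfTree _ _ (halfTree_subset hy h)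
      rw [hy] at hby
      exact mem_halfTree_barLetter.1 hby hx
    · exact hcb y h hby
  have h2 : Between k (a * mk [x]) k₀ := by
    intro y hky hk₀y
    rcases hk₀b.mem_or_mem hk₀y with h | h
    · have hy : y = barLetter x := by
        by_contra hy
        exact self_notMem_halfTree _ _ (halfTree_subset hy h)
      rw [hy] at hk₀y
      obtain ⟨z, hz⟩ := exists_mem_halfTree (Ne.symm hk₀a)
      have hzx : z ≠ x := by
        rintro rfl
        exact mem_halfTree_barLetter.1 hk₀y hz
      rcases hk₀b.mem_or_mem hz with h' | h'
      · exact self_notMem_halfTree _ _ h'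
      · exact hzx (halfTree_letter_unique h' hx)
    · exact h1 y hky h
  have h3 := h2.norm_eq
  have h4 : (k⁻¹ * k₀).norm ≤ k.norm + k₀.norm := by
    simpa using norm_mul_le k⁻¹ k₀
  have h5 : (a * mk [x]).norm ≤ k.norm + (k⁻¹ * (a * mk [x])).norm := by
    simpa using norm_mul_le k (k⁻¹ * (a * mk [x]))
  have h6 : a.norm ≤ (a * mk [x]).norm + 1 := by
    have := norm_mul_le (a * mk [x]) (mk [barLetter x])
    rw [← inv_mk_singleton, mul_inv_cancel_right, norm_inv_eq] at this
    exact this.trans (Nat.add_le_add_left norm_mk_le _)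
  have := hN k hk
  have := hN k₀ hk₀
  omega

end FreeGroup

/-! ### Paths, folded graphs and morphisms. -/

namespace LabeledGraph

open FreeGroup

variable {X : Type*} {Γ Δ : LabeledGraph X}

theorem label_bar' (Γ : LabeledGraph X) (e : Γ.E) : Γ.label (Γ.bar e) = barLetter (Γ.label e) :=
  Γ.label_bar e

/-- The list of edges `p` is a path from `z` to `z'`. -/
def IsPath (Γ : LabeledGraph X) : Γ.V → List Γ.E → Γ.V → Prop
  | z, [], z' => z = z'
  | z, e :: p, z' => Γ.ι e = z ∧ IsPath Γ (Γ.ι (Γ.bar e)) p z'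

theorem isPath_append {z z' : Γ.V} {p q : List Γ.E} :
    Γ.IsPath z (p ++ q) z' ↔ ∃ y, Γ.IsPath z p y ∧ Γ.IsPath y q z' := by
  induction p generalizing z with
  | nil => simp [IsPath]
  | cons e p ih => simp [IsPath, ih, and_assoc]

theorem isPath_singleton (e : Γ.E) : Γ.IsPath (Γ.ι e) [e] (Γ.ι (Γ.bar e)) := ⟨rfl, rfl⟩

theorem IsPath.map (f : Hom Γ Δ) {z z' : Γ.V} {p : List Γ.E} (h : Γ.IsPath z p z') :
    Δ.IsPath (f.onV z) (p.map f.onE) (f.onV z') := by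
  induction p generalizing z with
  | nil => exact congrArg f.onV h
  | cons e p ih =>
    refine ⟨by rw [← f.map_ι, h.1], ?_⟩
    rw [← f.map_bar, ← f.map_ι]
    exact ih h.2

theorem map_label_map (f : Hom Γ Δ) (p : List Γ.E) :
    (p.map f.onE).map Δ.label = p.map Γ.label := by
  simp [Function.comp_def, f.map_label]

theorem IsPath.reverse {z z' : Γ.V} {p : List Γ.E} (h : Γ.IsPath z p z') :
    Γ.IsPath z' (p.map Γ.bar).reverse z := by
  induction p generalizing z with
  | nil => exact Eq.symm h
  | cons e p ih =>
    rw [List.map_cons, List.reverse_cons, isPath_append]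
    refine ⟨_, ih h.2, rfl, ?_⟩
    rw [Γ.bar_bar]
    exact h.1

theorem map_label_reverse (p : List Γ.E) :
    ((p.map Γ.bar).reverse).map Γ.label = invRev (p.map Γ.label) := by
  simp [invRev, Function.comp_def, Γ.label_bar]

/-- There is a path from `z` to `z'` whose label is `g` in the free group. -/
def Joins (Γ : LabeledGraph X) (z : Γ.V) (g : FreeGroup X) (z' : Γ.V) : Prop :=
  ∃ p, Γ.IsPath z p z' ∧ FreeGroup.mk (p.map Γ.label) = g

theorem joins_refl (z : Γ.V) : Γ.Joins z 1 z := ⟨[], rfl, rfl⟩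

theorem Joins.of_eq {z z' : Γ.V} {g h : FreeGroup X} (hj : Γ.Joins z g z') (e : g = h) :
    Γ.Joins z h z' := e ▸ hj

theorem Joins.trans {z₁ z₂ z₃ : Γ.V} {g h : FreeGroup X} (h₁ : Γ.Joins z₁ g z₂)
    (h₂ : Γ.Joins z₂ h z₃) : Γ.Joins z₁ (g * h) z₃ := by
  obtain ⟨p, hp, rfl⟩ := h₁
  obtain ⟨q, hq, rfl⟩ := h₂
  exact ⟨p ++ q, isPath_append.2 ⟨_, hp, hq⟩, by rw [List.map_append, mul_mk]⟩

theorem Joins.symm {z z' : Γ.V} {g : FreeGroup X} (h : Γ.Joins z g z') : Γ.Joins z' g⁻¹ z := by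
  obtain ⟨p, hp, rfl⟩ := h
  exact ⟨_, hp.reverse, by rw [map_label_reverse, inv_mk]⟩

theorem Joins.pow {z : Γ.V} {g : FreeGroup X} (h : Γ.Joins z g z) (n : ℕ) :
    Γ.Joins z (g ^ n) z := by
  induction n with
  | zero => simpa using joins_refl z
  | succ n ih => rw [pow_succ]; exact ih.trans h

theorem Joins.zpow {z : Γ.V} {g : FreeGroup X} (h : Γ.Joins z g z) (k : ℤ) :
    Γ.Joins z (g ^ k) z := by
  cases k with
  | ofNat n => simpa using h.pow n
  | negSucc n => rw [zpow_negSucc]; exact (h.pow _).symm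

theorem joins_edge (e : Γ.E) : Γ.Joins (Γ.ι e) (FreeGroup.mk [Γ.label e]) (Γ.ι (Γ.bar e)) :=
  ⟨[e], isPath_singleton e, rfl⟩

theorem Joins.map (f : Hom Γ Δ) {z z' : Γ.V} {g : FreeGroup X} (h : Γ.Joins z g z') :
    Δ.Joins (f.onV z) g (f.onV z') := by
  obtain ⟨p, hp, rfl⟩ := h
  exact ⟨_, hp.map f, by rw [map_label_map]⟩

/-- Distinct edges with the same initial vertex have distinct labels. -/
def Folded (Γ : LabeledGraph X) : Prop :=
  ∀ e f, Γ.ι e = Γ.ι f → Γ.label e = Γ.label f → e = f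

theorem folded_fold (Γ : LabeledGraph X) : Γ.fold.Folded := by
  rintro ⟨e⟩ ⟨f⟩ hv hl
  exact Quotient.sound (s := Γ.foldESetoid) ⟨Quotient.exact (s := Γ.foldVSetoid) hv, hl⟩

theorem Folded.path_unique (hΓ : Γ.Folded) {z z₁ z₂ : Γ.V} {p q : List Γ.E}
    (hp : Γ.IsPath z p z₁) (hq : Γ.IsPath z q z₂) (h : p.map Γ.label = q.map Γ.label) :
    p = q ∧ z₁ = z₂ := by
  induction p generalizing z q with
  | nil =>
    rcases q with _ | ⟨f, q⟩
    · exact ⟨rfl, hp.symm.trans hq⟩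
    · simp at h
  | cons e p ih =>
    rcases q with _ | ⟨f, q⟩
    · simp at h
    · simp only [List.map_cons, List.cons.injEq] at h
      obtain rfl := hΓ e f (hp.1.trans hq.1.symm) h.1
      obtain ⟨rfl, h2⟩ := ih hp.2 hq.2 h.2
      exact ⟨rfl, h2⟩

/-- In a folded graph two consecutive edges with inverse labels form a backtrack, so a cancellation
of labels is realized by deleting it from the path. -/
theorem Folded.exists_path_of_red (hΓ : Γ.Folded) {z z' : Γ.V} {L L' : List (X × Bool)}
    (hL : Red L L') (h : ∃ p, Γ.IsPath z p z' ∧ p.map Γ.label = L) :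
    ∃ p, Γ.IsPath z p z' ∧ p.map Γ.label = L' := by
  induction hL with
  | refl => exact h
  | tail _ hs ih =>
    obtain ⟨p, hp, hl⟩ := ih
    obtain @⟨L₁, L₂, x, b⟩ := hs
    obtain ⟨p₁, p₂, rfl, h1, h2⟩ := List.map_eq_append_iff.1 hl
    obtain ⟨e, p₃, rfl, he, h3⟩ := List.map_eq_cons_iff.1 h2
    obtain ⟨f, p₄, rfl, hf, h4⟩ := List.map_eq_cons_iff.1 h3
    obtain ⟨y, hy, hy'⟩ := isPath_append.1 hp
    have : f = Γ.bar e := hΓ _ _ hy'.2.1 (by rw [hf, label_bar, he])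
    subst this
    refine ⟨p₁ ++ p₄, isPath_append.2 ⟨y, hy, ?_⟩, by rw [List.map_append, h1, h4]⟩
    have h5 := hy'.2.2
    rwa [Γ.bar_bar, hy'.1] at h5

theorem Folded.exists_path [DecidableEq X] (hΓ : Γ.Folded) {z z' : Γ.V} {g : FreeGroup X}
    (h : Γ.Joins z g z') : ∃ p, Γ.IsPath z p z' ∧ p.map Γ.label = g.toWord := by
  obtain ⟨p, hp, rfl⟩ := h
  rw [toWord_mk]
  exact hΓ.exists_path_of_red reduce.red ⟨p, hp, rfl⟩

theorem Folded.joins_unique (hΓ : Γ.Folded) {z z₁ z₂ : Γ.V} {g : FreeGroup X}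
    (h₁ : Γ.Joins z g z₁) (h₂ : Γ.Joins z g z₂) : z₁ = z₂ := by
  classical
  obtain ⟨p, hp, hp'⟩ := hΓ.exists_path h₁
  obtain ⟨q, hq, hq'⟩ := hΓ.exists_path h₂
  exact (hΓ.path_unique hp hq (hp'.trans hq'.symm)).2

/-- Labels determine paths in a folded graph, so a morphism from a connected graph is rigid.
Equality of morphisms is thereby reduced to a single vertex. -/
theorem Folded.hom_ext (hΔ : Δ.Folded) {f g : Hom Γ Δ} {z₀ : Γ.V}
    (hc : ∀ z, ∃ a, Γ.Joins z₀ a z) (h : f.onV z₀ = g.onV z₀) : f = g := by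
  have hV : ∀ z, f.onV z = g.onV z := by
    intro z
    obtain ⟨a, ha⟩ := hc z
    exact hΔ.joins_unique (ha.map f) (h ▸ ha.map g)
  refine Hom.ext (funext hV) (funext fun e => hΔ _ _ ?_ ?_)
  · rw [← f.map_ι, ← g.map_ι, hV]
  · rw [f.map_label, g.map_label]

theorem Hom.exists_factor (j : Hom Γ Δ) (hV : Function.Injective j.onV)
    (hE : Function.Injective j.onE) {Ξ : LabeledGraph X} (f : Hom Ξ Δ)
    (hfV : ∀ z, f.onV z ∈ Set.range j.onV) (hfE : ∀ e, f.onE e ∈ Set.range j.onE) :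
    ∃ f', j.comp f' = f := by
  choose V hV' using hfV
  choose E hE' using hfE
  refine ⟨⟨V, E, fun e => hV ?_, fun e => hE ?_, fun e => ?_⟩, Hom.ext (funext hV') (funext hE')⟩
  · rw [hV', j.map_ι, hE', f.map_ι]
  · rw [hE', j.map_bar, hE', f.map_bar]
  · rw [← j.map_label, hE', f.map_label]

theorem Hom.comp_injective (j : Hom Γ Δ) (hV : Function.Injective j.onV)
    (hE : Function.Injective j.onE) {Ξ : LabeledGraph X} {f f' : Hom Ξ Γ}
    (h : j.comp f = j.comp f') : f = f' := by
  have h1 := congrArg Hom.onV h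
  have h2 := congrArg Hom.onE h
  exact Hom.ext (funext fun z => hV (congrFun h1 z)) (funext fun e => hE (congrFun h2 e))

theorem IsPath.start_eq {z z' : Γ.V} {p : List Γ.E} (h : Γ.IsPath z p z') (hp : 0 < p.length) :
    Γ.ι p[0] = z := by
  rcases p with _ | ⟨e, p⟩
  · simp at hp
  · exact h.1

theorem IsPath.succ_eq {z z' : Γ.V} {p : List Γ.E} (h : Γ.IsPath z p z') {i : ℕ}
    (hi : i + 1 < p.length) : Γ.ι (Γ.bar p[i]) = Γ.ι p[i + 1] := by
  rw [← List.take_append_drop i p, isPath_append] at h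
  obtain ⟨y, h1, h2⟩ := h
  rw [List.drop_eq_getElem_cons (by omega), List.drop_eq_getElem_cons hi] at h2
  exact h2.2.1.symm

theorem IsPath.last_eq {z z' : Γ.V} {p : List Γ.E} (h : Γ.IsPath z p z') {i : ℕ}
    (hi : i + 1 = p.length) : Γ.ι (Γ.bar (p[i]'(by omega))) = z' := by
  rw [← List.take_append_drop i p, isPath_append] at h
  obtain ⟨y, h1, h2⟩ := h
  rw [List.drop_eq_getElem_cons (by omega), List.drop_eq_nil_of_le (by omega)] at h2
  exact h2.2

/-- A path gives a morphism from a segment. -/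
theorem exists_hom_line {z z' : Γ.V} {p : List Γ.E} (h : Γ.IsPath z p z')
    {L : List (X × Bool)} (hL : p.map Γ.label = L) : ∃ f : Hom (line L) Γ,
      f.onV (0 : Fin (L.length + 1)) = z ∧
      ∀ i : Fin L.length, f.onE (i, true) = p[i.1]'(by have := i.2; simpa [← hL] using this) := by
  subst hL
  have hlen : ∀ i : Fin (p.map Γ.label).length, i.1 < p.length := fun i => by simpa using i.2
  refine ⟨{ onV := fun i => if hi : i.1 < p.length then Γ.ι p[i.1] else z'
            onE := fun e => if e.2 then p[e.1.1]'(hlen e.1) else Γ.bar (p[e.1.1]'(hlen e.1))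
            map_ι := ?_
            map_bar := ?_
            map_label := ?_ }, ?_, fun i => rfl⟩
  · rintro ⟨i, _ | _⟩
    · have hi := hlen i
      change (if hi : i.1 + 1 < p.length then Γ.ι p[i.1 + 1] else z') = Γ.ι (Γ.bar p[i.1])
      by_cases h1 : i.1 + 1 < p.length
      · rw [dif_pos h1]
        exact (h.succ_eq h1).symm
      · rw [dif_neg h1]
        exact (h.last_eq (i := i.1) (by omega)).symm
    · have hi := hlen i
      simp [line, hi]
  · rintro ⟨i, _ | _⟩
    · simp [line, Γ.bar_bar]
    · simp [line]
  · rintro ⟨i, _ | _⟩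
    · simp [line, Γ.label_bar]
    · simp [line]
  · change (if hi : 0 < p.length then Γ.ι p[0] else z') = z
    split_ifs with h1
    · exact h.start_eq h1
    · have : p = [] := List.length_eq_zero_iff.1 (by omega)
      subst this
      exact Eq.symm h

/-- A closed path gives a morphism from a circle. -/
theorem exists_hom_circle {z : Γ.V} {p : List Γ.E} (h : Γ.IsPath z p z)
    {L : List (X × Bool)} (hL : p.map Γ.label = L) : ∃ f : Hom (circle L) Γ,
      ∀ i : Fin L.length, f.onE (i, true) = p[i.1]'(by have := i.2; simpa [← hL] using this) := by
  subst hL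
  have hlen : ∀ i : Fin (p.map Γ.label).length, i.1 < p.length := fun i => by simpa using i.2
  refine ⟨{ onV := fun i => Γ.ι (p[i.1]'(hlen i))
            onE := fun e => if e.2 then p[e.1.1]'(hlen e.1) else Γ.bar (p[e.1.1]'(hlen e.1))
            map_ι := ?_
            map_bar := ?_
            map_label := ?_ }, fun i => rfl⟩
  · rintro ⟨i, _ | _⟩
    · have hi := hlen i
      have hlen' : (p.map Γ.label).length = p.length := by simp
      simp only [circle, Bool.false_eq_true, if_false, hlen']
      rcases Nat.lt_or_ge (i.1 + 1) p.length with h1 | h1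
      · simp only [Nat.mod_eq_of_lt h1]
        exact (h.succ_eq h1).symm
      · have h2 : i.1 + 1 = p.length := by omega
        simp only [h2, Nat.mod_self]
        rw [h.start_eq (by omega), h.last_eq h2]
    · simp [circle]
  · rintro ⟨i, _ | _⟩
    · simp [circle, Γ.bar_bar]
    · simp [circle]
  · rintro ⟨i, _ | _⟩
    · simp [circle, Γ.label_bar]
    · simp [circle]

/-! ### Reduced paths in folded graphs -/

theorem Folded.follows_iff (hΓ : Γ.Folded) {e f : Γ.E} :
    Γ.Follows e f ↔ Γ.ι (Γ.bar e) = Γ.ι f ∧ Γ.label f ≠ barLetter (Γ.label e) := by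
  constructor
  · rintro ⟨h1, h2⟩
    exact ⟨h1, fun h => h2 (hΓ _ _ h1.symm (by rw [label_bar', h]))⟩
  · rintro ⟨h1, h2⟩
    refine ⟨h1, ?_⟩
    rintro rfl
    exact h2 (label_bar' _ _)

theorem Folded.isChain_follows_iff (hΓ : Γ.Folded) {e : Γ.E} {p : List Γ.E} :
    (e :: p).IsChain Γ.Follows ↔
      (∃ z, Γ.IsPath (Γ.ι e) (e :: p) z) ∧ IsReduced ((e :: p).map Γ.label) := by
  induction p generalizing e with
  | nil => simp [IsPath]
  | cons f p ih =>
    rw [List.isChain_cons_cons, hΓ.follows_iff, ih, List.map_cons, List.map_cons, List.map_cons,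
      FreeGroup.isReduced_cons_cons, ← ne_barLetter_iff]
    constructor
    · rintro ⟨⟨h1, h2⟩, ⟨z, h3⟩, h4⟩
      exact ⟨⟨z, rfl, h1.symm, h3.2⟩, h2, h4⟩
    · rintro ⟨⟨z, h1⟩, h2, h3⟩
      exact ⟨⟨h1.2.1.symm, h2⟩, ⟨z, rfl, h1.2.2⟩, h3⟩

theorem IsPath.getLast?_eq {z z' : Γ.V} {p : List Γ.E} (hp : p ≠ []) (h : Γ.IsPath z p z') :
    p.getLast?.map (fun c => Γ.ι (Γ.bar c)) = some z' := by
  obtain ⟨q, e, rfl⟩ := List.eq_nil_or_concat p |>.resolve_left hp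
  rw [List.concat_eq_append] at h ⊢
  obtain ⟨y, -, h2⟩ := isPath_append.1 h
  have h3 : Γ.ι (Γ.bar e) = z' := h2.2
  simp [h3]

theorem Folded.mem_geodesicEdges_iff (hΓ : Γ.Folded) {a b : Γ.V} {e : Γ.E} :
    e ∈ Γ.geodesicEdges a b ↔
      ∃ p, Γ.IsPath a p b ∧ IsReduced (p.map Γ.label) ∧ e ∈ p := by
  constructor
  · rintro ⟨_ | ⟨f, p⟩, h1, h2, h3, h4⟩
    · simp at h4
    · obtain ⟨⟨z, hz⟩, hr⟩ := hΓ.isChain_follows_iff.1 h1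
      have hz' := hz.getLast?_eq (by simp)
      rw [h3] at hz'
      simp only [List.head?_cons, Option.map_some, Option.some.injEq] at h2 hz'
      subst h2 hz'
      exact ⟨_, hz, hr, h4⟩
  · rintro ⟨_ | ⟨f, p⟩, h1, h2, h3⟩
    · simp at h3
    · refine ⟨_, hΓ.isChain_follows_iff.2 ⟨⟨b, rfl, h1.2⟩, h2⟩, ?_, h1.getLast?_eq (by simp), h3⟩
      simp [h1.1]

theorem Folded.mem_coreEdges_iff (hΓ : Γ.Folded) {e : Γ.E} :
    e ∈ Γ.coreEdges ↔
      ∃ z p, Γ.IsPath z p z ∧ IsCyclicallyReduced (p.map Γ.label) ∧ e ∈ p := by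
  constructor
  · rintro ⟨_ | ⟨f, p⟩, h1, h2, h3⟩
    · simp at h3
    · obtain ⟨⟨z, hz⟩, hr⟩ := hΓ.isChain_follows_iff.1 h1
      obtain ⟨l, hl⟩ : ∃ l, (f :: p).getLast? = some l := by
        rw [← Option.isSome_iff_exists]
        simp
      have hz' := hz.getLast?_eq (by simp)
      obtain ⟨h4, h5⟩ := hΓ.follows_iff.1 (h2 l hl f rfl)
      rw [hl, Option.map_some, Option.some.injEq, h4] at hz'
      subst hz'
      refine ⟨_, _, hz, ⟨hr, ?_⟩, h3⟩
      intro a ha b hb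
      rw [List.getLast?_map, hl] at ha
      simp only [Option.map_some, Option.mem_def, Option.some.injEq, List.map_cons,
        List.head?_cons] at ha hb
      subst ha hb
      exact ne_barLetter_iff.1 h5
  · rintro ⟨z, _ | ⟨f, p⟩, h1, h2, h3⟩
    · simp at h3
    · refine ⟨_, hΓ.isChain_follows_iff.2 ⟨⟨z, rfl, h1.2⟩, h2.1⟩, ?_, h3⟩
      intro c hc d hd
      have h4 := h1.getLast?_eq (by simp)
      rw [Option.mem_def.1 hc, Option.map_some, Option.some.injEq] at h4
      rw [List.head?_cons, Option.mem_def, Option.some.injEq] at hd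
      subst hd
      refine hΓ.follows_iff.2 ⟨h4.trans h1.1.symm, ne_barLetter_iff.2 ?_⟩
      refine h2.2 _ ?_ _ (by simp)
      rw [List.getLast?_map, Option.mem_def.1 hc]
      rfl

/-! ### Developments -/

/-- The relation `R` presents the Cayley subtree that covers `Γ`: `R z g` says that the point `g`
lies over the vertex `z`. The deck transformations are the powers of `c`. -/
structure Develops (Γ : LabeledGraph X) (R : Γ.V → FreeGroup X → Prop) (c : FreeGroup X) :
    Prop where
  total : ∀ z, ∃ g, R z g
  step : ∀ e g, R (Γ.ι e) g → R (Γ.ι (Γ.bar e)) (g * FreeGroup.mk [Γ.label e])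
  deck : ∀ z g g', R z g → R z g' → ∃ k : ℤ, g' = c ^ k * g
  shift : ∀ z g (k : ℤ), R z g → R z (c ^ k * g)
  conn : ∀ z g z' g', R z g → R z' g' → Γ.Joins z (g⁻¹ * g') z'

namespace Develops

variable {R : Γ.V → FreeGroup X → Prop} {c : FreeGroup X} (D : Develops Γ R c)
include D

theorem path {z z' : Γ.V} {p : List Γ.E} {g : FreeGroup X} (h : Γ.IsPath z p z') (hz : R z g) :
    R z' (g * FreeGroup.mk (p.map Γ.label)) := by
  induction p generalizing z g with
  | nil =>
    obtain rfl : z = z' := h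
    simpa [← one_eq_mk] using hz
  | cons e p ih =>
    have h1 := ih h.2 (D.step e g (h.1 ▸ hz))
    rwa [mul_assoc, mul_mk] at h1

theorem joins {z z' : Γ.V} {g h : FreeGroup X} (hj : Γ.Joins z h z') (hz : R z g) :
    R z' (g * h) := by
  obtain ⟨p, hp, rfl⟩ := hj
  exact D.path hp hz

theorem step_iff (e : Γ.E) (g : FreeGroup X) :
    R (Γ.ι (Γ.bar e)) (g * FreeGroup.mk [Γ.label e]) ↔ R (Γ.ι e) g := by
  refine ⟨fun h => ?_, D.step e g⟩
  have := D.joins (joins_edge e).symm h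
  rwa [mul_inv_cancel_right] at this

/-- Vertices under the same point are joined by a path with trivial label, which in a folded graph
reduces to the empty path. -/
theorem inj (hΓ : Γ.Folded) {z z' : Γ.V} {g : FreeGroup X} (h : R z g) (h' : R z' g) : z = z' := by
  have := D.conn _ _ _ _ h h'
  rw [inv_mul_cancel] at this
  exact hΓ.joins_unique (joins_refl z) this

theorem map {R' : Δ.V → FreeGroup X → Prop} {c' : FreeGroup X} (D' : Develops Δ R' c')
    (f : Hom Γ Δ) {z₀ : Γ.V} {g₀ : FreeGroup X} (h : R z₀ g₀) (h' : R' (f.onV z₀) g₀) {z : Γ.V}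
    {g : FreeGroup X} (hz : R z g) : R' (f.onV z) g := by
  have := D'.joins ((D.conn _ _ _ _ h hz).map f) h'
  rwa [mul_inv_cancel_left] at this

theorem translate (t : FreeGroup X) :
    Develops Γ (fun z g => R z (t * g)) (t⁻¹ * c * t) where
  total z := by
    obtain ⟨g, hg⟩ := D.total z
    exact ⟨t⁻¹ * g, by rwa [mul_inv_cancel_left]⟩
  step e g h := by
    rw [← mul_assoc]
    exact D.step e _ h
  deck z g g' h h' := by
    obtain ⟨k, hk⟩ := D.deck z _ _ h h'
    refine ⟨k, ?_⟩
    have : (t⁻¹ * c * t) ^ k = t⁻¹ * c ^ k * t := by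
      simpa using (conj_zpow (i := k) (a := t⁻¹) (b := c))
    rw [this, eq_inv_mul_of_mul_eq hk]
    group
  shift z g k h := by
    have : (t⁻¹ * c * t) ^ k = t⁻¹ * c ^ k * t := by
      simpa using (conj_zpow (i := k) (a := t⁻¹) (b := c))
    rw [this]
    have := D.shift z _ k h
    convert this using 1
    group
  conn z g z' g' h h' := by
    have := D.conn _ _ _ _ h h'
    convert this using 1
    group

end Develops

end LabeledGraph

/-! ### Developments of segments, circles and folded graphs. -/

namespace LabeledGraph

open FreeGroup

variable {X : Type*}

theorem getElem_succ_ne {L : List (X × Bool)} (h : IsReduced L) {i : ℕ} (hi : i + 1 < L.length) :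
    L[i + 1] ≠ barLetter L[i] :=
  ne_barLetter_iff.2 (List.isChain_iff_getElem.1 h i hi)

theorem getElem_zero_ne {L : List (X × Bool)} (h : IsCyclicallyReduced L) {i : ℕ}
    (hi : i + 1 = L.length) : L[0] ≠ barLetter L[i] := by
  refine ne_barLetter_iff.2 (h.2 _ ?_ _ ?_)
  · rw [List.getLast?_eq_getElem?, Option.mem_def, List.getElem?_eq_some_iff]
    exact ⟨by omega, by congr 1; omega⟩
  · rw [List.head?_eq_getElem?, Option.mem_def, List.getElem?_eq_some_iff]
    exact ⟨by omega, rfl⟩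

theorem getElem_mod_succ_ne {L : List (X × Bool)} (h : IsCyclicallyReduced L) {i : ℕ}
    (hi : i < L.length) :
    L[(i + 1) % L.length]'(Nat.mod_lt _ (by omega)) ≠ barLetter L[i] := by
  rcases Nat.lt_or_ge (i + 1) L.length with h1 | h1
  · simp only [Nat.mod_eq_of_lt h1]
    exact getElem_succ_ne h.1 h1
  · have h2 : i + 1 = L.length := by omega
    simp only [h2, Nat.mod_self]
    exact getElem_zero_ne h h2

/-! ### Segments -/

theorem label_line_true (L : List (X × Bool)) (i : Fin L.length) :
    (line L).label (i, true) = L[i.1] := rfl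

theorem folded_line {L : List (X × Bool)} (h : IsReduced L) : (line L).Folded := by
  have key : ∀ i j : Fin L.length, i.castSucc = j.succ →
      L[i.1] = barLetter L[j.1] → False := by
    intro i j hij hl
    have h1 : i.1 = j.1 + 1 := congrArg Fin.val hij
    have h2 := i.2
    simp only [h1] at hl
    exact getElem_succ_ne h (by omega) hl
  rintro ⟨i, _ | _⟩ ⟨j, _ | _⟩ hι hl
  · have h1 : i = j := Fin.succ_injective _ hι
    rw [h1]
  · refine (key j i (Eq.symm hι) ?_).elim
    exact Eq.symm hl
  · exact (key i j hι hl).elim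
  · have h1 : i = j := Fin.castSucc_injective _ hι
    rw [h1]

theorem joins_line (L : List (X × Bool)) (i : ℕ) (hi : i < L.length + 1) :
    (line L).Joins (0 : Fin (L.length + 1)) (FreeGroup.mk (L.take i))
      (⟨i, hi⟩ : Fin (L.length + 1)) := by
  induction i with
  | zero => exact joins_refl _
  | succ i ih =>
    have hi' : i < L.length := by omega
    have h1 := (ih (by omega)).trans (joins_edge (Γ := line L) (⟨i, hi'⟩, true))
    rwa [label_line_true, mul_mk, List.take_concat_get' _ _ hi'] at h1

theorem connected_line (L : List (X × Bool)) (z : (line L).V) :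
    ∃ a, (line L).Joins (0 : Fin (L.length + 1)) a z :=
  ⟨_, joins_line L z.1 z.2⟩

/-- The development of a segment that starts at `a`. -/
def lineDev (L : List (X × Bool)) (a : FreeGroup X) (z : (line L).V) (g : FreeGroup X) : Prop :=
  g = a * FreeGroup.mk (L.take (Fin.val (n := L.length + 1) z))

theorem develops_line (L : List (X × Bool)) (a : FreeGroup X) :
    Develops (line L) (lineDev L a) 1 where
  total z := ⟨_, rfl⟩
  step := by
    rintro ⟨i, _ | _⟩ g h
    · have h' : g = a * FreeGroup.mk (L.take (i.1 + 1)) := h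
      change g * _ = a * FreeGroup.mk (L.take i.1)
      have h2 : (line L).label (i, false) = barLetter L[i.1] := rfl
      rw [h', h2, ← List.take_concat_get' _ _ i.2, ← mul_mk, ← inv_mk_singleton, mul_assoc,
        mul_assoc, mul_inv_cancel, mul_one]
    · have h' : g = a * FreeGroup.mk (L.take i.1) := h
      change g * _ = a * FreeGroup.mk (L.take (i.1 + 1))
      rw [h', label_line_true, ← List.take_concat_get' _ _ i.2, ← mul_mk, mul_assoc]
  deck z g g' h h' := ⟨0, by rw [h, h']; simp⟩
  shift z g k h := by simpa using h
  conn z g z' g' h h' := by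
    rw [h, h']
    exact ((joins_line L z.1 z.2).symm.trans (joins_line L z'.1 z'.2)).of_eq (by group)

theorem exists_lineDev_iff [DecidableEq X] {L : List (X × Bool)} (hL : IsReduced L)
    {a g : FreeGroup X} :
    (∃ z, lineDev L a z g) ↔ Between a g (a * FreeGroup.mk L) := by
  rw [between_iff_exists, inv_mul_cancel_left, hL.toWord_mk_eq]
  constructor
  · rintro ⟨z, rfl⟩
    exact ⟨_, _, (List.take_append_drop z.1 L).symm, rfl⟩
  · rintro ⟨L₁, L₂, rfl, rfl⟩
    exact ⟨(⟨L₁.length, by simp⟩ : Fin ((L₁ ++ L₂).length + 1)), by simp [lineDev]⟩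

/-! ### Circles -/

theorem label_circle_true (L : List (X × Bool)) (i : Fin L.length) :
    (circle L).label (i, true) = L[i.1] := rfl

theorem folded_circle {L : List (X × Bool)} (h : IsCyclicallyReduced L) : (circle L).Folded := by
  have key : ∀ i j : Fin L.length, i.1 = (j.1 + 1) % L.length →
      L[i.1] = barLetter L[j.1] → False := by
    intro i j hij hl
    simp only [hij] at hl
    exact getElem_mod_succ_ne h j.2 hl
  rintro ⟨i, _ | _⟩ ⟨j, _ | _⟩ hι hl
  · have h1 : (i.1 + 1) % L.length = (j.1 + 1) % L.length := congrArg Fin.val hι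
    have h2 : i = j := by
      have h3 : i.1 ≡ j.1 [MOD L.length] := Nat.ModEq.add_right_cancel' 1 h1
      exact Fin.ext (Nat.ModEq.eq_of_lt_of_lt h3 i.2 j.2)
    rw [h2]
  · exact (key j i (congrArg Fin.val (Eq.symm hι)) (Eq.symm hl)).elim
  · exact (key i j (congrArg Fin.val hι) hl).elim
  · have h1 : i = j := hι
    rw [h1]

theorem joins_circle (L : List (X × Bool)) (hL : 0 < L.length) (i : ℕ) (hi : i ≤ L.length) :
    (circle L).Joins (⟨0, hL⟩ : Fin L.length) (FreeGroup.mk (L.take i))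
      (⟨i % L.length, Nat.mod_lt _ hL⟩ : Fin L.length) := by
  induction i with
  | zero =>
    simp only [Nat.zero_mod]
    exact joins_refl _
  | succ i ih =>
    have hi' : i < L.length := by omega
    have h0 := ih (by omega)
    simp only [Nat.mod_eq_of_lt hi'] at h0
    have h1 := h0.trans (joins_edge (Γ := circle L) (⟨i, hi'⟩, true))
    rwa [label_circle_true, mul_mk, List.take_concat_get' _ _ hi'] at h1

/-- The development of a circle that sends the initial vertex to `a` and its translates. -/
def circleDev (L : List (X × Bool)) (a : FreeGroup X) (z : (circle L).V) (g : FreeGroup X) : Prop :=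
  ∃ k : ℤ, g = a * FreeGroup.mk L ^ k * FreeGroup.mk (L.take (Fin.val (n := L.length) z))

/-- The value `i = L.length` is allowed: it is the initial vertex again, and one more turn is
absorbed in the exponent `k`. -/
theorem circleDev_iff {L : List (X × Bool)} (a : FreeGroup X) {i : ℕ} (hi : i ≤ L.length)
    (hL : 0 < L.length) {g : FreeGroup X} :
    circleDev L a (⟨i % L.length, Nat.mod_lt _ hL⟩ : Fin L.length) g ↔
      ∃ k : ℤ, g = a * FreeGroup.mk L ^ k * FreeGroup.mk (L.take i) := by
  rcases hi.lt_or_eq with h | h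
  · simp only [circleDev, Nat.mod_eq_of_lt h]
  · simp only [circleDev, h, Nat.mod_self, List.take_zero, List.take_length]
    constructor
    · rintro ⟨k, rfl⟩
      refine ⟨k - 1, ?_⟩
      rw [mul_assoc _ _ (FreeGroup.mk L), ← zpow_add_one, sub_add_cancel, ← one_eq_mk, mul_one]
    · rintro ⟨k, rfl⟩
      refine ⟨k + 1, ?_⟩
      rw [zpow_add_one, ← one_eq_mk, mul_one, mul_assoc]

theorem develops_circle (L : List (X × Bool)) (hL : 0 < L.length) (a : FreeGroup X) :
    Develops (circle L) (circleDev L a) (a * FreeGroup.mk L * a⁻¹) where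
  total z := ⟨_, 0, rfl⟩
  step := by
    rintro ⟨i, _ | _⟩ g h
    · obtain ⟨k, hk⟩ := (circleDev_iff a (i := i.1 + 1) i.2 hL).1 h
      refine ⟨k, ?_⟩
      change g * _ = a * _ * FreeGroup.mk (L.take i.1)
      have h2 : (circle L).label (i, false) = barLetter L[i.1] := rfl
      rw [hk, h2, ← List.take_concat_get' _ _ i.2, ← mul_mk, ← inv_mk_singleton]
      group
    · obtain ⟨k, hk⟩ := h
      have hk' : g = a * FreeGroup.mk L ^ k * FreeGroup.mk (L.take i.1) := hk
      refine (circleDev_iff a (i := i.1 + 1) i.2 hL).2 ⟨k, ?_⟩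
      rw [hk', label_circle_true, ← List.take_concat_get' _ _ i.2, ← mul_mk, mul_assoc, mul_assoc]
  deck := by
    rintro z _ _ ⟨k, rfl⟩ ⟨l, rfl⟩
    refine ⟨l - k, ?_⟩
    rw [conj_zpow, zpow_sub]
    group
  shift := by
    rintro z _ l ⟨k, rfl⟩
    refine ⟨l + k, ?_⟩
    rw [conj_zpow, zpow_add]
    group
  conn := by
    rintro z _ z' _ ⟨k, rfl⟩ ⟨l, rfl⟩
    have h : ∀ z : (circle L).V, (circle L).Joins (⟨0, hL⟩ : Fin L.length)
        (FreeGroup.mk (L.take (Fin.val (n := L.length) z))) z := by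
      intro z
      have := joins_circle L hL z.1 z.2.le
      simp only [Nat.mod_eq_of_lt z.2] at this
      exact this
    have h0 := joins_circle L hL L.length le_rfl
    simp only [Nat.mod_self, List.take_length] at h0
    refine (((h z).symm.trans (h0.zpow (l - k))).trans (h z')).of_eq ?_
    rw [zpow_sub]
    group

/-- The line that covers a circle. -/
def circleLine {L : List (X × Bool)} (h : IsCyclicallyReduced L) (hL : 0 < L.length)
    (a : FreeGroup X) : Line X where
  pt i := a * FreeGroup.mk L ^ (i / L.length) * FreeGroup.mk (L.take (i % L.length).toNat)
  letter i := L[(i % L.length).toNat]'(by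
    have := Int.emod_lt_of_pos i (b := L.length) (by omega)
    omega)
  step i := by
    have hL' : (0 : ℤ) < L.length := by omega
    have hm := Int.emod_lt_of_pos i hL'
    have hp := Int.emod_nonneg i hL'.ne'
    have hd := Int.emod_add_mul_ediv i L.length
    rcases lt_or_ge (i % L.length + 1) (L.length : ℤ) with h1 | h1
    · obtain ⟨h2, h3⟩ := (Int.ediv_emod_unique (a := i + 1) (r := i % L.length + 1)
        (q := i / L.length) hL').2 ⟨by omega, by omega, h1⟩
      rw [h2, h3, Int.toNat_add hp (by omega), Int.toNat_one,
        ← List.take_concat_get' _ _ (by omega), ← mul_mk, ← mul_assoc]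
    -- The step completes a period: the remainder returns to zero and the full word becomes one more
    -- power.
    · obtain ⟨h2, h3⟩ := (Int.ediv_emod_unique (a := i + 1) (r := 0)
        (q := i / L.length + 1) hL').2 ⟨by rw [mul_add]; omega, le_rfl, hL'⟩
      rw [h2, h3, Int.toNat_zero, List.take_zero, ← one_eq_mk, mul_one, zpow_add_one, mul_assoc,
        mul_assoc, mul_mk, List.take_concat_get' _ _ (by omega), List.take_of_length_le (by omega)]
  red i := by
    have hL' : (0 : ℤ) < L.length := by omega
    have hm := Int.emod_lt_of_pos i hL'
    have hp := Int.emod_nonneg i hL'.ne'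
    have h2 : ((i + 1) % L.length).toNat = ((i % L.length).toNat + 1) % L.length := by
      zify
      rw [Int.toNat_of_nonneg hp, Int.toNat_of_nonneg (Int.emod_nonneg _ hL'.ne')]
      simp
    simp only [h2]
    exact getElem_mod_succ_ne h (by omega)

section

variable {L : List (X × Bool)} (h : IsCyclicallyReduced L) (hL : 0 < L.length) (a : FreeGroup X)

theorem circleLine_pt (k : ℤ) {i : ℕ} (hi : i < L.length) :
    (circleLine h hL a).pt (i + L.length * k) =
      a * FreeGroup.mk L ^ k * FreeGroup.mk (L.take i) := by
  have hL' : (0 : ℤ) < L.length := by omega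
  obtain ⟨h2, h3⟩ := (Int.ediv_emod_unique (a := i + L.length * k) (r := i)
    (q := k) hL').2 ⟨rfl, by omega, by omega⟩
  simp only [circleLine, h2, h3, Int.toNat_natCast]

theorem circleLine_letter (k : ℤ) {i : ℕ} (hi : i < L.length) :
    (circleLine h hL a).letter (i + L.length * k) = L[i] := by
  have hL' : (0 : ℤ) < L.length := by omega
  obtain ⟨h2, h3⟩ := (Int.ediv_emod_unique (a := i + L.length * k) (r := i)
    (q := k) hL').2 ⟨rfl, by omega, by omega⟩
  simp only [circleLine, h3, Int.toNat_natCast]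

theorem circleLine_pt_mul (k : ℤ) : (circleLine h hL a).pt (L.length * k) =
    a * FreeGroup.mk L ^ k := by
  have := circleLine_pt h hL a k hL
  simpa [← one_eq_mk] using this

theorem exists_circleDev_iff {g : FreeGroup X} :
    (∃ z, circleDev L a z g) ↔ g ∈ Set.range (circleLine h hL a).pt := by
  constructor
  · rintro ⟨z, k, rfl⟩
    exact ⟨_, circleLine_pt h hL a k z.2⟩
  · rintro ⟨i, rfl⟩
    have := Int.emod_lt_of_pos i (b := L.length) (by omega)
    exact ⟨(⟨(i % L.length).toNat, by omega⟩ : Fin L.length), i / L.length, rfl⟩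

end

/-! ### The development of the folded graph -/

section Fold

variable [DecidableEq X] (φ : FreeGroup X ≃* FreeGroup X) {Δ : LabeledGraph X}

theorem mk_substWord (x : X) :
    FreeGroup.mk (substWord φ.toMonoidHom x) = φ (FreeGroup.mk [(x, true)]) := by
  simp only [substWord, mk_toWord]
  rfl

theorem substWord_length_pos (x : X) : 0 < (substWord φ.toMonoidHom x).length := by
  rw [List.length_pos_iff]
  intro h
  have h1 := mk_substWord φ x
  rw [h, ← one_eq_mk, eq_comm, map_eq_one_iff φ φ.injective] at h1
  exact of_ne_one x h1

omit [DecidableEq X] in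
theorem label_eq_of_snd {x : X × Bool} (h : x.2 = true) : (x.1, true) = x := by
  rw [← h]

/-- The development of the graph after substitution. -/
def substDev (R : Δ.V → FreeGroup X → Prop) :
    (subst φ.toMonoidHom Δ).V → FreeGroup X → Prop
  | Sum.inl v, g => R v (φ.symm g)
  | Sum.inr p, g => R (Δ.ι p.1.1) (φ.symm
      (g * (FreeGroup.mk ((substWord φ.toMonoidHom (Δ.label p.1.1).1).take p.1.2))⁻¹))

/-- The development of the folded graph. -/
def foldDev (R : Δ.V → FreeGroup X → Prop) (Z : (foldSubst φ.toMonoidHom Δ).V)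
    (g : FreeGroup X) : Prop :=
  ∃ y, (foldMk (subst φ.toMonoidHom Δ)).onV y = Z ∧ substDev φ R y g

variable {R : Δ.V → FreeGroup X → Prop} {c : FreeGroup X}

/-- The path that replaces `e` is described uniformly from its initial vertex. At the far end,
consistency with the terminal vertex of `e` holds because the path spells `φ` of the label. -/
theorem substDev_point (D : Develops Δ R c) (e : Δ.E) (he : (Δ.label e).2 = true) {i : ℕ}
    (hi : i ≤ (substWord φ.toMonoidHom (Δ.label e).1).length) (g : FreeGroup X) :
    substDev φ R (substPoint φ.toMonoidHom Δ e he i) g ↔ R (Δ.ι e) (φ.symm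
      (g * (FreeGroup.mk ((substWord φ.toMonoidHom (Δ.label e).1).take i))⁻¹)) := by
  have hpos := substWord_length_pos φ (Δ.label e).1
  rw [substPoint]
  split_ifs with h1 h2
  · rfl
  · subst h2
    simp only [substDev, List.take_zero, ← one_eq_mk, inv_one, mul_one]
  · have h3 : i = (substWord φ.toMonoidHom (Δ.label e).1).length := by omega
    subst h3
    rw [List.take_length, mk_substWord, label_eq_of_snd he, _root_.map_mul, _root_.map_inv,
      MulEquiv.symm_apply_apply, ← D.step_iff, inv_mul_cancel_right]
    rfl

theorem substDev_step (D : Develops Δ R c) (a : (subst φ.toMonoidHom Δ).E) (g : FreeGroup X) :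
    substDev φ R ((subst φ.toMonoidHom Δ).ι ((subst φ.toMonoidHom Δ).bar a))
      (g * FreeGroup.mk [(subst φ.toMonoidHom Δ).label a]) ↔
    substDev φ R ((subst φ.toMonoidHom Δ).ι a) g := by
  obtain ⟨⟨⟨e, i⟩, he, hi⟩, b⟩ := a
  have key : ∀ g, substDev φ R (substPoint φ.toMonoidHom Δ e he (i + 1))
      (g * FreeGroup.mk [(substWord φ.toMonoidHom (Δ.label e).1)[i]]) ↔
      substDev φ R (substPoint φ.toMonoidHom Δ e he i) g := by
    intro g
    rw [substDev_point φ D e he hi, substDev_point φ D e he (le_of_lt hi),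
      ← List.take_concat_get' _ _ hi, ← mul_mk, mul_inv_rev, mul_assoc, mul_inv_cancel_left]
  cases b
  · have := key (g * (FreeGroup.mk [(substWord φ.toMonoidHom (Δ.label e).1)[i]])⁻¹)
    rw [inv_mul_cancel_right, inv_mk_singleton] at this
    exact this.symm
  · exact key g

/-- Equal points and equal labels lead to equal points, so folding only identifies vertices with the
same points over them. The development therefore descends to the folded graph. -/
theorem substDev_foldRel (D : Develops Δ R c) {y y' : (subst φ.toMonoidHom Δ).V}
    (h : FoldRel _ y y') (g : FreeGroup X) : substDev φ R y g ↔ substDev φ R y' g := by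
  induction h generalizing g with
  | refl => rfl
  | symm _ ih => exact (ih g).symm
  | trans _ _ ih₁ ih₂ => exact (ih₁ g).trans (ih₂ g)
  | @step e f _ hl ih =>
    have h1 := substDev_step φ D e (g * (FreeGroup.mk [(subst φ.toMonoidHom Δ).label e])⁻¹)
    have h2 := substDev_step φ D f (g * (FreeGroup.mk [(subst φ.toMonoidHom Δ).label f])⁻¹)
    rw [inv_mul_cancel_right] at h1 h2
    rw [h1, h2, ih, hl]

theorem foldDev_mk (D : Develops Δ R c) {y : (subst φ.toMonoidHom Δ).V} {g : FreeGroup X} :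
    foldDev φ R ((foldMk (subst φ.toMonoidHom Δ)).onV y) g ↔ substDev φ R y g := by
  constructor
  · rintro ⟨y', hy, h⟩
    exact (substDev_foldRel φ D (Quotient.exact (s := foldVSetoid _) hy) g).1 h
  · intro h
    exact ⟨y, rfl, h⟩

theorem foldDev_vertex (D : Develops Δ R c) {v : Δ.V} {g : FreeGroup X} :
    foldDev φ R (foldSubstVertex φ.toMonoidHom Δ v) (φ g) ↔ R v g := by
  refine (foldDev_mk φ D).trans ?_
  rw [substDev, MulEquiv.symm_apply_apply]

theorem joins_substPoint (e : Δ.E) (he : (Δ.label e).2 = true) (i : ℕ)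
    (hi : i ≤ (substWord φ.toMonoidHom (Δ.label e).1).length) :
    (subst φ.toMonoidHom Δ).Joins (Sum.inl (Δ.ι e))
      (FreeGroup.mk ((substWord φ.toMonoidHom (Δ.label e).1).take i))
      (substPoint φ.toMonoidHom Δ e he i) := by
  induction i with
  | zero =>
    have : substPoint φ.toMonoidHom Δ e he 0 = Sum.inl (Δ.ι e) := by simp [substPoint]
    rw [this, List.take_zero]
    exact joins_refl _
  | succ i ih =>
    have hi' : i < (substWord φ.toMonoidHom (Δ.label e).1).length := by omega
    have h1 := (ih (by omega)).trans
      (joins_edge (Γ := subst φ.toMonoidHom Δ) (⟨(e, i), he, hi'⟩, true))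
    rw [← List.take_concat_get' _ _ hi', ← mul_mk]
    exact h1

theorem joins_subst_edge (e : Δ.E) : (subst φ.toMonoidHom Δ).Joins (Sum.inl (Δ.ι e))
    (φ (FreeGroup.mk [Δ.label e])) (Sum.inl (Δ.ι (Δ.bar e))) := by
  have key : ∀ e : Δ.E, (Δ.label e).2 = true → (subst φ.toMonoidHom Δ).Joins (Sum.inl (Δ.ι e))
      (φ (FreeGroup.mk [Δ.label e])) (Sum.inl (Δ.ι (Δ.bar e))) := by
    intro e he
    have h1 := joins_substPoint φ e he _ le_rfl
    rw [List.take_length, mk_substWord, label_eq_of_snd he] at h1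
    have hpos := substWord_length_pos φ (Δ.label e).1
    have h2 : substPoint φ.toMonoidHom Δ e he (substWord φ.toMonoidHom (Δ.label e).1).length =
        Sum.inl (Δ.ι (Δ.bar e)) := by
      rw [substPoint, dif_neg (by omega), if_neg (by omega)]
    rwa [h2] at h1
  by_cases he : (Δ.label e).2 = true
  · exact key e he
  · have h1 := (key (Δ.bar e) (by simp [Δ.label_bar, he])).symm
    rwa [Δ.bar_bar, ← _root_.map_inv, label_bar', inv_mk_singleton, barLetter_barLetter] at h1

theorem Joins.subst {z z' : Δ.V} {g : FreeGroup X} (h : Δ.Joins z g z') :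
    (subst φ.toMonoidHom Δ).Joins (Sum.inl z) (φ g) (Sum.inl z') := by
  obtain ⟨p, hp, rfl⟩ := h
  induction p generalizing z with
  | nil =>
    obtain rfl : z = z' := hp
    simpa [← one_eq_mk] using joins_refl _
  | cons e p ih =>
    have h1 := (joins_subst_edge φ e).trans (ih hp.2)
    rwa [hp.1, ← _root_.map_mul, mul_mk] at h1

theorem exists_joins_of_substDev {y : (LabeledGraph.subst φ.toMonoidHom Δ).V}
    {g : FreeGroup X} (h : substDev φ R y g) : ∃ v a s, R v a ∧ φ a * s = g ∧
      (LabeledGraph.subst φ.toMonoidHom Δ).Joins (Sum.inl v) s y := by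
  rcases y with v | ⟨⟨e, i⟩, he, hi⟩
  · exact ⟨v, _, 1, h, by simp, joins_refl _⟩
  · refine ⟨Δ.ι e, _, FreeGroup.mk ((substWord φ.toMonoidHom (Δ.label e).1).take i), h, ?_, ?_⟩
    · rw [MulEquiv.apply_symm_apply, inv_mul_cancel_right]
    · have h1 := joins_substPoint φ e he i (le_of_lt hi.2)
      have h2 : substPoint φ.toMonoidHom Δ e he i = Sum.inr ⟨(e, i), he, hi⟩ := by
        rw [substPoint, dif_pos hi]
      rwa [h2] at h1

/-- Folding realizes `φ` on the tree: a vertex over `g` becomes a vertex over `φ g`, and the deck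
group becomes its image. Bijectivity of `φ` keeps the points over one vertex within a single deck
orbit. Connectedness is checked through the original vertices, from which each interior point of a
path is reached by a prefix. -/
theorem develops_fold (D : Develops Δ R c) :
    Develops (foldSubst φ.toMonoidHom Δ) (foldDev φ R) (φ c) where
  total := by
    rintro ⟨y⟩
    rcases y with v | p
    · obtain ⟨g, hg⟩ := D.total v
      exact ⟨φ g, _, rfl, by simpa [substDev] using hg⟩
    · obtain ⟨g, hg⟩ := D.total (Δ.ι p.1.1)
      exact ⟨φ g * FreeGroup.mk ((substWord φ.toMonoidHom (Δ.label p.1.1).1).take p.1.2),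
        _, rfl, by
          rw [substDev, mul_inv_cancel_right, MulEquiv.symm_apply_apply]
          exact hg⟩
  step := by
    rintro ⟨a⟩ g hg
    have h1 := (foldDev_mk φ D (y := (LabeledGraph.subst φ.toMonoidHom Δ).ι a)).1 hg
    exact (foldDev_mk φ D
      (y := (LabeledGraph.subst φ.toMonoidHom Δ).ι ((LabeledGraph.subst φ.toMonoidHom Δ).bar a))).2
      ((substDev_step φ D a g).2 h1)
  deck := by
    rintro _ g g' ⟨y, rfl, h⟩ h'
    replace h' := (foldDev_mk φ D).1 h'
    rcases y with v | p
    · obtain ⟨k, hk⟩ := D.deck _ _ _ h h'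
      refine ⟨k, φ.symm.injective ?_⟩
      rw [hk, ← map_zpow, _root_.map_mul, MulEquiv.symm_apply_apply]
    · obtain ⟨k, hk⟩ := D.deck _ _ _ h h'
      refine ⟨k, φ.symm.injective ?_⟩
      rw [_root_.map_mul, _root_.map_mul, ← mul_assoc] at hk
      rw [mul_right_cancel hk, ← map_zpow, _root_.map_mul, MulEquiv.symm_apply_apply]
  shift := by
    rintro _ g k ⟨y, rfl, h⟩
    refine ⟨y, rfl, ?_⟩
    rcases y with v | p
    · have := D.shift _ _ k h
      simpa [substDev, ← map_zpow] using this
    · have := D.shift _ _ k h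
      simpa [substDev, ← map_zpow, mul_assoc] using this
  conn := by
    rintro _ g _ g' ⟨y, rfl, h⟩ ⟨y', rfl, h'⟩
    obtain ⟨v, a, s, hv, rfl, hs⟩ := exists_joins_of_substDev φ h
    obtain ⟨v', a', s', hv', rfl, hs'⟩ := exists_joins_of_substDev φ h'
    have h1 := ((hs.symm.trans ((D.conn _ _ _ _ hv hv').subst φ)).trans hs').map
      (foldMk (LabeledGraph.subst φ.toMonoidHom Δ))
    refine h1.of_eq ?_
    rw [_root_.map_mul, _root_.map_inv]
    group

theorem foldDev_map {Ξ : LabeledGraph X} {R' : Ξ.V → FreeGroup X → Prop} (f : Hom Δ Ξ)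
    (hf : ∀ z g, R z g → R' (f.onV z) g) {Z : (foldSubst φ.toMonoidHom Δ).V} {g : FreeGroup X}
    (h : foldDev φ R Z g) : foldDev φ R' ((foldSubstMap φ.toMonoidHom f).onV Z) g := by
  obtain ⟨y, rfl, h⟩ := h
  refine ⟨(substMap φ.toMonoidHom f).onV y, rfl, ?_⟩
  rcases y with v | p
  · exact hf _ _ h
  · have := hf _ _ h
    rw [f.map_ι] at this
    change R' (Ξ.ι (f.onE p.1.1)) (φ.symm (g *
      (FreeGroup.mk ((substWord φ.toMonoidHom (Ξ.label (f.onE p.1.1)).1).take p.1.2))⁻¹))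
    rwa [f.map_label]

theorem foldDev_translate (t : FreeGroup X) {Z : (foldSubst φ.toMonoidHom Δ).V}
    {g : FreeGroup X} :
    foldDev φ (fun z g => R z (t * g)) Z g ↔ foldDev φ R Z (φ t * g) := by
  have : ∀ y g, substDev φ (fun z g => R z (t * g)) y g ↔ substDev φ R y (φ t * g) := by
    rintro (v | p) g <;> simp [substDev, mul_assoc]
  simp only [foldDev, this]

end Fold

end LabeledGraph

/-! ### Geodesic and core edges as the edges that separate two points or two ends. -/

namespace LabeledGraph

open FreeGroup

variable {X : Type*} {Γ : LabeledGraph X}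

theorem Hom.exists_span_iff {Ξ : LabeledGraph X} (hΞ : ∀ z, ∃ e, Ξ.ι e = z) (A : Set Γ.E)
    (k : Hom Ξ Γ) : (∃ f : Hom Ξ (Γ.span A), (Γ.spanIncl A).comp f = k) ↔
      ∀ e, k.onE e ∈ A ∨ Γ.bar (k.onE e) ∈ A := by
  constructor
  · rintro ⟨f, rfl⟩ e
    exact (f.onE e).2
  · intro h
    refine (Γ.spanIncl A).exists_factor Subtype.val_injective Subtype.val_injective k
      (fun z => ?_) (fun e => ⟨⟨k.onE e, h e⟩, rfl⟩)
    obtain ⟨e, rfl⟩ := hΞ z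
    exact ⟨⟨k.onV (Ξ.ι e), k.onE e, h e, (k.map_ι e).symm⟩, rfl⟩

theorem spanIncl_comp_injective (A : Set Γ.E) {Ξ : LabeledGraph X} {f f' : Hom Ξ (Γ.span A)}
    (h : (Γ.spanIncl A).comp f = (Γ.spanIncl A).comp f') : f = f' :=
  (Γ.spanIncl A).comp_injective Subtype.val_injective Subtype.val_injective h

/-- As `Ξ` has no isolated vertex, a morphism factors through an embedded subgraph as soon as its
edges do. -/
theorem card_hom_eq {Ξ Γ₁ Γ₂ : LabeledGraph X} (hΞ : ∀ z, ∃ e, Ξ.ι e = z)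
    (j₁ : Hom Γ₁ Γ) (j₂ : Hom Γ₂ Γ) (hV₁ : Function.Injective j₁.onV)
    (hE₁ : Function.Injective j₁.onE) (hV₂ : Function.Injective j₂.onV)
    (hE₂ : Function.Injective j₂.onE) (h : Set.range j₁.onE = Set.range j₂.onE) :
    Nat.card (Hom Ξ Γ₁) = Nat.card (Hom Ξ Γ₂) := by
  have key : ∀ {Γ' : LabeledGraph X} (j : Hom Γ' Γ), Function.Injective j.onV →
      Function.Injective j.onE → Nat.card (Hom Ξ Γ') =
      Nat.card {k : Hom Ξ Γ // ∀ e, k.onE e ∈ Set.range j.onE} := by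
    intro Γ' j hV hE
    refine Nat.card_eq_of_bijective (fun f => ⟨j.comp f, fun e => ⟨f.onE e, rfl⟩⟩) ⟨?_, ?_⟩
    · intro f f' hf
      exact j.comp_injective hV hE (congrArg Subtype.val hf)
    · rintro ⟨k, hk⟩
      obtain ⟨f, hf⟩ := j.exists_factor hV hE k (fun z => by
        obtain ⟨e, rfl⟩ := hΞ z
        obtain ⟨e', he'⟩ := hk e
        exact ⟨_, by rw [k.map_ι, ← he', j.map_ι]⟩) hk
      exact ⟨f, Subtype.ext hf⟩
  rw [key j₁ hV₁ hE₁, key j₂ hV₂ hE₂, h]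

theorem exists_edge_line {L : List (X × Bool)} (hL : L ≠ []) (z : (line L).V) :
    ∃ e, (line L).ι e = z := by
  have hpos := List.length_pos_iff.2 hL
  have hz : z.1 < L.length + 1 := z.2
  rcases Nat.lt_or_ge z.1 L.length with h | h
  · exact ⟨((⟨z.1, h⟩ : Fin L.length), true), rfl⟩
  · refine ⟨((⟨L.length - 1, by omega⟩ : Fin L.length), false), Fin.ext ?_⟩
    change L.length - 1 + 1 = z.1
    omega

/-- The set `H` separates the filters `l₁` and `l₂`. -/
def Separates {T : Type*} (l₁ l₂ : Filter T) (H : Set T) : Prop :=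
  (Hᶜ ∈ l₁ ∧ H ∈ l₂) ∨ (H ∈ l₁ ∧ Hᶜ ∈ l₂)

variable [DecidableEq X] {R : Γ.V → FreeGroup X → Prop} {c : FreeGroup X}

/-! ### Segments in folded graphs -/

/-- With trivial deck group the graph is a copy of a subtree, so a reduced path from `a` to `b` is
the geodesic from `P` to `Q`. -/
theorem Folded.mem_geodesicEdges_iff_crossing (hΓ : Γ.Folded) (D : Develops Γ R 1) {a b : Γ.V}
    {P Q : FreeGroup X} (ha : R a P) (hb : R b Q) {e : Γ.E} {g : FreeGroup X}
    (he : R (Γ.ι e) g) : e ∈ Γ.geodesicEdges a b ↔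
      P ∉ halfTree g (Γ.label e) ∧ Q ∈ halfTree g (Γ.label e) := by
  rw [hΓ.mem_geodesicEdges_iff, crossing_iff]
  constructor
  · rintro ⟨p, hp, hr, hep⟩
    obtain ⟨p₁, p₂, rfl⟩ := List.append_of_mem hep
    have h1 : Q = P * FreeGroup.mk ((p₁ ++ e :: p₂).map Γ.label) := by
      obtain ⟨k, hk⟩ := D.deck _ _ _ (D.path hp ha) hb
      simpa using hk
    obtain ⟨y, hy, hy'⟩ := isPath_append.1 hp
    have h2 : P * FreeGroup.mk (p₁.map Γ.label) = g := by
      obtain ⟨k, hk⟩ := D.deck _ _ _ (hy'.1 ▸ he) (D.path hy ha)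
      simpa using hk
    refine ⟨p₁.map Γ.label, p₂.map Γ.label, ?_, h2⟩
    rw [h1, inv_mul_cancel_left, hr.toWord_mk_eq]
    simp
  · rintro ⟨L₁, L₂, hw, rfl⟩
    obtain ⟨p, hp, hl⟩ := hΓ.exists_path (D.conn _ _ _ _ ha hb)
    refine ⟨p, hp, hl ▸ isReduced_toWord, ?_⟩
    rw [hw] at hl
    obtain ⟨p₁, p₂, rfl, h1, h2⟩ := List.map_eq_append_iff.1 hl
    obtain ⟨f, p₃, rfl, hf, -⟩ := List.map_eq_cons_iff.1 h2
    obtain ⟨y, hy, hy'⟩ := isPath_append.1 hp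
    have h3 := D.path hy ha
    rw [h1, ← hy'.1] at h3
    rw [hΓ e f (D.inj hΓ he h3) hf.symm]
    simp

theorem Folded.mem_span_geodesicEdges_iff (hΓ : Γ.Folded) (D : Develops Γ R 1) {a b : Γ.V}
    {P Q : FreeGroup X} (ha : R a P) (hb : R b Q) {e : Γ.E} {g : FreeGroup X}
    (he : R (Γ.ι e) g) : (e ∈ Γ.geodesicEdges a b ∨ Γ.bar e ∈ Γ.geodesicEdges a b) ↔
      Separates (pure P) (pure Q) (halfTree g (Γ.label e)) := by
  rw [hΓ.mem_geodesicEdges_iff_crossing D ha hb he,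
    hΓ.mem_geodesicEdges_iff_crossing D ha hb (D.step e g he), label_bar',
    mem_halfTree_barLetter, mem_halfTree_barLetter, not_not]
  rfl

/-! ### The axis -/

theorem eventually_atTop_of_finite_changes {S : Set ℤ} (hS : {n | ¬(n ∈ S ↔ n + 1 ∈ S)}.Finite)
    (h : ∃ᶠ n in Filter.atTop, n ∈ S) : ∀ᶠ n in Filter.atTop, n ∈ S := by
  obtain ⟨N, hN⟩ := hS.bddAbove
  obtain ⟨m, hm, hmS⟩ := Filter.frequently_atTop.1 h (N + 1)
  refine Filter.eventually_atTop.2 ⟨m, fun n hn => ?_⟩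
  induction n, hn using Int.leInduction with
  | base => exact hmS
  | succ n hn ih =>
    have h1 : n ∉ {n | ¬(n ∈ S ↔ n + 1 ∈ S)} := fun hn' => by
      have := hN hn'
      omega
    simp only [Set.mem_ofPred_eq, not_not] at h1
    exact h1.1 ih

theorem eventually_atBot_of_finite_changes {S : Set ℤ} (hS : {n | ¬(n ∈ S ↔ n + 1 ∈ S)}.Finite)
    (h : ∃ᶠ n in Filter.atBot, n ∈ S) : ∀ᶠ n in Filter.atBot, n ∈ S := by
  obtain ⟨N, hN⟩ := hS.bddBelow
  obtain ⟨m, hm, hmS⟩ := Filter.frequently_atBot.1 h (N - 1)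
  refine Filter.eventually_atBot.2 ⟨m, fun n hn => ?_⟩
  induction n, hn using Int.leInductionDown with
  | base => exact hmS
  | pred n hn ih =>
    have h1 : n - 1 ∉ {n | ¬(n ∈ S ↔ n + 1 ∈ S)} := fun hn' => by
      have := hN hn'
      omega
    simp only [Set.mem_ofPred_eq, not_not, sub_add_cancel] at h1
    exact h1.2 ih

omit [DecidableEq X] in
theorem zpow_injective_of_ne_one (hc : c ≠ 1) : Function.Injective fun n : ℤ => c ^ n := by
  intro m n h
  by_contra hne
  have h1 : c ^ (m - n) = 1 := by
    rw [zpow_sub]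
    exact mul_inv_eq_one.2 h
  have h2 : m - n ≠ 0 := sub_ne_zero.2 hne
  exact hc ((zpow_left_injective h2) (by simpa using h1))

theorem finite_changes (hc : c ≠ 1) (P Q g : FreeGroup X) (x : X × Bool) :
    {n : ℤ | ¬(c ^ n * P ∈ halfTree g x ↔ c ^ n * Q ∈ halfTree g x)}.Finite := by
  refine (((finite_setOf_crossing P Q g x).union (finite_setOf_crossing Q P g x)).preimage
    (zpow_injective_of_ne_one hc).injOn).subset ?_
  intro n hn
  simp only [Set.mem_preimage, Set.mem_ofPred_eq, Set.mem_union] at hn ⊢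
  tauto

theorem finite_changes_succ (hc : c ≠ 1) (P g : FreeGroup X) (x : X × Bool) (S : Set ℤ)
    (hS : ∀ n, n ∈ S ↔ c ^ n * P ∈ halfTree g x) : {n : ℤ | ¬(n ∈ S ↔ n + 1 ∈ S)}.Finite := by
  refine (finite_changes hc P (c * P) g x).subset ?_
  intro n hn
  simp only [Set.mem_ofPred_eq] at hn ⊢
  rwa [hS, hS, zpow_add_one, mul_assoc] at hn

/-- The powers of `c` move from the near side of the edge `(g, x)` to its far side. -/
def Traverses (c P g : FreeGroup X) (x : X × Bool) : Prop :=
  (∀ᶠ n : ℤ in Filter.atBot, c ^ n * P ∉ halfTree g x) ∧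
    ∀ᶠ n : ℤ in Filter.atTop, c ^ n * P ∈ halfTree g x

theorem finite_eventually_atTop {S : Set ℤ} (hS : S.Finite) : ∀ᶠ n in Filter.atTop, n ∉ S := by
  obtain ⟨N, hN⟩ := hS.bddAbove
  exact Filter.eventually_atTop.2 ⟨N + 1, fun n hn hnS => by have := hN hnS; omega⟩

theorem finite_eventually_atBot {S : Set ℤ} (hS : S.Finite) : ∀ᶠ n in Filter.atBot, n ∉ S := by
  obtain ⟨N, hN⟩ := hS.bddBelow
  exact Filter.eventually_atBot.2 ⟨N - 1, fun n hn hnS => by have := hN hnS; omega⟩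

/-- The orbit of a point under the powers of `c` changes sides only finitely often, and two orbits
are on the same side for all but finitely many powers. So frequent membership for one orbit is
eventual membership for every orbit. -/
theorem Traverses.of_frequently (hc : c ≠ 1) {P g : FreeGroup X} {x : X × Bool} (Q : FreeGroup X)
    (h₁ : ∃ᶠ n : ℤ in Filter.atBot, c ^ n * Q ∉ halfTree g x)
    (h₂ : ∃ᶠ n : ℤ in Filter.atTop, c ^ n * Q ∈ halfTree g x) : Traverses c P g x := by
  have hf := finite_changes hc Q P g x
  constructor
  · have := finite_changes_succ hc P g x {n | c ^ n * P ∈ halfTree g x} (fun n => Iff.rfl)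
    refine eventually_atBot_of_finite_changes (S := {n | c ^ n * P ∉ halfTree g x})
      (by simpa only [Set.mem_ofPred_eq, not_iff_not] using this) ?_
    refine (h₁.and_eventually (finite_eventually_atBot hf)).mono fun n hn => ?_
    have := hn.2
    simp only [Set.mem_ofPred_eq, not_not] at this ⊢
    rw [← this]
    exact hn.1
  · refine eventually_atTop_of_finite_changes (S := {n | c ^ n * P ∈ halfTree g x})
      (finite_changes_succ hc P g x _ fun n => Iff.rfl) ?_
    refine (h₂.and_eventually (finite_eventually_atTop hf)).mono fun n hn => ?_
    have := hn.2
    simp only [Set.mem_ofPred_eq, not_not] at this ⊢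
    rw [← this]
    exact hn.1

theorem Traverses.congr (hc : c ≠ 1) {P Q g : FreeGroup X} {x : X × Bool}
    (h : Traverses c P g x) : Traverses c Q g x :=
  .of_frequently hc P h.1.frequently h.2.frequently

/-- A cyclically reduced closed path lifts to a periodic line whose period is a power `c ^ j`. The
lift of `e` is an edge of this line, up to a deck transformation `c ^ i`, and the sign of `j` tells
in which direction the powers of `c` pass it. -/
theorem Folded.traverses_of_mem_coreEdges (hΓ : Γ.Folded) (D : Develops Γ R c) (hc : c ≠ 1)
    (P : FreeGroup X) {e : Γ.E} {g : FreeGroup X} (he : R (Γ.ι e) g) (h : e ∈ Γ.coreEdges) :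
    Traverses c P g (Γ.label e) ∨ Traverses c P (g * FreeGroup.mk [Γ.label e])
      (barLetter (Γ.label e)) := by
  obtain ⟨z, p, hp, hr, hep⟩ := hΓ.mem_coreEdges_iff.1 h
  obtain ⟨p₁, p₂, rfl⟩ := List.append_of_mem hep
  obtain ⟨y, hy, hy'⟩ := isPath_append.1 hp
  obtain ⟨q, hq⟩ := D.total z
  set L := (p₁ ++ e :: p₂).map Γ.label with hL
  have hlen : p₁.length < L.length := by simp [hL]
  have hL0 : 0 < L.length := by omega
  obtain ⟨j, hj⟩ := D.deck _ _ _ hq (D.path hp hq)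
  obtain ⟨i, hi⟩ := D.deck _ _ _ (D.path hy hq) (hy'.1 ▸ he)
  have hpow : ∀ k : ℤ, q * FreeGroup.mk L ^ k = c ^ (j * k) * q := by
    intro k
    have h1 : FreeGroup.mk L = q⁻¹ * c ^ j * q := by
      rw [mul_assoc, ← hj, inv_mul_cancel_left]
    have h2 := conj_zpow (i := k) (a := q⁻¹) (b := c ^ j)
    rw [inv_inv] at h2
    rw [h1, h2, ← zpow_mul]
    group
  -- The lifted line passes through `q` times the `k`-th power of the period at index `L.length *
  -- k`, and the edge has index `p₁.length`, which is in the range from `0` to `L.length - 1`.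
  have hmem : ∀ k : ℤ, c ^ (j * k + i) * q ∈ halfTree g (Γ.label e) ↔ 0 < k := by
    intro k
    have h1 : g = c ^ i * (circleLine hr hL0 q).pt p₁.length := by
      have := circleLine_pt hr hL0 q 0 hlen
      rw [mul_zero, add_zero] at this
      rw [this, hi]
      simp [hL]
    have h2 : Γ.label e = (circleLine hr hL0 q).letter p₁.length := by
      have := circleLine_letter hr hL0 q 0 hlen
      rw [mul_zero, add_zero] at this
      rw [this]
      simp [hL]
    have h3 := (circleLine hr hL0 q).pt_mem_half (i := p₁.length) (j := L.length * k)
    rw [Line.half, circleLine_pt_mul, hpow, ← h2] at h3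
    rw [h1, add_comm, zpow_add, mul_assoc, mul_mem_halfTree, h3]
    have hlen' : (p₁.length : ℤ) < L.length := by exact_mod_cast hlen
    constructor
    · intro h4
      by_contra! hk
      nlinarith
    · intro hk
      nlinarith
  have hj0 : j ≠ 0 := by
    rintro rfl
    have h1 := hmem 0
    have h2 := hmem 1
    simp only [zero_mul] at h1 h2
    rw [h1] at h2
    simp at h2
  rcases lt_or_gt_of_ne hj0 with hneg | hpos
  · right
    refine .of_frequently hc q (Filter.frequently_atBot.2 fun N => ?_)
      (Filter.frequently_atTop.2 fun N => ?_)
    -- As `j ≤ -1`, the exponent is at most `N`, while the multiplier of `j` is positive. The other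
    -- three witnesses are chosen in the same way.
    · refine ⟨j * (|N| + |i| + 1) + i, ?_, ?_⟩
      · have := neg_abs_le N
        have := le_abs_self i
        have := abs_nonneg N
        have := abs_nonneg i
        nlinarith
      · rw [mem_halfTree_barLetter, not_not, hmem]
        positivity
    · refine ⟨j * (-(|N| + |i|)) + i, ?_, ?_⟩
      · have := le_abs_self N
        have := neg_abs_le i
        have := abs_nonneg N
        have := abs_nonneg i
        nlinarith
      · rw [mem_halfTree_barLetter, hmem]
        have := abs_nonneg N
        have := abs_nonneg i
        omega
  · left
    refine .of_frequently hc q (Filter.frequently_atBot.2 fun N => ?_)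
      (Filter.frequently_atTop.2 fun N => ?_)
    · refine ⟨j * (-(|N| + |i|)) + i, ?_, ?_⟩
      · have := neg_abs_le N
        have := le_abs_self i
        have := abs_nonneg N
        have := abs_nonneg i
        nlinarith
      · rw [hmem]
        have := abs_nonneg N
        have := abs_nonneg i
        omega
    · refine ⟨j * (|N| + |i| + 1) + i, ?_, ?_⟩
      · have := le_abs_self N
        have := neg_abs_le i
        have := abs_nonneg N
        have := abs_nonneg i
        nlinarith
      · rw [hmem]
        positivity

/-- There is a closed path that spells the cyclic reduction of the generator of the group of deck
transformations; it contains all edges that are traversed by the axis. -/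
theorem Folded.exists_axis (hΓ : Γ.Folded) (D : Develops Γ R c) (hc : c ≠ 1) {z₀ : Γ.V}
    {P : FreeGroup X} (hP : R z₀ P) : ∃ z p Q, R z Q ∧ Γ.IsPath z p z ∧
      p.map Γ.label = reduceCyclically (P⁻¹ * c * P).toWord ∧
      c * Q = Q * FreeGroup.mk (p.map Γ.label) ∧
      ∀ e g, R (Γ.ι e) g → Traverses c P g (Γ.label e) → e ∈ p := by
  set w := (P⁻¹ * c * P).toWord with hw
  have hconj := reduceCyclically.conj_conjugator_reduceCyclically w
  set s := reduceCyclically.conjugator w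
  set r := reduceCyclically w with hr
  have hrr : IsCyclicallyReduced r := reduceCyclically.isCyclicallyReduced isReduced_toWord
  have hz : Γ.Joins z₀ (P⁻¹ * c * P) z₀ := by
    refine (D.conn _ _ _ _ hP (D.shift _ _ 1 hP)).of_eq ?_
    rw [zpow_one, mul_assoc]
  obtain ⟨p, hp, hl⟩ := hΓ.exists_path hz
  rw [← hw, ← hconj] at hl
  obtain ⟨p₁₂, p₃, rfl, h12, h3⟩ := List.map_eq_append_iff.1 hl
  obtain ⟨p₁, p₂, rfl, h1, h2⟩ := List.map_eq_append_iff.1 h12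
  obtain ⟨z₂, hp12, hp3⟩ := isPath_append.1 hp
  obtain ⟨z₁, hp1, hp2⟩ := isPath_append.1 hp12
  -- The paths that spell the conjugator and, backwards, its inverse start at the same vertex, hence
  -- coincide. So the middle path is closed.
  obtain ⟨-, rfl⟩ := hΓ.path_unique hp1 hp3.reverse
    (by rw [map_label_reverse, h3, invRev_invRev, h1])
  have hQ := D.path hp1 hP
  rw [h1] at hQ
  have hcQ : c * (P * FreeGroup.mk s) = P * FreeGroup.mk s * FreeGroup.mk r := by
    have h4 : P⁻¹ * c * P = FreeGroup.mk s * FreeGroup.mk r * (FreeGroup.mk s)⁻¹ := by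
      rw [inv_mk, mul_mk, mul_mk, hconj, hw, mk_toWord]
    rw [mul_assoc, inv_mul_eq_iff_eq_mul] at h4
    rw [← mul_assoc, h4]
    group
  refine ⟨z₁, p₂, P * FreeGroup.mk s, hQ, hp2, h2, by rw [h2, hcQ], fun e g he ht => ?_⟩
  obtain ⟨ht1, ht2⟩ := ht.congr hc (Q := P * FreeGroup.mk s)
  -- Somewhere two consecutive points of the orbit lie on different sides. The segment that joins
  -- them spells `r`, so it projects to the closed path and crosses the edge.
  obtain ⟨n, hn1, hn2⟩ : ∃ n : ℤ, c ^ n * (P * FreeGroup.mk s) ∉ halfTree g (Γ.label e) ∧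
      c ^ (n + 1) * (P * FreeGroup.mk s) ∈ halfTree g (Γ.label e) := by
    by_contra! hn
    obtain ⟨N, hN⟩ := Filter.eventually_atBot.1 ht1
    obtain ⟨m, hm, hm'⟩ := (ht2.and (Filter.eventually_ge_atTop N)).exists
    have : ∀ k, N ≤ k → c ^ k * (P * FreeGroup.mk s) ∉ halfTree g (Γ.label e) := by
      intro k hk
      induction k, hk using Int.leInduction with
      | base => exact hN N le_rfl
      | succ k _ ih => exact hn k ih
    exact this m hm' hm
  obtain ⟨L₁, L₂, hL, hg⟩ := crossing_iff.1 ⟨hn1, hn2⟩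
  rw [zpow_add_one, mul_assoc (c ^ n), hcQ, mul_inv_rev, mul_assoc, inv_mul_cancel_left,
    inv_mul_cancel_left, hrr.1.toWord_mk_eq] at hL
  rw [hL] at h2
  obtain ⟨q₁, q₂, rfl, h5, h6⟩ := List.map_eq_append_iff.1 h2
  obtain ⟨f, q₃, rfl, hf, -⟩ := List.map_eq_cons_iff.1 h6
  obtain ⟨y, hy, hy'⟩ := isPath_append.1 hp2
  have h7 := D.path hy (D.shift _ _ n hQ)
  rw [h5, hg, ← hy'.1] at h7
  rw [hΓ e f (D.inj hΓ he h7) hf.symm]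
  simp

theorem Folded.mem_span_coreEdges_iff (hΓ : Γ.Folded) (D : Develops Γ R c) (hc : c ≠ 1) {z₀ : Γ.V}
    {P : FreeGroup X} (hP : R z₀ P) {e : Γ.E} {g : FreeGroup X} (he : R (Γ.ι e) g) :
    (e ∈ Γ.coreEdges ∨ Γ.bar e ∈ Γ.coreEdges) ↔
      (Traverses c P g (Γ.label e) ∨ Traverses c P (g * FreeGroup.mk [Γ.label e])
        (barLetter (Γ.label e))) := by
  obtain ⟨z, p, Q, -, hp, hl, -, hall⟩ := hΓ.exists_axis D hc hP
  have hcore : ∀ {f}, f ∈ p → f ∈ Γ.coreEdges := fun hf =>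
    hΓ.mem_coreEdges_iff.2
      ⟨z, p, hp, hl ▸ reduceCyclically.isCyclicallyReduced isReduced_toWord, hf⟩
  have hbar := D.step e g he
  constructor
  · rintro (h | h)
    · exact hΓ.traverses_of_mem_coreEdges D hc P he h
    · have := hΓ.traverses_of_mem_coreEdges D hc P hbar h
      rw [label_bar', barLetter_barLetter, ← inv_mk_singleton, mul_inv_cancel_right] at this
      exact this.symm
  · rintro (h | h)
    · exact Or.inl (hcore (hall e g he h))
    · refine Or.inr (hcore (hall _ _ hbar ?_))
      rwa [label_bar']

/-- The core of a folded graph with infinite cyclic fundamental group is a circle. -/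
theorem Folded.card_hom_core (hΓ : Γ.Folded) (D : Develops Γ R c) (hc : c ≠ 1) {z₀ : Γ.V}
    {P : FreeGroup X} (hP : R z₀ P) {Ξ : LabeledGraph X} (hΞ : ∀ z, ∃ e, Ξ.ι e = z) :
    Nat.card (Hom Ξ (circle (reduceCyclically (P⁻¹ * c * P).toWord))) =
      Nat.card (Hom Ξ (Γ.span Γ.coreEdges)) := by
  obtain ⟨z, p, Q, hQ, hp, hl, hcQ, hall⟩ := hΓ.exists_axis D hc hP
  set r := reduceCyclically (P⁻¹ * c * P).toWord with hr
  have hrr : IsCyclicallyReduced r := reduceCyclically.isCyclicallyReduced isReduced_toWord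
  have hcore : ∀ {f}, f ∈ p → f ∈ Γ.coreEdges := fun hf =>
    hΓ.mem_coreEdges_iff.2 ⟨z, p, hp, hl ▸ hrr, hf⟩
  rw [hl] at hcQ
  have hplen : p.length = r.length := by rw [← hl, List.length_map]
  have hL : 0 < r.length := by
    rw [List.length_pos_iff]
    intro h
    rw [h, ← one_eq_mk, mul_one] at hcQ
    exact hc (mul_eq_right.1 hcQ)
  obtain ⟨f, hf⟩ := exists_hom_circle hp hl
  have hf0 : f.onV (⟨0, hL⟩ : Fin r.length) = z := by
    have h1 := f.map_ι (((⟨0, hL⟩ : Fin r.length), true) : Fin r.length × Bool)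
    rw [hf ⟨0, hL⟩] at h1
    exact h1.trans (hp.start_eq (by omega))
  have Dr := develops_circle r hL Q
  have hcdev : Q * FreeGroup.mk r * Q⁻¹ = c := by rw [← hcQ, mul_inv_cancel_right]
  rw [hcdev] at Dr
  have hmap : ∀ {y g}, circleDev r Q y g → R (f.onV y) g := fun {y g} hy =>
    Dr.map D f (z₀ := (⟨0, hL⟩ : Fin r.length)) (g₀ := Q)
      ⟨0, by simp [← one_eq_mk]⟩ (by rw [hf0]; exact hQ) hy
  -- The circle and the graph have the same deck group, so points over one vertex of the graph lie
  -- over one vertex of the circle.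
  have hV : Function.Injective f.onV := by
    intro i j hij
    obtain ⟨g, hg⟩ := Dr.total i
    obtain ⟨g', hg'⟩ := Dr.total j
    obtain ⟨k, hk⟩ := D.deck _ _ _ (hmap hg) (hij ▸ hmap hg')
    exact Dr.inj (folded_circle hrr) (Dr.shift _ _ k hg) (hk ▸ hg')
  have hE : Function.Injective f.onE := by
    intro e e' he
    refine folded_circle hrr _ _ (hV ?_) ?_
    · rw [f.map_ι, f.map_ι, he]
    · rw [← f.map_label, ← f.map_label, he]
  have hrange : ∀ {e}, e ∈ p → e ∈ Set.range f.onE := by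
    intro e he
    obtain ⟨i, hi, rfl⟩ := List.getElem_of_mem he
    exact ⟨_, hf ⟨i, by omega⟩⟩
  refine card_hom_eq hΞ f (Γ.spanIncl Γ.coreEdges) hV hE Subtype.val_injective
    Subtype.val_injective (Set.ext fun e => ⟨?_, ?_⟩)
  · rintro ⟨⟨i, _ | _⟩, rfl⟩
    · refine ⟨⟨f.onE (i, false), Or.inr ?_⟩, rfl⟩
      have h1 : f.onE (i, true) = Γ.bar (f.onE (i, false)) := f.map_bar (i, false)
      refine h1 ▸ ?_
      rw [hf i]
      exact hcore (List.getElem_mem _)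
    · refine ⟨⟨f.onE (i, true), Or.inl ?_⟩, rfl⟩
      rw [hf i]
      exact hcore (List.getElem_mem _)
  · rintro ⟨⟨e, he⟩, rfl⟩
    obtain ⟨g, hg⟩ := D.total (Γ.ι e)
    rcases (hΓ.mem_span_coreEdges_iff D hc hP hg).1 he with h | h
    · exact hrange (hall _ _ hg h)
    · obtain ⟨e', he'⟩ := hrange (hall _ _ (D.step e g hg) (by rwa [label_bar']))
      refine ⟨(circle r).bar e', ?_⟩
      rw [f.map_bar, he', Γ.bar_bar]
      rfl

end LabeledGraph

/-! ### Concatenation of segments. -/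

namespace FreeGroup

variable {X : Type*} [DecidableEq X]

theorem between_two_points {a b c d : FreeGroup X} (hab : a ≠ b) (ha : Between c a d)
    (hb : Between c b d) :
    (Between c a b ∧ Between a b d) ∨ (Between c b a ∧ Between b a d) := by
  have key : ∀ {c d : FreeGroup X}, Between c b d → Between c a b → Between a b d := by
    intro c d hb hca y hay hdy
    rcases hca.mem_or_mem hay with h | h
    · exact hb y h hdy
    · exact self_notMem_halfTree _ _ h
  obtain ⟨x, hx⟩ := exists_mem_halfTree hab
  by_cases hc : c ∈ halfTree a x
  · have h1 : Between d a b := (between_iff_of_mem hx).2 (ha x hc)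
    exact Or.inr ⟨(key hb.symm h1).symm, h1.symm⟩
  · have h1 : Between c a b := (between_iff_of_mem hx).2 hc
    exact Or.inl ⟨h1, key hb h1⟩

theorem Between.trans_left {a b c d : FreeGroup X} (h : Between a b d) (h' : Between c a d) :
    Between c a b := by
  intro x hc hb
  rcases h.mem_or_mem hb with h1 | h1
  · exact self_notMem_halfTree _ _ h1
  · exact h' x hc h1

/-- Two geodesics that overlap in a nondegenerate segment concatenate to a geodesic. For `a = b` the
path could backtrack. -/
theorem Between.trans_of_ne {a b c d : FreeGroup X} (hab : a ≠ b) (h : Between c a b)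
    (h' : Between a b d) : Between c a d := by
  intro x hc hd
  obtain ⟨y, hy⟩ := exists_mem_halfTree hab
  have hxy : y ≠ x := by
    rintro rfl
    exact h y hc hy
  rcases h'.mem_or_mem hy with h1 | h1
  · exact self_notMem_halfTree _ _ h1
  · exact hxy (halfTree_letter_unique h1 hd)

theorem between_mul_letter {a b : FreeGroup X} {x : X × Bool} (h : b ∈ halfTree a x) :
    Between a (a * mk [x]) b := by
  have h1 : a ∈ halfTree (a * mk [x]) (barLetter x) :=
    mem_halfTree_barLetter.2 (self_notMem_halfTree _ _)
  exact ((between_iff_of_mem h1).2 fun h2 => mem_halfTree_barLetter.1 h2 h).symm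

end FreeGroup

/-! ### u-words, their two sides, and the position of their images. -/

namespace UWord

open FreeGroup

variable {X : Type*}

theorem word_ne_one (v : UWord X) : v.word ≠ 1 := (Quotient.out v).2

theorem eq_of_word {v w : UWord X} (h : w.word = v.word ∨ w.word = v.word⁻¹) : v = w := by
  rw [← Quotient.out_eq v, ← Quotient.out_eq w]
  exact Quotient.sound h

theorem exists_word {g : FreeGroup X} (hg : g ≠ 1) : ∃ v : UWord X, v.word = g ∨ v.word = g⁻¹ := by
  refine ⟨Quotient.mk (uWordSetoid X) ⟨g, hg⟩, ?_⟩
  rcases Quotient.mk_out (s := uWordSetoid X) ⟨g, hg⟩ with h | h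
  · exact Or.inl h.symm
  · exact Or.inr (inv_eq_iff_eq_inv.1 (Eq.symm h))

/-- There is a u-word that labels the segment between two given points. -/
theorem exists_segment {a b : FreeGroup X} (h : a ≠ b) : ∃ (v : UWord X) (P Q : FreeGroup X),
    P * v.word = Q ∧ ((P = a ∧ Q = b) ∨ (P = b ∧ Q = a)) := by
  obtain ⟨v, hv⟩ := exists_word (g := a⁻¹ * b) (fun h' => h (inv_mul_eq_one.1 h'))
  rcases hv with hv | hv
  · exact ⟨v, a, b, by rw [hv]; group, Or.inl ⟨rfl, rfl⟩⟩
  · exact ⟨v, b, a, by rw [hv]; group, Or.inr ⟨rfl, rfl⟩⟩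

variable [DecidableEq X]

theorem length_pos (u : UWord X) : 0 < u.word.toWord.length :=
  List.length_pos_iff.2 fun h => u.word_ne_one (toWord_eq_nil_iff.1 h)

theorem exists_edge (u : UWord X) (z : u.graph.V) : ∃ e, u.graph.ι e = z :=
  exists_edge_line (List.length_pos_iff.1 u.length_pos) z

theorem folded_graph (u : UWord X) : u.graph.Folded := folded_line isReduced_toWord

/-- The development of the graph of a u-word that starts at `a`. -/
def dev (u : UWord X) (a : FreeGroup X) : u.graph.V → FreeGroup X → Prop :=
  lineDev u.word.toWord a

theorem develops_dev (u : UWord X) (a : FreeGroup X) : Develops u.graph (u.dev a) 1 :=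
  develops_line _ _

theorem exists_dev_iff (u : UWord X) {a g : FreeGroup X} :
    (∃ z, u.dev a z g) ↔ Between a g (a * u.word) := by
  have := exists_lineDev_iff (isReduced_toWord (x := u.word)) (a := a) (g := g)
  rwa [mk_toWord] at this

/-- The points that see the segment from `1` to `u` from its initial point. -/
def initialSide (u : UWord X) : Set (FreeGroup X) := {c | Between c 1 u.word}

/-- The points that see the segment from `1` to `u` from its final point. -/
def finalSide (u : UWord X) : Set (FreeGroup X) := {c | Between 1 u.word c}

/-- The far side of the `i`-th edge of the segment from `1` to `u`. -/
def edgeHalf (u : UWord X) (i : Fin u.word.toWord.length) : Set (FreeGroup X) :=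
  halfTree (FreeGroup.mk (u.word.toWord.take i)) u.word.toWord[i]

theorem edgeHalf_anti (u : UWord X) : Antitone u.edgeHalf := by
  have key : ∀ (n i : ℕ) (h : i + n < u.word.toWord.length),
      u.edgeHalf ⟨i + n, h⟩ ⊆ u.edgeHalf ⟨i, by omega⟩ := by
    intro n
    induction n with
    | zero => exact fun i h => subset_rfl
    | succ n ih =>
      intro i h
      refine Set.Subset.trans ?_ (ih i (by omega))
      have h1 : FreeGroup.mk (u.word.toWord.take (i + n + 1)) =
          FreeGroup.mk (u.word.toWord.take (i + n)) *
            FreeGroup.mk [u.word.toWord[i + n]'(by omega)] := by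
        rw [mul_mk, List.take_concat_get']
      simp only [edgeHalf, Fin.getElem_fin, ← add_assoc, h1]
      exact halfTree_subset (getElem_succ_ne isReduced_toWord _)
  intro i j hij
  obtain ⟨n, hn⟩ := Nat.exists_eq_add_of_le (show i.1 ≤ j.1 from hij)
  have := key n i.1 (by omega)
  simpa only [← hn] using this

theorem initialSide_eq (u : UWord X) :
    u.initialSide = (u.edgeHalf ⟨0, u.length_pos⟩)ᶜ := by
  ext c
  have h : u.word ∈ u.edgeHalf ⟨0, u.length_pos⟩ := by
    simp only [edgeHalf, List.take_zero, ← one_eq_mk, mem_halfTree, inv_one, one_mul,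
      Fin.getElem_fin]
    rw [List.head?_eq_getElem?, List.getElem?_eq_getElem]
  have h2 : u.edgeHalf ⟨0, u.length_pos⟩ = halfTree 1 (u.word.toWord[0]'u.length_pos) := by
    simp only [edgeHalf, List.take_zero, ← one_eq_mk, Fin.getElem_fin]
  rw [h2] at h ⊢
  exact between_iff_of_mem h

theorem finalSide_eq (u : UWord X) :
    u.finalSide = u.edgeHalf ⟨u.word.toWord.length - 1, by have := u.length_pos; omega⟩ := by
  ext c
  have hpos := u.length_pos
  set n := u.word.toWord.length - 1 with hn
  have hn' : n < u.word.toWord.length := by omega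
  have h1 : u.word = FreeGroup.mk (u.word.toWord.take n) *
      FreeGroup.mk [u.word.toWord[n]] := by
    rw [mul_mk, List.take_concat_get', List.take_of_length_le (by omega), mk_toWord]
  have h2 : (1 : FreeGroup X) ∈ halfTree u.word (barLetter u.word.toWord[n]) := by
    have h1' := mem_halfTree_barLetter (g := FreeGroup.mk (u.word.toWord.take n))
      (c := 1) (x := u.word.toWord[n])
    rw [← h1] at h1'
    refine h1'.2 ?_
    have := (crossing_iff (a := 1) (b := u.word) (x := u.word.toWord[n])
      (g := FreeGroup.mk (u.word.toWord.take n))).2 ⟨u.word.toWord.take n, [], by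
        rw [inv_one, one_mul, List.take_concat_get', List.take_of_length_le (by omega)],
        one_mul _⟩
    exact this.1
  change Between 1 u.word c ↔ _
  have h3 : Between 1 u.word c ↔ Between c u.word 1 := ⟨Between.symm, Between.symm⟩
  rw [h3, between_iff_of_mem h2]
  have h4 : halfTree u.word (barLetter u.word.toWord[n]) =
      (halfTree (FreeGroup.mk (u.word.toWord.take n)) u.word.toWord[n])ᶜ := by
    rw [← halfTree_barLetter, ← h1]
  rw [h4, Set.mem_compl_iff, not_not]
  rfl

theorem disjoint_sides (u : UWord X) : Disjoint u.initialSide u.finalSide := by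
  rw [initialSide_eq, finalSide_eq, Set.disjoint_compl_left_iff_subset]
  exact u.edgeHalf_anti (Nat.zero_le _)

/-- The half trees along `u` are nested, so the first and the last one control all others. Opposite
directions at these two would give a point in the last half tree but not in the first. The filters
are principal at points for segments and the two ends of an orbit for circles, which treats both
images at once. -/
theorem separates_iff (u : UWord X) (l₁ l₂ : Filter (FreeGroup X)) [l₁.NeBot] [l₂.NeBot] :
    (∀ i, Separates l₁ l₂ (u.edgeHalf i)) ↔ (u.initialSide ∈ l₁ ∧ u.finalSide ∈ l₂) ∨
      (u.finalSide ∈ l₁ ∧ u.initialSide ∈ l₂) := by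
  have hle : ∀ i, u.edgeHalf i ⊆ u.edgeHalf ⟨0, u.length_pos⟩ :=
    fun i => u.edgeHalf_anti (Nat.zero_le _)
  have hge : ∀ i : Fin u.word.toWord.length, u.edgeHalf
      ⟨u.word.toWord.length - 1, by have := u.length_pos; omega⟩ ⊆ u.edgeHalf i :=
    fun i => u.edgeHalf_anti (Nat.le_sub_one_of_lt i.2)
  rw [initialSide_eq, finalSide_eq]
  constructor
  · intro h
    have h1 := hle ⟨u.word.toWord.length - 1, by have := u.length_pos; omega⟩
    rcases h ⟨0, u.length_pos⟩ with ⟨h2, h3⟩ | ⟨h2, h3⟩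
    · rcases h ⟨u.word.toWord.length - 1, by have := u.length_pos; omega⟩ with ⟨-, h5⟩ | ⟨h4, -⟩
      · exact Or.inl ⟨h2, h5⟩
      · obtain ⟨c, hc1, hc2⟩ := (Filter.nonempty_of_mem (Filter.inter_mem h2 h4))
        exact absurd (h1 hc2) hc1
    · rcases h ⟨u.word.toWord.length - 1, by have := u.length_pos; omega⟩ with ⟨-, h5⟩ | ⟨h4, -⟩
      · obtain ⟨c, hc1, hc2⟩ := (Filter.nonempty_of_mem (Filter.inter_mem h3 h5))
        exact absurd (h1 hc2) hc1
      · exact Or.inr ⟨h4, h3⟩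
  · rintro (⟨h1, h2⟩ | ⟨h1, h2⟩) i
    · exact Or.inl ⟨Filter.mem_of_superset h1 (Set.compl_subset_compl.2 (hle i)),
        Filter.mem_of_superset h2 (hge i)⟩
    · exact Or.inr ⟨Filter.mem_of_superset h1 (hge i),
        Filter.mem_of_superset h2 (Set.compl_subset_compl.2 (hle i))⟩

/-- A morphism from `u` whose initial vertex lies under `1` has image in a subgraph whose edges are
those that separate two ends if and only if `u` separates these ends. -/
theorem exists_span_iff (u : UWord X) {Γ : LabeledGraph X} {R : Γ.V → FreeGroup X → Prop}
    {c : FreeGroup X} (D : Develops Γ R c) {l₁ l₂ : Filter (FreeGroup X)} [l₁.NeBot] [l₂.NeBot]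
    {A : Set Γ.E} (hA : ∀ e g, R (Γ.ι e) g →
      ((e ∈ A ∨ Γ.bar e ∈ A) ↔ Separates l₁ l₂ (halfTree g (Γ.label e))))
    (k : Hom u.graph Γ) (hk : R (k.onV u.first) 1) :
    (∃ f : Hom u.graph (Γ.span A), (Γ.spanIncl A).comp f = k) ↔
      (u.initialSide ∈ l₁ ∧ u.finalSide ∈ l₂) ∨ (u.finalSide ∈ l₁ ∧ u.initialSide ∈ l₂) := by
  rw [Hom.exists_span_iff u.exists_edge, ← separates_iff]
  have key : ∀ i : Fin u.word.toWord.length, (k.onE (i, true) ∈ A ∨ Γ.bar (k.onE (i, true)) ∈ A) ↔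
      Separates l₁ l₂ (u.edgeHalf i) := by
    intro i
    have key : ∀ e : u.graph.E, u.dev 1 (u.graph.ι e) (FreeGroup.mk (u.word.toWord.take i)) →
        ((k.onE e ∈ A ∨ Γ.bar (k.onE e) ∈ A) ↔ Separates l₁ l₂
          (halfTree (FreeGroup.mk (u.word.toWord.take i)) (u.graph.label e))) := by
      intro e he
      have h1 := (u.develops_dev 1).map D k (z₀ := u.first) (g₀ := 1)
        (by simp [dev, lineDev, first, ← one_eq_mk]) hk he
      rw [k.map_ι] at h1
      have h2 := hA _ _ h1
      rwa [k.map_label] at h2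
    exact key (i, true) (one_mul _).symm
  constructor
  · exact fun h i => (key i).1 (h (i, true))
  · rintro h ⟨i, _ | _⟩
    · have h1 : k.onE (i, false) = Γ.bar (k.onE (i, true)) := k.map_bar (i, true)
      have h2 : k.onE (i, true) = Γ.bar (k.onE (i, false)) := k.map_bar (i, false)
      have h3 := (key i).2 (h i)
      rw [← h1] at h3
      exact h2 ▸ h3.symm
    · exact (key i).2 (h i)

/-- The points that are sent by `φ` to the initial side of `u`. -/
def sourceSide (φ : FreeGroup X ≃* FreeGroup X) (u : UWord X) : Set (FreeGroup X) :=
  φ ⁻¹' u.initialSide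

/-- The points that are sent by `φ` to the final side of `u`. -/
def targetSide (φ : FreeGroup X ≃* FreeGroup X) (u : UWord X) : Set (FreeGroup X) :=
  φ ⁻¹' u.finalSide

theorem disjoint_source_target (φ : FreeGroup X ≃* FreeGroup X) (u : UWord X) :
    Disjoint (u.sourceSide φ) (u.targetSide φ) := u.disjoint_sides.preimage φ

theorem finite_boundary_sourceSide [Finite X] (φ : FreeGroup X ≃* FreeGroup X) (u : UWord X) :
    (boundary (u.sourceSide φ)).Finite := by
  rw [sourceSide, initialSide_eq, Set.preimage_compl, boundary_compl]
  exact finite_boundary_preimage_halfTree φ _ _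

theorem finite_boundary_targetSide [Finite X] (φ : FreeGroup X ≃* FreeGroup X) (u : UWord X) :
    (boundary (u.targetSide φ)).Finite := by
  rw [targetSide, finalSide_eq]
  exact finite_boundary_preimage_halfTree φ _ _

theorem exists_between_of_develops {Γ : LabeledGraph X} (hΓ : Γ.Folded)
    {R : Γ.V → FreeGroup X → Prop} {c : FreeGroup X} (D : Develops Γ R c) {z z' : Γ.V}
    {a g b : FreeGroup X} (ha : R z a) (hb : R z' b) (h : Between a g b) : ∃ y, R y g := by
  obtain ⟨L₁, L₂, hw, rfl⟩ := between_iff_exists.1 h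
  obtain ⟨p, hp, hl⟩ := hΓ.exists_path (D.conn _ _ _ _ ha hb)
  rw [hw] at hl
  obtain ⟨p₁, p₂, rfl, rfl, -⟩ := List.map_eq_append_iff.1 hl
  obtain ⟨y, hy, -⟩ := isPath_append.1 hp
  exact ⟨y, D.path hy ha⟩

/-- Morphisms from a segment correspond to segments in the development. -/
theorem exists_hom_of_develops (v : UWord X) {Γ : LabeledGraph X} (hΓ : Γ.Folded)
    {R : Γ.V → FreeGroup X → Prop} {c : FreeGroup X} (D : Develops Γ R c) {P : FreeGroup X}
    (h₁ : ∃ z, R z P) (h₂ : ∃ z, R z (P * v.word)) :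
    ∃ h : Hom v.graph Γ, R (h.onV v.first) P := by
  obtain ⟨z, hz⟩ := h₁
  obtain ⟨z', hz'⟩ := h₂
  have hj := D.conn _ _ _ _ hz hz'
  rw [inv_mul_cancel_left] at hj
  obtain ⟨p, hp, hl⟩ := hΓ.exists_path hj
  obtain ⟨h, hh, -⟩ := exists_hom_line hp hl
  exact ⟨h, by
    change R (h.onV (0 : Fin (v.word.toWord.length + 1))) P
    rw [hh]
    exact hz⟩

theorem lineDev_first (v : UWord X) (a g : FreeGroup X) :
    v.dev a v.first g ↔ g = a := by
  simp [dev, lineDev, first, ← one_eq_mk]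

theorem lineDev_last (v : UWord X) (a g : FreeGroup X) :
    v.dev a v.last g ↔ g = a * v.word := by
  have : v.word.toWord.take v.word.toWord.length = v.word.toWord := List.take_length
  simp [dev, lineDev, last, -List.take_length, this, mk_toWord]

theorem develops_map (v : UWord X) {Γ : LabeledGraph X} {R : Γ.V → FreeGroup X → Prop}
    {c : FreeGroup X} (D : Develops Γ R c) {P : FreeGroup X} (h : Hom v.graph Γ)
    (hP : R (h.onV v.first) P) (z : v.graph.V) (g : FreeGroup X)
    (hz : v.dev P z g) : R (h.onV z) g :=
  (v.develops_dev P).map D h ((v.lineDev_first P P).2 rfl) hP hz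

variable (φ : FreeGroup X ≃* FreeGroup X)

theorem foldDev_lineDev (v : UWord X) (a : FreeGroup X)
    {Z : (foldSubst φ.toMonoidHom v.graph).V} {g : FreeGroup X} :
    foldDev φ (v.dev a) Z g ↔
      foldDev φ (v.dev 1) Z (φ a⁻¹ * g) := by
  rw [← foldDev_translate]
  have : v.dev a = fun z g => v.dev 1 z (a⁻¹ * g) := by
    funext z g
    simp only [dev, lineDev, one_mul, inv_mul_eq_iff_eq_mul]
  rw [this]

theorem develops_fold_line (v : UWord X) (a : FreeGroup X) :
    Develops (foldSubst φ.toMonoidHom v.graph) (foldDev φ (v.dev a)) 1 := by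
  have := develops_fold φ (v.develops_dev a)
  rwa [_root_.map_one] at this

/-- Since the deck group of a segment is trivial, fixing the position of `u` in the tree fixes that
of `v`. -/
theorem foldDev_lineDev_unique (v : UWord X) {a b g : FreeGroup X}
    {Z : (foldSubst φ.toMonoidHom v.graph).V} (ha : foldDev φ (v.dev a) Z g)
    (hb : foldDev φ (v.dev b) Z g) : a = b := by
  rw [foldDev_lineDev] at ha hb
  obtain ⟨k, hk⟩ := (v.develops_fold_line φ 1).deck _ _ _ ha hb
  rw [one_zpow, one_mul] at hk
  have := φ.injective (mul_right_cancel hk)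
  exact (inv_injective this).symm

theorem exists_start (v : UWord X) (Z : (foldSubst φ.toMonoidHom v.graph).V) :
    ∃ a, foldDev φ (v.dev a) Z 1 := by
  obtain ⟨g, hg⟩ := (v.develops_fold_line φ 1).total Z
  refine ⟨(φ.symm g)⁻¹, ?_⟩
  rw [foldDev_lineDev]
  simpa using hg

/-- The points `P` and `Q` lie on different sides of `u`. -/
def Ends (u : UWord X) (P Q : FreeGroup X) : Prop :=
  (P ∈ u.sourceSide φ ∧ Q ∈ u.targetSide φ) ∨ (P ∈ u.targetSide φ ∧ Q ∈ u.sourceSide φ)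

/-- The edges of `φ(v)` are those that separate the images of the end points of `v`, and all edges
of `u` do so exactly when these images lie on different sides of `u`. -/
theorem exists_image_iff (u v : UWord X) {a : FreeGroup X}
    (k : Hom u.graph (foldSubst φ.toMonoidHom v.graph))
    (hk : foldDev φ (v.dev a) (k.onV u.first) 1) :
    (∃ f : Hom u.graph (v.image φ), (v.imageIncl φ).comp f = k) ↔ u.Ends φ a (a * v.word) := by
  have D := v.develops_fold_line φ a
  refine u.exists_span_iff D (l₁ := pure (φ a)) (l₂ := pure (φ (a * v.word)))
    (fun e g he => ?_) k hk
  refine (folded_fold _).mem_span_geodesicEdges_iff D ?_ ?_ he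
  · exact (foldDev_vertex φ (v.develops_dev a)).2 ((v.lineDev_first a a).2 rfl)
  · exact (foldDev_vertex φ (v.develops_dev a)).2 ((v.lineDev_last a _).2 rfl)

end UWord

/-! ### Marked u-words as pairs of points in the tree. -/

namespace MarkedUWord

open FreeGroup

variable {X : Type*} [DecidableEq X] {φ : FreeGroup X ≃* FreeGroup X} {u : UWord X}

/-- The initial point of the base word in the Cayley tree, placed so that `u` starts at `1`. -/
noncomputable def start (p : MarkedUWord φ u) : FreeGroup X :=
  (p.base.exists_start φ (p.toFold.onV u.first)).choose

theorem start_spec (p : MarkedUWord φ u) :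
    foldDev φ (p.base.dev p.start) (p.toFold.onV u.first) 1 :=
  (p.base.exists_start φ (p.toFold.onV u.first)).choose_spec

/-- The final point of the base word in the Cayley tree. -/
noncomputable def finish (p : MarkedUWord φ u) : FreeGroup X := p.start * p.base.word

theorem ends (p : MarkedUWord φ u) : u.Ends φ p.start p.finish :=
  (u.exists_image_iff φ p.base p.toFold p.start_spec).1 ⟨p.emb, rfl⟩

open Classical in
/-- The end point of the base word on the side where `u` starts. -/
noncomputable def src (p : MarkedUWord φ u) : FreeGroup X :=
  if p.start ∈ u.sourceSide φ then p.start else p.finish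

open Classical in
/-- The end point of the base word on the side where `u` ends. -/
noncomputable def tgt (p : MarkedUWord φ u) : FreeGroup X :=
  if p.start ∈ u.sourceSide φ then p.finish else p.start

theorem src_tgt_cases (p : MarkedUWord φ u) :
    (p.src = p.start ∧ p.tgt = p.finish) ∨ (p.src = p.finish ∧ p.tgt = p.start) := by
  by_cases h : p.start ∈ u.sourceSide φ <;> simp [src, tgt, h]

theorem src_mem_and_tgt_mem (p : MarkedUWord φ u) :
    p.src ∈ u.sourceSide φ ∧ p.tgt ∈ u.targetSide φ := by
  rcases p.ends with ⟨h1, h2⟩ | ⟨h1, h2⟩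
  · simp [src, tgt, h1, h2]
  · have h3 : p.start ∉ u.sourceSide φ :=
      fun h => Set.disjoint_left.1 (u.disjoint_source_target φ) h h1
    simp [src, tgt, h1, h2, h3]

theorem src_mem (p : MarkedUWord φ u) : p.src ∈ u.sourceSide φ := p.src_mem_and_tgt_mem.1

theorem tgt_mem (p : MarkedUWord φ u) : p.tgt ∈ u.targetSide φ := p.src_mem_and_tgt_mem.2

theorem src_ne_tgt (p : MarkedUWord φ u) : p.src ≠ p.tgt := fun h =>
  Set.disjoint_left.1 (u.disjoint_source_target φ) p.src_mem (h ▸ p.tgt_mem)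

theorem forall_src_tgt_iff (p : MarkedUWord φ u) (Y : FreeGroup X → Prop) :
    (Y p.start ∧ Y p.finish) ↔ (Y p.src ∧ Y p.tgt) := by
  rcases p.src_tgt_cases with ⟨h1, h2⟩ | ⟨h1, h2⟩
  · rw [h1, h2]
  · rw [h1, h2, and_comm]

theorem between_src_tgt_iff (p : MarkedUWord φ u) (g : FreeGroup X) :
    Between p.start g p.finish ↔ Between p.src g p.tgt := by
  rcases p.src_tgt_cases with ⟨h1, h2⟩ | ⟨h1, h2⟩
  · rw [h1, h2]
  · rw [h1, h2]
    exact ⟨Between.symm, Between.symm⟩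

theorem ext_of_start {p q : MarkedUWord φ u} (hb : p.base = q.base) (hs : p.start = q.start) :
    p = q := by
  have hp := p.start_spec
  have hq := q.start_spec
  rw [← hs] at hq
  obtain ⟨v, f⟩ := p
  obtain ⟨v', f'⟩ := q
  obtain rfl : v = v' := hb
  congr 1
  refine spanIncl_comp_injective _ ?_
  refine (folded_fold _).hom_ext (z₀ := u.first) (connected_line u.word.toWord) ?_
  exact (v.develops_fold_line φ _).inj (folded_fold _) hp hq

/-- If the chosen orientations disagreed, the base words would be inverse to each other, hence the
same u-word, hence equal words. A nontrivial element of a free group is not its own inverse. -/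
theorem ext_of_src_tgt {p q : MarkedUWord φ u} (hs : p.src = q.src) (ht : p.tgt = q.tgt) :
    p = q := by
  have hpw : p.base.word = p.start⁻¹ * p.finish := by rw [finish, inv_mul_cancel_left]
  have hqw : q.base.word = q.start⁻¹ * q.finish := by rw [finish, inv_mul_cancel_left]
  have straight : p.start = q.start → p.finish = q.finish → p = q := by
    intro h1 h2
    exact ext_of_start (UWord.eq_of_word (Or.inl (by rw [hpw, hqw, h1, h2]))) h1
  have crossed : p.start = q.finish → p.finish = q.start → p = q := by
    intro h1 h2
    have h3 : q.base.word = p.base.word⁻¹ := by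
      rw [hpw, hqw, h1, h2]
      group
    have h4 : p.base = q.base := UWord.eq_of_word (Or.inr h3)
    rw [h4] at h3
    have h5 : q.base.word ^ 2 = 1 := by
      rw [pow_two]
      nth_rewrite 1 [h3]
      exact inv_mul_cancel _
    exact absurd ((pow_eq_one_iff_left two_ne_zero).1 h5) q.base.word_ne_one
  rcases p.src_tgt_cases with ⟨h1, h2⟩ | ⟨h1, h2⟩ <;>
    rcases q.src_tgt_cases with ⟨h3, h4⟩ | ⟨h3, h4⟩
  · exact straight (by rw [← h1, ← h3, hs]) (by rw [← h2, ← h4, ht])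
  · exact crossed (by rw [← h1, ← h3, hs]) (by rw [← h2, ← h4, ht])
  · exact crossed (by rw [← h2, ← h4, ht]) (by rw [← h1, ← h3, hs])
  · exact straight (by rw [← h2, ← h4, ht]) (by rw [← h1, ← h3, hs])

/-- The geodesic from `φ a` to `φ b` contains the segment from `1` to `u.word`, so `u` maps to the
folded graph of the u-word between `a` and `b`, with image in its geodesic. -/
theorem exists_of_mem {a b : FreeGroup X} (ha : a ∈ u.sourceSide φ) (hb : b ∈ u.targetSide φ) :
    ∃ p : MarkedUWord φ u, p.src = a ∧ p.tgt = b := by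
  have hab : a ≠ b := fun h => Set.disjoint_left.1 (u.disjoint_source_target φ) ha (h ▸ hb)
  obtain ⟨v, P, Q, hPQ, hcases⟩ := UWord.exists_segment hab
  have D := v.develops_fold_line φ P
  have hf : (foldSubst φ.toMonoidHom v.graph).Folded := folded_fold _
  have hP := (foldDev_vertex φ (v.develops_dev P)).2 ((v.lineDev_first P P).2 rfl)
  have hQ := (foldDev_vertex φ (v.develops_dev P)).2 ((v.lineDev_last P Q).2 hPQ.symm)
  have ha' : Between (φ a) 1 u.word := ha
  have hb' : Between 1 u.word (φ b) := hb
  have h1 : Between (φ a) 1 (φ b) := ha'.trans_of_ne u.word_ne_one.symm hb'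
  have h2 : Between (φ a) u.word (φ b) :=
    (hb'.symm.trans_of_ne u.word_ne_one ha'.symm).symm
  have hends : u.Ends φ P (P * v.word) := by
    rw [hPQ]
    rcases hcases with ⟨rfl, rfl⟩ | ⟨rfl, rfl⟩
    · exact Or.inl ⟨ha, hb⟩
    · exact Or.inr ⟨hb, ha⟩
  have hY : ∀ g, Between (φ a) g (φ b) → ∃ y, foldDev φ (v.dev P) y g := by
    intro g hg
    rcases hcases with ⟨rfl, rfl⟩ | ⟨rfl, rfl⟩
    · exact UWord.exists_between_of_develops hf D hP hQ hg
    · exact UWord.exists_between_of_develops hf D hP hQ hg.symm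
  obtain ⟨k, hk⟩ := u.exists_hom_of_develops hf D (P := 1) (hY 1 h1) (by
    rw [one_mul]
    exact hY _ h2)
  obtain ⟨f, rfl⟩ := (u.exists_image_iff φ v k hk).2 hends
  refine ⟨⟨v, f⟩, ?_⟩
  set p : MarkedUWord φ u := ⟨v, f⟩ with hp
  have hs : p.start = P := v.foldDev_lineDev_unique φ p.start_spec hk
  have hfin : p.finish = Q := by
    rw [finish, hs]
    exact hPQ
  have hsrc := p.src_mem
  have htgt := p.tgt_mem
  have hdisj := Set.disjoint_left.1 (u.disjoint_source_target φ)
  have hst := p.src_tgt_cases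
  rw [hs, hfin] at hst
  rcases hst with ⟨h3, h4⟩ | ⟨h3, h4⟩ <;> rw [h3] at hsrc ⊢ <;> rw [h4] at htgt ⊢ <;>
    rcases hcases with ⟨rfl, rfl⟩ | ⟨rfl, rfl⟩
  · exact ⟨rfl, rfl⟩
  · exact (hdisj hsrc hb).elim
  · exact (hdisj hsrc hb).elim
  · exact ⟨rfl, rfl⟩

/-! ### Morphisms between base words -/

section Compat

variable (p : MarkedUWord φ u) {Δ : LabeledGraph X} {R : Δ.V → FreeGroup X → Prop}
  {c : FreeGroup X}

theorem foldDev_comp (D : Develops Δ R c) (h : Hom p.base.graph Δ)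
    (hs : R (h.onV p.base.first) p.start) :
    foldDev φ R (((foldSubstMap φ.toMonoidHom h).comp p.toFold).onV u.first) 1 :=
  foldDev_map φ h (p.base.develops_map D h hs) p.start_spec

theorem comp_eq_iff (D : Develops Δ R c) {k : Hom u.graph (foldSubst φ.toMonoidHom Δ)}
    (hk : foldDev φ R (k.onV u.first) 1) (h : Hom p.base.graph Δ) :
    (foldSubstMap φ.toMonoidHom h).comp p.toFold = k ↔ R (h.onV p.base.first) p.start := by
  constructor
  · rintro rfl
    obtain ⟨g, hg⟩ := D.total (h.onV p.base.first)
    -- Translated in this way, the development puts `p.start` over the image of the initial vertex.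
    -- Comparing the two points over the start of `u` shows that the translation is a deck
    -- transformation.
    have D' := D.translate (g * p.start⁻¹)
    have h1 := p.foldDev_comp D' h (by simpa using hg)
    rw [foldDev_translate, mul_one] at h1
    obtain ⟨k, hk⟩ := (develops_fold φ D).deck _ _ _ h1 hk
    rw [← map_zpow, ← _root_.map_mul, eq_comm, map_eq_one_iff φ φ.injective, ← mul_assoc,
      mul_inv_eq_one] at hk
    rw [← hk]
    exact D.shift _ _ k hg
  · intro hs
    refine (folded_fold _).hom_ext (z₀ := u.first) (connected_line u.word.toWord) ?_
    exact (develops_fold φ D).inj (folded_fold _) (p.foldDev_comp D h hs) hk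

/-- Compatibility forces the position of the base word, so the only question is whether this segment
lies in the development. By connectedness its two end points decide. -/
theorem exists_comp_eq_iff (hΔ : Δ.Folded) (D : Develops Δ R c)
    {k : Hom u.graph (foldSubst φ.toMonoidHom Δ)} (hk : foldDev φ R (k.onV u.first) 1) :
    (∃ h : Hom p.base.graph Δ, (foldSubstMap φ.toMonoidHom h).comp p.toFold = k) ↔
      (∃ z, R z p.src) ∧ ∃ z, R z p.tgt := by
  rw [← p.forall_src_tgt_iff fun g => ∃ z, R z g]
  constructor
  · rintro ⟨h, hh⟩
    rw [p.comp_eq_iff D hk] at hh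
    exact ⟨⟨_, hh⟩, _, p.base.develops_map D h hh _ _ ((p.base.lineDev_last _ _).2 rfl)⟩
  · rintro ⟨h1, h2⟩
    obtain ⟨h, hh⟩ := p.base.exists_hom_of_develops hΔ D h1 h2
    exact ⟨h, (p.comp_eq_iff D hk h).2 hh⟩

end Compat

theorem exists_lineDev_start_iff (q : MarkedUWord φ u) (g : FreeGroup X) :
    (∃ z, q.base.dev q.start z g) ↔ Between q.src g q.tgt := by
  rw [q.base.exists_dev_iff]
  exact q.between_src_tgt_iff g

theorem isSub_iff {p q : MarkedUWord φ u} :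
    p.IsSub q ↔ Between q.src p.src q.tgt ∧ Between q.src p.tgt q.tgt := by
  rw [← q.exists_lineDev_start_iff, ← q.exists_lineDev_start_iff]
  exact p.exists_comp_eq_iff q.base.folded_graph (q.base.develops_dev _) q.start_spec

/-- Morphisms to u-words are segments that contain the one from `p.src` to `p.tgt`, and each must
have its ends on different sides of `u`. Keeping one end fixed and moving the other gives the two
conditions of an ideal pair. Conversely, these apply to the two ends of any larger segment. -/
theorem isIdealPreimage_iff {p : MarkedUWord φ u} : p.IsIdealPreimage ↔
    IsIdealPair (u.sourceSide φ) (u.targetSide φ) p.src p.tgt := by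
  have hdisj := Set.disjoint_left.1 (u.disjoint_source_target φ)
  constructor
  · intro h
    have key : ∀ a b : FreeGroup X, a ≠ b → Between a p.src b → Between a p.tgt b →
        u.Ends φ a b := by
      intro a b hab h1 h2
      obtain ⟨v, P, Q, hPQ, hcases⟩ := UWord.exists_segment hab
      have hY : ∀ g, Between a g b → ∃ z, v.dev P z g := by
        intro g hg
        rw [v.exists_dev_iff, hPQ]
        rcases hcases with ⟨rfl, rfl⟩ | ⟨rfl, rfl⟩
        · exact hg
        · exact hg.symm
      obtain ⟨h3, h4⟩ :=
        (p.forall_src_tgt_iff fun g => ∃ z, v.dev P z g).2 ⟨hY _ h1, hY _ h2⟩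
      obtain ⟨k, hk⟩ := p.base.exists_hom_of_develops v.folded_graph
        (v.develops_dev P) h3 h4
      obtain ⟨f, hf⟩ := h v k
      have h5 := p.foldDev_comp (v.develops_dev P) k hk
      have h6 := (u.exists_image_iff φ v _ h5).1 ⟨f, hf.symm⟩
      rw [hPQ] at h6
      rcases hcases with ⟨rfl, rfl⟩ | ⟨rfl, rfl⟩
      · exact h6
      · exact h6.symm.imp And.symm And.symm
    constructor
    · intro c hc
      have hne : c ≠ p.tgt := by
        rintro rfl
        exact p.src_ne_tgt (eq_of_between_self hc)
      rcases key c p.tgt hne hc (between_right _ _) with ⟨h1, -⟩ | ⟨-, h2⟩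
      · exact h1
      · exact (hdisj h2 p.tgt_mem).elim
    · intro d hd
      have hne : p.src ≠ d := by
        rintro rfl
        exact p.src_ne_tgt (eq_of_between_self hd).symm
      rcases key p.src d hne (between_left _ _) hd with ⟨-, h1⟩ | ⟨h2, -⟩
      · exact h1
      · exact (hdisj p.src_mem h2).elim
  · intro hI w h
    obtain ⟨P, hP⟩ : ∃ P, w.dev P (h.onV p.base.first) p.start :=
      ⟨_, (inv_mul_cancel_right _ _).symm⟩
    have D := w.develops_dev P
    have hk := p.foldDev_comp D h hP
    have hY := (p.exists_comp_eq_iff w.folded_graph D hk).1 ⟨h, rfl⟩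
    rw [w.exists_dev_iff, w.exists_dev_iff] at hY
    have hends : u.Ends φ P (P * w.word) := by
      rcases between_two_points p.src_ne_tgt hY.1 hY.2 with ⟨h1, h2⟩ | ⟨h1, h2⟩
      · exact Or.inl ⟨hI.left _ h1, hI.right _ h2⟩
      · exact Or.inr ⟨hI.right _ h1.symm, hI.left _ h2.symm⟩
    obtain ⟨f, hf⟩ := (u.exists_image_iff φ w _ hk).2 hends
    exact ⟨f, hf.symm⟩

end MarkedUWord

/-! ### Cyclic completion, one-letter extensions, and lines through ideal pairs. -/

namespace FreeGroup

variable {X : Type*}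

theorem IsReduced.eq_of_fst_eq {x : X × Bool} {t : List (X × Bool)} (h : IsReduced (x :: t))
    (ht : ∀ l ∈ t, l.1 = x.1) : ∀ l ∈ t, l = x := by
  induction t generalizing x with
  | nil => simp
  | cons y t ih =>
    rw [isReduced_cons_cons] at h
    have hy : y.1 = x.1 := ht y (by simp)
    obtain rfl : x = y := Prod.ext hy.symm (h.1 hy.symm)
    intro l hl
    rcases List.mem_cons.1 hl with rfl | hl
    · rfl
    · exact ih h.2 (fun l hl => ht l (List.mem_cons_of_mem _ hl)) l hl

/-- If the last letter is inverse to the first, some letter of the word belongs to another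
generator, since a reduced word in one generator repeats one letter. Appending that letter removes
the cancellation. -/
theorem IsReduced.exists_isCyclicallyReduced_append {L : List (X × Bool)} (h : IsReduced L)
    (hL : L ≠ []) : ∃ L', IsCyclicallyReduced (L ++ L') := by
  by_cases hc : IsCyclicallyReduced L
  · exact ⟨[], by rwa [List.append_nil]⟩
  obtain ⟨x, t, rfl⟩ := List.exists_cons_of_ne_nil hL
  obtain ⟨y, hy, hyx, hyx'⟩ : ∃ y ∈ (x :: t).getLast?, y.1 = x.1 ∧ y.2 ≠ x.2 := by
    by_contra! hn
    exact hc ⟨h, fun a ha b hb hab => by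
      obtain rfl : x = b := by simpa using hb
      exact hn a ha hab⟩
  obtain ⟨z, hz, hzx⟩ : ∃ z ∈ t, z.1 ≠ x.1 := by
    by_contra! hn
    have h1 := h.eq_of_fst_eq hn
    rcases List.mem_cons.1 (List.mem_of_mem_getLast? hy) with rfl | h2
    · exact hyx' rfl
    · rw [h1 y h2] at hyx'
      exact hyx' rfl
  refine ⟨[z], isReduced_append.2 ⟨h, IsReduced.singleton, ?_⟩, ?_⟩
  · intro a ha b hb
    obtain rfl : y = a := Option.some_injective _ (hy.symm.trans ha)
    obtain rfl : z = b := by simpa using hb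
    rw [ne_barLetter_iff, hyx]
    exact fun h => absurd h.symm hzx
  · intro a ha b hb hab
    obtain rfl : z = a := by
      rw [List.getLast?_concat] at ha
      exact Option.some_injective _ ha
    obtain rfl : x = b := by simpa using hb
    exact absurd hab hzx

variable [DecidableEq X]

theorem isReduced_invRev {L : List (X × Bool)} : IsReduced (invRev L) ↔ IsReduced L := by
  rw [isReduced_iff_reduce_eq, isReduced_iff_reduce_eq, reduce_invRev]
  exact invRev_injective.eq_iff

theorem isReduced_append_singleton_iff {o e : FreeGroup X} {y : X × Bool} :
    IsReduced ((o⁻¹ * e).toWord ++ [y]) ↔ o ∉ halfTree e y := by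
  have h1 : (o⁻¹ * e).toWord.getLast?.map barLetter = (e⁻¹ * o).toWord.head? := by
    rw [← head?_invRev, ← toWord_inv]
    congr 2
    group
  rw [isReduced_append, mem_halfTree, ← h1]
  constructor
  · rintro ⟨-, -, h⟩ h2
    obtain ⟨a, ha, hay⟩ := Option.map_eq_some_iff.1 h2
    exact h a ha y (by simp) hay.symm
  · intro h
    refine ⟨isReduced_toWord, IsReduced.singleton, fun a ha b hb hab => h ?_⟩
    obtain rfl : y = b := by simpa using hb
    rw [Option.mem_def.1 ha, Option.map_some, hab]

theorem between_mul_letter_right {o e d : FreeGroup X} {y : X × Bool} (ho : o ∉ halfTree e y)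
    (hd : d ∈ halfTree e y) : Between o (e * mk [y]) d :=
  ((between_iff_of_mem (mem_halfTree_barLetter.2 ho)).2
    fun h => mem_halfTree_barLetter.1 h hd).symm

theorem between_of_notMem {o e : FreeGroup X} {y : X × Bool} (ho : o ∉ halfTree e y) :
    Between o e (e * mk [y]) :=
  (between_iff_of_mem (mul_letter_mem_halfTree e y)).2 ho

theorem exists_notMem_halfTree {o e : FreeGroup X} (h : o ≠ e) : ∃ y, o ∉ halfTree e y := by
  obtain ⟨x, hx⟩ := exists_mem_halfTree h.symm
  exact ⟨barLetter x, fun h' => barLetter_ne x (halfTree_letter_unique h' hx)⟩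

theorem mul_letter_ne (e : FreeGroup X) (y : X × Bool) : e * mk [y] ≠ e := fun h => by
  have h1 := mul_letter_mem_halfTree e y
  rw [h] at h1
  exact self_notMem_halfTree e y h1

/-- A reduced word cannot overlap with the inverse of its extension by one letter. -/
theorem not_between_mul_inv {m : FreeGroup X} (hm : m ≠ 1) {x : X × Bool}
    (hr : IsReduced (m.toWord ++ [x])) (a : FreeGroup X) :
    ¬ Between a (a * m) (a * (m * mk [x])⁻¹) := by
  intro h
  have hmx : (m * mk [x])⁻¹.toWord = invRev (m.toWord ++ [x]) := by
    rw [toWord_inv]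
    congr 1
    rw [← hr.toWord_mk_eq, ← mul_mk, mk_toWord]
  rw [between_iff_toWord, inv_mul_cancel_left, inv_mul_cancel_left, hmx, invRev_append] at h
  set T := ((a * m)⁻¹ * (a * (m * mk [x])⁻¹)).toWord
  rcases hW : m.toWord with _ | ⟨w, W⟩
  · exact hm (toWord_eq_nil_iff.1 hW)
  rw [hW, invRev_cons (a := w)] at h
  have h1 : invRev [x] = [barLetter x] := by simp [invRev, barLetter]
  have h2 : invRev [w] = [barLetter w] := by simp [invRev, barLetter]
  rw [h1, h2, List.singleton_append, List.cons_append, List.cons.injEq] at h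
  obtain ⟨h3, h4⟩ := h
  have hT : T.length = 1 := by
    have := congrArg List.length h4
    simp at this
    omega
  have h5 := (List.append_inj' h4 (by simp [hT])).1
  have hWr : IsReduced W := by
    have : IsReduced ([w] ++ W) := by
      rw [List.singleton_append, ← hW]
      exact isReduced_toWord
    exact this.of_append_right
  -- The overlap forces `W` to be its own inverse, hence trivial. Then `m` is the single letter
  -- inverse to `x`, which contradicts reducedness.
  have h6 : mk W = 1 := by
    have h7 : mk W * mk W = 1 := by
      nth_rewrite 1 [← h5]
      rw [← inv_mk, inv_mul_cancel]
    rw [← pow_two] at h7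
    exact (pow_eq_one_iff_left two_ne_zero).1 h7
  have h8 : W = [] := by rw [← hWr.toWord_mk_eq, h6, toWord_one]
  rw [hW, h8, ← h3] at hr
  refine (isReduced_append.1 hr).2.2 (barLetter x) (by simp) x (by simp) ?_
  rw [barLetter_barLetter]

theorem IsIdealPair.symm {A B : Set (FreeGroup X)} {a b : FreeGroup X}
    (h : IsIdealPair A B a b) : IsIdealPair B A b a :=
  ⟨fun c hc => h.right c hc.symm, fun d hd => h.left d hd.symm⟩

theorem IsIdealPair.mul_letter {A B : Set (FreeGroup X)} {o e : FreeGroup X} {y : X × Bool}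
    (h : IsIdealPair A B o e) (hy : o ∉ halfTree e y) :
    IsIdealPair A B o (e * FreeGroup.mk [y]) := by
  have hb := between_of_notMem hy
  refine ⟨fun c hc => h.left c (hb.trans_left hc), fun d hd => h.right d ?_⟩
  exact hb.trans_of_ne (mul_letter_ne e y).symm (hb.symm.trans_left hd.symm).symm

/-- A point beyond `e` other than `e` is beyond one of the extensions, and a point behind `o` is
behind `o` for any extension. This is why a full paradigm of ideal preimages comes from an ideal
preimage. -/
theorem isIdealPair_of_mul_letter {A B : Set (FreeGroup X)} {o e : FreeGroup X} (hoe : o ≠ e)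
    (he : e ∈ B) (h : ∀ y, o ∉ halfTree e y → IsIdealPair A B o (e * FreeGroup.mk [y])) :
    IsIdealPair A B o e := by
  constructor
  · intro c hc
    obtain ⟨y, hy⟩ := exists_notMem_halfTree hoe
    exact (h y hy).left c (hc.trans_of_ne hoe (between_of_notMem hy))
  · intro d hd
    by_cases hde : e = d
    · exact hde ▸ he
    obtain ⟨y, hy⟩ := exists_mem_halfTree hde
    have ho : o ∉ halfTree e y := fun ho => hd y ho hy
    exact (h y ho).right d (between_mul_letter_right ho hy)

namespace Line

variable (ℓ : Line X)

theorem adjacent {m n : ℤ} {y : X × Bool} (h : ℓ.pt m = ℓ.pt n * FreeGroup.mk [y]) :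
    m = n + 1 ∨ m = n - 1 := by
  have h1 : ℓ.pt m ∈ halfTree (ℓ.pt n) y := h ▸ mul_letter_mem_halfTree _ _
  rcases lt_trichotomy m n with hlt | rfl | hlt
  · right
    have h2 : ℓ.pt m ∈ halfTree (ℓ.pt n) (barLetter (ℓ.letter (n - 1))) := by
      rw [compl_half, Set.mem_compl_iff, pt_mem_half]
      omega
    apply ℓ.pt_injective
    have h3 := ℓ.step (n - 1)
    rw [sub_add_cancel] at h3
    rw [h, halfTree_letter_unique h1 h2, h3, ← inv_mk_singleton, mul_inv_cancel_right]
  · exact (self_notMem_halfTree _ _ h1).elim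
  · left
    apply ℓ.pt_injective
    rw [h, ℓ.step, halfTree_letter_unique h1 (ℓ.pt_mem_half.2 hlt)]

theorem mem_range_of_between {a b g : FreeGroup X} (ha : a ∈ Set.range ℓ.pt)
    (hb : b ∈ Set.range ℓ.pt) (h : Between a g b) : g ∈ Set.range ℓ.pt := by
  obtain ⟨i, rfl⟩ := ha
  obtain ⟨j, rfl⟩ := hb
  rcases le_total i j with hij | hij
  · obtain ⟨k, -, -, rfl⟩ := ℓ.exists_of_between hij h
    exact ⟨k, rfl⟩
  · obtain ⟨k, -, -, rfl⟩ := ℓ.exists_of_between hij h.symm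
    exact ⟨k, rfl⟩

end Line

/-- The line runs from `A` to `B`. -/
def Line.Runs (ℓ : Line X) (A B : Set (FreeGroup X)) : Prop :=
  (∀ᶠ i in Filter.atBot, ℓ.pt i ∈ A) ∧ ∀ᶠ i in Filter.atTop, ℓ.pt i ∈ B

omit [DecidableEq X] in
theorem Line.runs_reverse (ℓ : Line X) {A B : Set (FreeGroup X)} :
    ℓ.reverse.Runs A B ↔ ℓ.Runs B A := by
  rw [Line.Runs, ℓ.eventually_reverse' (p := fun g => g ∈ A),
    ℓ.eventually_reverse (p := fun g => g ∈ B), and_comm]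
  rfl

/-- A line that contains an ideal pair can be oriented from `A` to `B`. -/
theorem IsIdealPair.exists_runs {A B : Set (FreeGroup X)} {a b : FreeGroup X} (hab : a ≠ b)
    (h : IsIdealPair A B a b) (ℓ : Line X) (ha : a ∈ Set.range ℓ.pt) (hb : b ∈ Set.range ℓ.pt) :
    ℓ.Runs A B ∨ ℓ.Runs B A := by
  have key : ∀ ℓ : Line X, ∀ i j : ℤ, i < j → IsIdealPair A B (ℓ.pt i) (ℓ.pt j) →
      ℓ.Runs A B := by
    intro ℓ i j hij hI
    obtain ⟨h1, h2⟩ := (ℓ.isIdealPair_iff hij).1 hI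
    refine ⟨Filter.eventually_atBot.2 ⟨i, fun n hn => h1 ?_⟩,
      Filter.eventually_atTop.2 ⟨j, fun n hn => h2 ?_⟩⟩
    · rw [Set.mem_compl_iff, ℓ.pt_mem_half]
      omega
    · rw [ℓ.pt_mem_half]
      omega
  obtain ⟨i, rfl⟩ := ha
  obtain ⟨j, rfl⟩ := hb
  rcases lt_trichotomy i j with hij | rfl | hij
  · exact Or.inl (key ℓ i j hij h)
  · exact absurd rfl hab
  · right
    rw [← ℓ.runs_reverse]
    exact key ℓ.reverse (-i) (-j) (by omega) (by simpa [Line.reverse] using h)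

end FreeGroup

/-! ### Cyclic words as periodic lines. -/

namespace CyclicWord

open FreeGroup

variable {X : Type*} [DecidableEq X]

theorem length_pos (w : CyclicWord X) : 0 < w.word.toWord.length :=
  List.length_pos_iff.2 fun h => w.word_ne_one (toWord_eq_nil_iff.1 h)

theorem folded_graph (w : CyclicWord X) : w.graph.Folded := folded_circle w.cyclicallyReduced

/-- The development of the graph of a cyclic word that sends the initial vertex to `a`. -/
def dev (w : CyclicWord X) (a : FreeGroup X) : w.graph.V → FreeGroup X → Prop :=
  circleDev w.word.toWord a

theorem develops_dev (w : CyclicWord X) (a : FreeGroup X) :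
    Develops w.graph (w.dev a) (a * w.word * a⁻¹) := by
  have := develops_circle w.word.toWord w.length_pos a
  rwa [mk_toWord] at this

/-- The line through `a` that covers a cyclic word. -/
def line (w : CyclicWord X) (a : FreeGroup X) : Line X :=
  circleLine w.cyclicallyReduced w.length_pos a

theorem exists_dev_iff (w : CyclicWord X) {a g : FreeGroup X} :
    (∃ z, w.dev a z g) ↔ g ∈ Set.range (w.line a).pt :=
  exists_circleDev_iff w.cyclicallyReduced w.length_pos a

/-- The initial vertex of the circle. -/
def origin (w : CyclicWord X) : w.graph.V := (⟨0, w.length_pos⟩ : Fin w.word.toWord.length)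

theorem dev_origin (w : CyclicWord X) (a : FreeGroup X) : w.dev a w.origin a :=
  ⟨0, by simp [origin, ← one_eq_mk]⟩

theorem exists_line_of_ne {a b : FreeGroup X} (h : a ≠ b) : ∃ (w : CyclicWord X) (c : FreeGroup X),
    a ∈ Set.range (w.line c).pt ∧ b ∈ Set.range (w.line c).pt := by
  have hL : (a⁻¹ * b).toWord ≠ [] := fun h' => h (inv_mul_eq_one.1 (toWord_eq_nil_iff.1 h'))
  obtain ⟨L', hL'⟩ := (isReduced_toWord (x := a⁻¹ * b)).exists_isCyclicallyReduced_append hL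
  have hw := hL'.isReduced.toWord_mk_eq
  have hpos : 0 < ((a⁻¹ * b).toWord ++ L').length := List.length_pos_iff.2 (by simp [hL])
  have hne : FreeGroup.mk ((a⁻¹ * b).toWord ++ L') ≠ 1 := fun h' => by
    rw [← toWord_eq_nil_iff, hw] at h'
    rw [h'] at hpos
    simp at hpos
  let w : CyclicWord X := ⟨FreeGroup.mk ((a⁻¹ * b).toWord ++ L'), hne, by rwa [hw]⟩
  have hw' : w.word.toWord = (a⁻¹ * b).toWord ++ L' := hw
  refine ⟨w, a, w.exists_dev_iff.1 ⟨_, w.dev_origin a⟩, w.exists_dev_iff.1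
    ⟨(⟨(a⁻¹ * b).toWord.length % w.word.toWord.length, Nat.mod_lt _ w.length_pos⟩ :
      Fin w.word.toWord.length), ?_⟩⟩
  · refine (circleDev_iff a (by rw [hw']; simp) w.length_pos).2 ⟨0, ?_⟩
    rw [hw', List.take_left, mk_toWord]
    simp

variable (φ : FreeGroup X ≃* FreeGroup X)

theorem foldDev_dev (w : CyclicWord X) (a : FreeGroup X)
    {Z : (foldSubst φ.toMonoidHom w.graph).V} {g : FreeGroup X} :
    foldDev φ (w.dev a) Z g ↔ foldDev φ (w.dev 1) Z (φ a⁻¹ * g) := by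
  rw [← foldDev_translate]
  have : w.dev a = fun z g => w.dev 1 z (a⁻¹ * g) := by
    funext z g
    simp only [dev, circleDev, one_mul, inv_mul_eq_iff_eq_mul, mul_assoc]
  rw [this]

theorem exists_start (w : CyclicWord X) (Z : (foldSubst φ.toMonoidHom w.graph).V) :
    ∃ a, foldDev φ (w.dev a) Z 1 := by
  obtain ⟨g, hg⟩ := (develops_fold φ (w.develops_dev 1)).total Z
  refine ⟨(φ.symm g)⁻¹, ?_⟩
  rw [foldDev_dev]
  simpa using hg

theorem conj_ne_one (w : CyclicWord X) (a : FreeGroup X) : φ (a * w.word * a⁻¹) ≠ 1 := by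
  rw [ne_eq, map_eq_one_iff φ φ.injective, conj_eq_one_iff]
  exact w.word_ne_one

theorem zpow_mul_eq (w : CyclicWord X) (a : FreeGroup X) (n : ℤ) :
    φ (a * w.word * a⁻¹) ^ n * φ a = φ ((w.line a).pt (w.word.toWord.length * n)) := by
  have h1 : (w.line a).pt (w.word.toWord.length * n) = a * w.word ^ n := by
    have := circleLine_pt_mul w.cyclicallyReduced w.length_pos a n
    rwa [mk_toWord] at this
  rw [h1, ← map_zpow, ← _root_.map_mul, conj_zpow, inv_mul_cancel_right]

/-- The orbit of `a` meets the line once per period. For a set with finite boundary this sample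
determines on which side the line ends up. -/
theorem eventually_line_iff (w : CyclicWord X) (a : FreeGroup X) {C : Set (FreeGroup X)}
    (hC : (boundary C).Finite) :
    ((∀ᶠ n : ℤ in Filter.atBot, (w.line a).pt (w.word.toWord.length * n) ∈ C) ↔
      ∀ᶠ i in Filter.atBot, (w.line a).pt i ∈ C) ∧
    ((∀ᶠ n : ℤ in Filter.atTop, (w.line a).pt (w.word.toWord.length * n) ∈ C) ↔
      ∀ᶠ i in Filter.atTop, (w.line a).pt i ∈ C) := by
  have hpos : (1 : ℤ) ≤ w.word.toWord.length := by exact_mod_cast w.length_pos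
  have h1 : Filter.Tendsto (fun n : ℤ => w.word.toWord.length * n) Filter.atBot Filter.atBot := by
    refine Filter.tendsto_atBot.2 fun b => Filter.eventually_atBot.2 ⟨min b 0, fun n hn => ?_⟩
    have := le_min_iff.1 hn
    nlinarith
  have h2 : Filter.Tendsto (fun n : ℤ => w.word.toWord.length * n) Filter.atTop Filter.atTop := by
    refine Filter.tendsto_atTop.2 fun b => Filter.eventually_atTop.2 ⟨max b 0, fun n hn => ?_⟩
    have := max_le_iff.1 hn
    nlinarith
  refine ⟨⟨fun h => ?_, fun h => h1.eventually h⟩, ⟨fun h => ?_, fun h => h2.eventually h⟩⟩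
  · exact (w.line a).eventually_mem_of_frequently_atBot hC (h1.frequently h.frequently)
  · exact (w.line a).eventually_mem_of_frequently hC (h2.frequently h.frequently)

/-- The edges of `φ(w)` are those that separate the two ends of the orbit of `φ a`. Pulled back by
`φ`, separation of these ends by `u` is a condition on the line that covers `w`. -/
theorem exists_image_iff [Finite X] (u : UWord X) (w : CyclicWord X) {a : FreeGroup X}
    (k : Hom u.graph (foldSubst φ.toMonoidHom w.graph))
    (hk : foldDev φ (w.dev a) (k.onV u.first) 1) :
    (∃ f : Hom u.graph (w.image φ), (w.imageIncl φ).comp f = k) ↔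
      (w.line a).Runs (u.sourceSide φ) (u.targetSide φ) ∨
        (w.line a).Runs (u.targetSide φ) (u.sourceSide φ) := by
  have D := develops_fold φ (w.develops_dev a)
  have hP := (foldDev_vertex φ (w.develops_dev a)).2 (w.dev_origin a)
  refine (u.exists_span_iff D
    (l₁ := Filter.map (fun n : ℤ => φ (a * w.word * a⁻¹) ^ n * φ a) Filter.atBot)
    (l₂ := Filter.map (fun n : ℤ => φ (a * w.word * a⁻¹) ^ n * φ a) Filter.atTop)
    (A := w.imageEdges φ) (fun e g he => ?_) k hk).trans ?_
  · refine ((folded_fold _).mem_span_coreEdges_iff D (w.conj_ne_one φ a) hP he).trans ?_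
    refine or_congr Iff.rfl ?_
    simp only [Traverses, halfTree_barLetter, Set.mem_compl_iff, not_not]
    rfl
  · have hA := w.eventually_line_iff a (u.finite_boundary_sourceSide φ)
    have hB := w.eventually_line_iff a (u.finite_boundary_targetSide φ)
    simp only [Line.Runs, ← hA.1, ← hA.2, ← hB.1, ← hB.2, Filter.mem_map, zpow_mul_eq]
    rfl

end CyclicWord

/-! ### Directions along a line. -/

namespace FreeGroup

variable {X : Type*} [DecidableEq X]

theorem Between.mono_right {a g e t : FreeGroup X} (h : Between a g e) (h' : Between a e t) :
    Between a g t := by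
  by_cases hge : g = e
  · rwa [hge]
  · exact h.trans_of_ne hge (h.symm.trans_left h'.symm).symm

/-- A line has only two directions at `e`. One points to `o`, so the other is `y`, and `d` must lie
there. -/
theorem Line.mem_halfTree_of_between (ℓ : Line X) {d e o : FreeGroup X} {y : X × Bool}
    (hd : d ∈ Set.range ℓ.pt) (he : e ∈ Set.range ℓ.pt) (ho : o ∈ Set.range ℓ.pt)
    (hy : e * FreeGroup.mk [y] ∈ Set.range ℓ.pt) (hoy : o ∉ halfTree e y) (hde : d ≠ e) (hoe : o ≠ e)
    (h : Between d e o) : d ∈ halfTree e y := by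
  obtain ⟨x, hx⟩ := exists_mem_halfTree hde.symm
  obtain ⟨z, hz⟩ := exists_mem_halfTree hoe.symm
  have hxz : x ≠ z := by
    rintro rfl
    exact h x hx hz
  have hyz : y ≠ z := by
    rintro rfl
    exact hoy hz
  obtain ⟨n, rfl⟩ := he
  obtain ⟨i, hi⟩ := ℓ.mem_range_of_between ⟨n, rfl⟩ hd (between_mul_letter hx)
  obtain ⟨j, hj⟩ := hy
  obtain ⟨k, hk⟩ := ℓ.mem_range_of_between ⟨n, rfl⟩ ho (between_mul_letter hz)
  have hinj : ∀ {a b : ℤ} {s t : X × Bool}, ℓ.pt a = ℓ.pt n * FreeGroup.mk [s] →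
      ℓ.pt b = ℓ.pt n * FreeGroup.mk [t] → a = b → s = t := by
    rintro a b s t h1 h2 rfl
    rw [h1] at h2
    have h3 := mul_letter_mem_halfTree (ℓ.pt n) s
    rw [h2] at h3
    exact halfTree_letter_unique h3 (mul_letter_mem_halfTree _ _)
  have h1 := ℓ.adjacent hi
  have h2 := ℓ.adjacent hj
  have h3 := ℓ.adjacent hk
  have h4 : i ≠ k := fun h => hxz (hinj hi hk h)
  have h5 : j ≠ k := fun h => hyz (hinj hj hk h)
  have h6 : i = j := by omega
  rwa [hinj hj hi h6.symm]

end FreeGroup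

/-! ### Minimal ideal preimages: existence on lines, finiteness, fullness. -/

namespace MarkedUWord

open FreeGroup

variable {X : Type*} [DecidableEq X] {φ : FreeGroup X ≃* FreeGroup X} {u : UWord X}

theorem disjoint_sides (φ : FreeGroup X ≃* FreeGroup X) (u : UWord X) {g : FreeGroup X}
    (h : g ∈ u.sourceSide φ) : g ∉ u.targetSide φ :=
  Set.disjoint_left.1 (u.disjoint_source_target φ) h

/-- The line contains the end points of the base word. -/
def LiesOn (p : MarkedUWord φ u) (ℓ : Line X) : Prop :=
  p.src ∈ Set.range ℓ.pt ∧ p.tgt ∈ Set.range ℓ.pt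

theorem LiesOn.of_isSub {p q : MarkedUWord φ u} {ℓ : Line X} (hq : q.LiesOn ℓ) (h : p.IsSub q) :
    p.LiesOn ℓ :=
  ⟨ℓ.mem_range_of_between hq.1 hq.2 (isSub_iff.1 h).1,
    ℓ.mem_range_of_between hq.1 hq.2 (isSub_iff.1 h).2⟩

/-- The line joins the two sides of the u-word. -/
def Crosses (φ : FreeGroup X ≃* FreeGroup X) (u : UWord X) (ℓ : Line X) : Prop :=
  ℓ.Runs (u.sourceSide φ) (u.targetSide φ) ∨ ℓ.Runs (u.targetSide φ) (u.sourceSide φ)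

theorem IsIdealPreimage.crosses {p : MarkedUWord φ u} (h : p.IsIdealPreimage) {ℓ : Line X}
    (hp : p.LiesOn ℓ) : Crosses φ u ℓ :=
  (isIdealPreimage_iff.1 h).exists_runs p.src_ne_tgt ℓ hp.1 hp.2

/-- The smallest ideal pair on the line is minimal outright, because any sub ideal preimage lies on
the same line. -/
theorem exists_isMinimal_liesOn [Finite X] {ℓ : Line X} (h : Crosses φ u ℓ) :
    ∃ q : MarkedUWord φ u, q.IsMinimalIdealPreimage ∧ q.LiesOn ℓ ∧
      ∀ p : MarkedUWord φ u, p.IsIdealPreimage → p.LiesOn ℓ → q.IsSub p := by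
  have key : ∀ ℓ : Line X, ℓ.Runs (u.sourceSide φ) (u.targetSide φ) →
      ∃ q : MarkedUWord φ u, q.IsMinimalIdealPreimage ∧ q.LiesOn ℓ ∧
        ∀ p : MarkedUWord φ u, p.IsIdealPreimage → p.LiesOn ℓ → q.IsSub p := by
    intro ℓ hℓ
    obtain ⟨i₀, j₀, hij, hI⟩ := ℓ.exists_isIdealPair_iff (u.disjoint_source_target φ)
      (u.finite_boundary_sourceSide φ) (u.finite_boundary_targetSide φ) hℓ.1 hℓ.2
    have h₀ := (hI i₀ j₀).2 ⟨le_rfl, le_rfl⟩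
    obtain ⟨q, hs, ht⟩ := exists_of_mem h₀.left_mem h₀.right_mem
    have hle : ∀ p : MarkedUWord φ u, p.IsIdealPreimage → ∀ i j, p.src = ℓ.pt i →
        p.tgt = ℓ.pt j → i ≤ i₀ ∧ j₀ ≤ j := by
      intro p hp i j hi hj
      rw [isIdealPreimage_iff, hi, hj] at hp
      exact (hI i j).1 hp
    refine ⟨q, ⟨isIdealPreimage_iff.2 (by rwa [hs, ht]), fun r hr hrq => ?_⟩,
      ⟨⟨_, hs.symm⟩, ⟨_, ht.symm⟩⟩, ?_⟩
    · obtain ⟨⟨i, hi⟩, ⟨j, hj⟩⟩ :=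
        LiesOn.of_isSub (q := q) (ℓ := ℓ) ⟨⟨_, hs.symm⟩, ⟨_, ht.symm⟩⟩ hrq
      rw [isSub_iff, hs, ht, ← hi, ← hj, ℓ.between_iff hij.le, ℓ.between_iff hij.le] at hrq
      obtain ⟨h1, h2⟩ := hle r hr i j hi.symm hj.symm
      exact ext_of_src_tgt (by rw [← hi, hs, le_antisymm h1 hrq.1.1])
        (by rw [← hj, ht, le_antisymm h2 hrq.2.2])
    · rintro p hp ⟨⟨i, hi⟩, ⟨j, hj⟩⟩
      obtain ⟨h1, h2⟩ := hle p hp i j hi.symm hj.symm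
      rw [isSub_iff, hs, ht, ← hi, ← hj, ℓ.between_iff (by omega), ℓ.between_iff (by omega)]
      omega
  rcases h with h | h
  · exact key ℓ h
  · obtain ⟨q, h1, h2, h3⟩ := key ℓ.reverse (ℓ.runs_reverse.2 h)
    simp only [LiesOn, ℓ.mem_range_reverse] at h2 h3
    exact ⟨q, h1, h2, h3⟩

/-! ### Finiteness -/

theorem isSub_of_between_src {p q : MarkedUWord φ u} (h : Between q.src p.src q.tgt)
    (ht : p.tgt = q.tgt) : p.IsSub q :=
  isSub_iff.2 ⟨h, ht ▸ between_right _ _⟩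

theorem isSub_of_between_tgt {p q : MarkedUWord φ u} (h : Between q.src p.tgt q.tgt)
    (hs : p.src = q.src) : p.IsSub q :=
  isSub_iff.2 ⟨hs ▸ between_left _ _, h⟩

/-- Moving the source one step towards the target keeps the condition beyond the target. So
minimality must be due to a point behind the new source that is not in the source side, which is the
obstruction required by `norm_le_of_left_minimal`. -/
theorem IsMinimalIdealPreimage.exists_src {p : MarkedUWord φ u} (hp : p.IsMinimalIdealPreimage)
    {x : X × Bool} (hx : p.tgt ∈ halfTree p.src x) :
    ∃ c, Between c (p.src * FreeGroup.mk [x]) p.tgt ∧ c ∉ u.sourceSide φ := by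
  by_contra! hn
  have hI := isIdealPreimage_iff.1 hp.1
  have hb := between_mul_letter hx
  have hm := hn _ (between_left _ _)
  have hne : p.src * FreeGroup.mk [x] ≠ p.tgt := fun h =>
    disjoint_sides φ u hm (by rw [h]; exact p.tgt_mem)
  obtain ⟨q, hs, ht⟩ := exists_of_mem hm p.tgt_mem
  have hq : q.IsIdealPreimage := by
    rw [isIdealPreimage_iff, hs, ht]
    exact ⟨hn, fun d hd => hI.right d (hd.symm.trans_of_ne hne.symm hb.symm).symm⟩
  have := hp.2 q hq (isSub_of_between_src (by rwa [hs]) ht)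
  rw [this] at hs
  exact mul_letter_ne _ _ hs.symm

theorem IsMinimalIdealPreimage.exists_tgt {p : MarkedUWord φ u} (hp : p.IsMinimalIdealPreimage)
    {x : X × Bool} (hx : p.src ∈ halfTree p.tgt x) :
    ∃ c, Between c (p.tgt * FreeGroup.mk [x]) p.src ∧ c ∉ u.targetSide φ := by
  by_contra! hn
  have hI := isIdealPreimage_iff.1 hp.1
  have hb := between_mul_letter hx
  have hm := hn _ (between_left _ _)
  have hne : p.tgt * FreeGroup.mk [x] ≠ p.src := fun h =>
    disjoint_sides φ u p.src_mem (by rwa [← h])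
  obtain ⟨q, hs, ht⟩ := exists_of_mem p.src_mem hm
  have hq : q.IsIdealPreimage := by
    rw [isIdealPreimage_iff, hs, ht]
    exact ⟨fun c hc => hI.left c (hc.trans_of_ne hne.symm hb.symm), fun d hd => hn d hd.symm⟩
  have := hp.2 q hq (isSub_of_between_tgt (by rw [ht]; exact hb.symm) hs)
  rw [this] at ht
  exact mul_letter_ne _ _ ht.symm

theorem finite_setOf_isMinimal [Finite X] (φ : FreeGroup X ≃* FreeGroup X) (u : UWord X) :
    {p : MarkedUWord φ u | p.IsMinimalIdealPreimage}.Finite := by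
  have hbound : ∀ C : Set (FreeGroup X), (boundary C).Finite →
      ∃ N : ℕ, ∀ k ∈ boundary C, k.norm ≤ N := by
    intro C hC
    obtain ⟨N, hN⟩ := (hC.image FreeGroup.norm).bddAbove
    exact ⟨N, fun k hk => hN ⟨k, hk, rfl⟩⟩
  obtain ⟨N₁, hN₁⟩ := hbound _ (u.finite_boundary_sourceSide φ)
  obtain ⟨N₂, hN₂⟩ := hbound _ (u.finite_boundary_targetSide φ)
  refine Set.Finite.of_finite_image (f := fun p => (p.src, p.tgt))
    (((finite_setOf_norm_le (3 * N₁ + 1)).prod (finite_setOf_norm_le (3 * N₂ + 1))).subset ?_) ?_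
  · rintro _ ⟨p, hp, rfl⟩
    obtain ⟨x, hx⟩ := exists_mem_halfTree p.src_ne_tgt
    obtain ⟨y, hy⟩ := exists_mem_halfTree p.src_ne_tgt.symm
    exact ⟨norm_le_of_left_minimal hN₁ p.src_mem (fun h => disjoint_sides φ u h p.tgt_mem) hx
        fun _ => hp.exists_src hx,
      norm_le_of_left_minimal hN₂ p.tgt_mem (disjoint_sides φ u p.src_mem) hy
        fun _ => hp.exists_tgt hy⟩
  · intro p _ q _ h
    exact ext_of_src_tgt (congrArg Prod.fst h) (congrArg Prod.snd h)

/-! ### Full sets -/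

/-- Translates fullness into geometry: a morphism `f` is a placed periodic line, and the marked
u-words from which `f` comes are the segments on it. -/
theorem exists_line_of_hom [Finite X] (w : CyclicWord X) (f : Hom u.graph (w.image φ)) :
    ∃ a, Crosses φ u (w.line a) ∧ ∀ p : MarkedUWord φ u,
      (∃ h : Hom p.base.graph w.graph,
        (foldSubstMap φ.toMonoidHom h).comp p.toFold = (w.imageIncl φ).comp f) ↔
      p.LiesOn (w.line a) := by
  obtain ⟨a, ha⟩ := w.exists_start φ (((w.imageIncl φ).comp f).onV u.first)
  refine ⟨a, (w.exists_image_iff φ u _ ha).1 ⟨f, rfl⟩, fun p => ?_⟩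
  rw [p.exists_comp_eq_iff w.folded_graph (w.develops_dev a) ha, w.exists_dev_iff,
    w.exists_dev_iff]
  rfl

theorem exists_hom_of_liesOn [Finite X] {p : MarkedUWord φ u} (hp : p.IsIdealPreimage)
    {w : CyclicWord X} {a : FreeGroup X} {h : Hom p.base.graph w.graph}
    (hs : w.dev a (h.onV p.base.first) p.start) :
    ∃ f : Hom u.graph (w.image φ),
      (w.imageIncl φ).comp f = (foldSubstMap φ.toMonoidHom h).comp p.toFold := by
  have D := w.develops_dev a
  have hk := p.foldDev_comp D h hs
  refine (w.exists_image_iff φ u _ hk).2 (hp.crosses ?_)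
  have := (p.exists_comp_eq_iff w.folded_graph D hk).1 ⟨h, rfl⟩
  rwa [w.exists_dev_iff, w.exists_dev_iff] at this

/-- Idealness is tested on u-words only. It carries over to cyclic words because a line through an
ideal pair has its ends on the two sides of `u`. -/
theorem IsIdealPreimage.exists_hom [Finite X] {p : MarkedUWord φ u} (hp : p.IsIdealPreimage)
    (w : CyclicWord X) (h : Hom p.base.graph w.graph) :
    ∃ f : Hom u.graph (w.image φ),
      (foldSubstMap φ.toMonoidHom h).comp p.toFold = (w.imageIncl φ).comp f := by
  obtain ⟨f, hf⟩ := exists_hom_of_liesOn hp (w := w) (h := h)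
    (a := p.start * (FreeGroup.mk (w.word.toWord.take
      (Fin.val (n := w.word.toWord.length) (h.onV p.base.first))))⁻¹) ⟨0, by
        rw [zpow_zero, mul_one, inv_mul_cancel_right]⟩
  exact ⟨f, hf.symm⟩

theorem IsFull.existsUnique [Finite X] {S : Set (MarkedUWord φ u)} (hS : IsFull S)
    {p : MarkedUWord φ u} (hp : p.IsIdealPreimage) {w : CyclicWord X} {a : FreeGroup X}
    (hpa : p.LiesOn (w.line a)) : ∃! s, s ∈ S ∧ s.LiesOn (w.line a) := by
  have D := w.develops_dev a
  have hl : ∀ q : MarkedUWord φ u,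
      q.LiesOn (w.line a) ↔ (∃ z, w.dev a z q.src) ∧ ∃ z, w.dev a z q.tgt := by
    intro q
    rw [w.exists_dev_iff, w.exists_dev_iff]
    rfl
  obtain ⟨h1, h2⟩ := (p.forall_src_tgt_iff fun g => ∃ z, w.dev a z g).2 ((hl p).1 hpa)
  obtain ⟨h, hh⟩ := p.base.exists_hom_of_develops w.folded_graph D h1 h2
  obtain ⟨f, hf⟩ := exists_hom_of_liesOn hp hh
  have := hS.2 w f
  rw [hf] at this
  simp only [hl]
  convert this using 4 with q
  exact (q.exists_comp_eq_iff w.folded_graph D (p.foldDev_comp D h hh)).symm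

/-- On each line the smallest ideal pair is a sub ideal preimage of every other, so it is the only
minimal one there. -/
theorem isFull_setOf_isMinimal [Finite X] (φ : FreeGroup X ≃* FreeGroup X) (u : UWord X) :
    IsFull {p : MarkedUWord φ u | p.IsMinimalIdealPreimage} := by
  refine ⟨fun p hp => hp.1, fun w f => ?_⟩
  obtain ⟨a, hc, hl⟩ := exists_line_of_hom w f
  simp only [hl]
  obtain ⟨q, hq, hqa, hmin⟩ := exists_isMinimal_liesOn hc
  exact ⟨q, ⟨hq, hqa⟩, fun p hp => (hp.1.2 q hq.1 (hmin p hp.1.1 hp.2)).symm⟩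

end MarkedUWord

/-! ### Full paradigms as one-letter extensions of a segment, and uniqueness. -/

namespace FreeGroup

variable {X : Type*} [DecidableEq X]

/-- Two segments that share an end point and a subsegment, and whose lengths match, extend the
subsegment at the same end. -/
theorem eq_or_eq_of_extension {o e s t : FreeGroup X} {y : X × Bool} (hoe : o ≠ e)
    (hy : o ∉ halfTree e y) (ho : o = s ∨ o = t) (he : Between s e t)
    (hw : s⁻¹ * t = o⁻¹ * (e * mk [y]) ∨ s⁻¹ * t = (o⁻¹ * (e * mk [y]))⁻¹) :
    (s = o ∧ t = e * mk [y]) ∨ (s = e * mk [y] ∧ t = o) := by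
  have hm : o⁻¹ * e ≠ 1 := fun h => hoe (inv_mul_eq_one.1 h)
  have hno := not_between_mul_inv hm (isReduced_append_singleton_iff.2 hy) o
  rw [mul_inv_cancel_left, mul_assoc] at hno
  rcases ho with rfl | rfl <;> rcases hw with hw | hw
  · exact Or.inl ⟨rfl, mul_left_cancel hw⟩
  · rw [inv_mul_eq_iff_eq_mul] at hw
    rw [hw] at he
    exact (hno he).elim
  · rw [inv_mul_eq_iff_eq_mul, ← mul_inv_eq_iff_eq_mul] at hw
    rw [← hw] at he
    exact (hno he.symm).elim
  · rw [← inv_inj, inv_inv, mul_inv_rev, inv_inv] at hw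
    exact Or.inr ⟨mul_left_cancel hw, rfl⟩

end FreeGroup

namespace MarkedUWord

open FreeGroup

variable {X : Type*} [DecidableEq X] {φ : FreeGroup X ≃* FreeGroup X} {u : UWord X}

/-- The base word joins the points `o` and `e`, in one of the two orientations. -/
def HasEnds (p : MarkedUWord φ u) (o e : FreeGroup X) : Prop :=
  (p.src = o ∧ p.tgt = e) ∨ (p.src = e ∧ p.tgt = o)

theorem hasEnds_iff {p : MarkedUWord φ u} {o e : FreeGroup X} : p.HasEnds o e ↔
    (p.start = o ∧ p.finish = e) ∨ (p.start = e ∧ p.finish = o) := by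
  rcases p.src_tgt_cases with ⟨h1, h2⟩ | ⟨h1, h2⟩
  · rw [HasEnds, h1, h2]
  · rw [HasEnds, h1, h2]
    tauto

theorem HasEnds.ne {p : MarkedUWord φ u} {o e : FreeGroup X} (h : p.HasEnds o e) : o ≠ e := by
  rcases h with ⟨rfl, rfl⟩ | ⟨rfl, rfl⟩
  · exact p.src_ne_tgt
  · exact p.src_ne_tgt.symm

theorem HasEnds.between_iff {p : MarkedUWord φ u} {o e : FreeGroup X} (h : p.HasEnds o e)
    {g : FreeGroup X} : Between p.src g p.tgt ↔ Between o g e := by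
  rcases h with ⟨rfl, rfl⟩ | ⟨rfl, rfl⟩
  · rfl
  · exact ⟨Between.symm, Between.symm⟩

theorem HasEnds.forall_iff {p : MarkedUWord φ u} {o e : FreeGroup X} (h : p.HasEnds o e)
    {Y : FreeGroup X → Prop} : (Y p.src ∧ Y p.tgt) ↔ Y o ∧ Y e := by
  rcases h with ⟨rfl, rfl⟩ | ⟨rfl, rfl⟩
  · rfl
  · exact and_comm

theorem HasEnds.isSub_iff {p q : MarkedUWord φ u} {o e s t : FreeGroup X} (hp : p.HasEnds o e)
    (hq : q.HasEnds s t) : p.IsSub q ↔ Between s o t ∧ Between s e t := by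
  rw [MarkedUWord.isSub_iff, hq.between_iff, hq.between_iff]
  exact hp.forall_iff (Y := fun g => Between s g t)

theorem hasEnds_start_finish (p : MarkedUWord φ u) : p.HasEnds p.start p.finish :=
  hasEnds_iff.2 (Or.inl ⟨rfl, rfl⟩)

theorem hasEnds_finish_start (p : MarkedUWord φ u) : p.HasEnds p.finish p.start :=
  hasEnds_iff.2 (Or.inr ⟨rfl, rfl⟩)

theorem HasEnds.word_eq {p : MarkedUWord φ u} {o e : FreeGroup X} (h : p.HasEnds o e) :
    p.base.word = o⁻¹ * e ∨ p.base.word = (o⁻¹ * e)⁻¹ := by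
  have hw : p.base.word = p.start⁻¹ * p.finish := by rw [finish, inv_mul_cancel_left]
  rw [hw]
  rcases hasEnds_iff.1 h with ⟨rfl, rfl⟩ | ⟨rfl, rfl⟩
  · exact Or.inl rfl
  · exact Or.inr (by group)

theorem isEnd_iff (q : MarkedUWord φ u) {z : q.base.graph.V} {g : FreeGroup X}
    (h : q.base.dev q.start z g) : q.base.IsEnd z ↔ g = q.start ∨ g = q.finish := by
  have D := q.base.develops_dev q.start
  constructor
  · rintro (rfl | rfl)
    · exact Or.inl ((q.base.lineDev_first _ _).1 h)
    · exact Or.inr ((q.base.lineDev_last _ _).1 h)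
  · rintro (rfl | rfl)
    · exact Or.inl (D.inj q.base.folded_graph h ((q.base.lineDev_first _ _).2 rfl))
    · exact Or.inr (D.inj q.base.folded_graph h ((q.base.lineDev_last _ _).2 rfl))

theorem compatible_iff {p q : MarkedUWord φ u} {h : Hom p.base.graph q.base.graph} :
    Compatible p q h ↔ q.base.dev q.start (h.onV p.base.first) p.start :=
  p.comp_eq_iff (q.base.develops_dev q.start) q.start_spec h

theorem Compatible.dev_last {p q : MarkedUWord φ u} {h : Hom p.base.graph q.base.graph}
    (hc : Compatible p q h) : q.base.dev q.start (h.onV p.base.last) p.finish :=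
  p.base.develops_map (q.base.develops_dev q.start) h (compatible_iff.1 hc) _ _
    ((p.base.lineDev_last _ _).2 rfl)

/-- Extending the segment of `p` by a letter at its end `e`. -/
theorem hasEnds_mul_letter_iff {p q : MarkedUWord φ u} {o e : FreeGroup X} (hp : p.HasEnds o e)
    {y : X × Bool} (hy : o ∉ halfTree e y) : q.HasEnds o (e * FreeGroup.mk [y]) ↔
      p.IsSub q ∧ (o = q.start ∨ o = q.finish) ∧
        q.base.IsOrientation (o⁻¹ * (e * FreeGroup.mk [y])) := by
  constructor
  · intro hq
    refine ⟨(hp.isSub_iff hq).2 ⟨between_left _ _, between_of_notMem hy⟩, ?_, hq.word_eq⟩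
    rcases hasEnds_iff.1 hq with ⟨h, -⟩ | ⟨-, h⟩
    · exact Or.inl h.symm
    · exact Or.inr h.symm
  · rintro ⟨hpq, ho, hw⟩
    have hw' : q.base.word = q.start⁻¹ * q.finish := by rw [finish, inv_mul_cancel_left]
    rw [UWord.IsOrientation, hw'] at hw
    exact hasEnds_iff.2 (eq_or_eq_of_extension hp.ne hy ho
      ((hp.isSub_iff q.hasEnds_start_finish).1 hpq).2 hw)

theorem isReduced_word_append_iff (p : MarkedUWord φ u) {x : X × Bool} :
    IsReduced (p.base.word.toWord ++ [x]) ↔ p.start ∉ halfTree p.finish x := by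
  rw [← isReduced_append_singleton_iff, finish, inv_mul_cancel_left]

theorem isReduced_append_word_iff (p : MarkedUWord φ u) {x : X × Bool} :
    IsReduced ([x] ++ p.base.word.toWord) ↔ p.finish ∉ halfTree p.start (barLetter x) := by
  rw [← isReduced_append_singleton_iff, ← isReduced_invRev, invRev_append, ← toWord_inv]
  have h1 : invRev [x] = [barLetter x] := by simp [invRev, barLetter]
  rw [h1, finish, mul_inv_rev, inv_mul_cancel_right]

/-- In the tree a full paradigm consists of all extensions of a segment by one edge at one end `e`.
This form treats prefixes, suffixes and both orientations of the base word together. -/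
theorem IsFullParadigm.exists_hasEnds {p : MarkedUWord φ u} {P : Set (MarkedUWord φ u)}
    (h : IsFullParadigm p P) : ∃ o e, p.HasEnds o e ∧
      ∀ y, o ∉ halfTree e y → ∃ q ∈ P, q.HasEnds o (e * FreeGroup.mk [y]) := by
  rcases h with ⟨q, rfl, hq⟩ | ⟨q, rfl, hq⟩
  · refine ⟨p.start, p.finish, p.hasEnds_start_finish, fun y hy => ?_⟩
    obtain ⟨ho, h, he, hc⟩ := hq ⟨y, p.isReduced_word_append_iff.2 hy⟩
    have hw : p.base.word * FreeGroup.mk [y] = p.start⁻¹ * (p.finish * FreeGroup.mk [y]) := by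
      rw [finish, mul_assoc, inv_mul_cancel_left]
    rw [hw] at ho
    exact ⟨_, ⟨_, rfl⟩, (hasEnds_mul_letter_iff p.hasEnds_start_finish hy).2
      ⟨⟨h, hc⟩, (isEnd_iff _ (compatible_iff.1 hc)).1 he, ho⟩⟩
  · refine ⟨p.finish, p.start, p.hasEnds_finish_start, fun y hy => ?_⟩
    obtain ⟨ho, h, he, hc⟩ := hq ⟨barLetter y, p.isReduced_append_word_iff.2
      (by rwa [barLetter_barLetter])⟩
    have hw : FreeGroup.mk [barLetter y] * p.base.word =
        (p.finish⁻¹ * (p.start * FreeGroup.mk [y]))⁻¹ := by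
      rw [finish, ← inv_mk_singleton]
      group
    rw [hw, UWord.IsOrientation, inv_inv, or_comm] at ho
    exact ⟨_, ⟨_, rfl⟩, (hasEnds_mul_letter_iff p.hasEnds_finish_start hy).2
      ⟨⟨h, hc⟩, (isEnd_iff _ hc.dev_last).1 he, ho⟩⟩

theorem exists_isFullParadigm {p : MarkedUWord φ u} {S : Set (MarkedUWord φ u)}
    {o e : FreeGroup X} (hp : p.HasEnds o e)
    (h : ∀ y, o ∉ halfTree e y → ∃ q ∈ S, q.HasEnds o (e * FreeGroup.mk [y])) :
    ∃ P, IsFullParadigm p P ∧ P ⊆ S := by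
  have : Nonempty (MarkedUWord φ u) := ⟨p⟩
  choose! q hqS hq using h
  rcases hasEnds_iff.1 hp with ⟨rfl, rfl⟩ | ⟨rfl, rfl⟩
  · refine ⟨_, Or.inl ⟨fun x => q x.1, rfl, fun x => ?_⟩, ?_⟩
    · have hx := p.isReduced_word_append_iff.1 x.2
      obtain ⟨⟨h, hc⟩, he, ho⟩ := (hasEnds_mul_letter_iff hp hx).1 (hq _ hx)
      rw [finish, mul_assoc, inv_mul_cancel_left] at ho
      exact ⟨ho, h, (isEnd_iff _ (compatible_iff.1 hc)).2 he, hc⟩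
    · rintro _ ⟨x, rfl⟩
      exact hqS _ (p.isReduced_word_append_iff.1 x.2)
  · refine ⟨_, Or.inr ⟨fun x => q (barLetter x.1), rfl, fun x => ?_⟩, ?_⟩
    · have hx := p.isReduced_append_word_iff.1 x.2
      obtain ⟨⟨h, hc⟩, he, ho⟩ := (hasEnds_mul_letter_iff hp hx).1 (hq _ hx)
      have hw : (p.finish⁻¹ * (p.start * FreeGroup.mk [barLetter x.1])) =
          (FreeGroup.mk [x.1] * p.base.word)⁻¹ := by
        rw [finish, ← inv_mk_singleton]
        group
      rw [hw, UWord.IsOrientation, inv_inv, or_comm] at ho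
      exact ⟨ho, h, (isEnd_iff _ hc.dev_last).2 he, hc⟩
    · rintro _ ⟨x, rfl⟩
      exact hqS _ (p.isReduced_append_word_iff.1 x.2)

theorem HasEnds.isIdealPair {p : MarkedUWord φ u} {o e : FreeGroup X} (h : p.HasEnds o e)
    (hp : p.IsIdealPreimage) :
    (o ∈ u.sourceSide φ → IsIdealPair (u.sourceSide φ) (u.targetSide φ) o e) ∧
      (o ∈ u.targetSide φ → IsIdealPair (u.targetSide φ) (u.sourceSide φ) o e) := by
  rw [isIdealPreimage_iff] at hp
  rcases h with ⟨rfl, rfl⟩ | ⟨rfl, rfl⟩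
  · exact ⟨fun _ => hp, fun h => (disjoint_sides φ u p.src_mem h).elim⟩
  · exact ⟨fun h => (disjoint_sides φ u h p.tgt_mem).elim, fun _ => hp.symm⟩

/-- If all extensions of `p` at one end are ideal, then `p` is ideal. As a proper sub ideal preimage
of each extension it contradicts their minimality. -/
theorem isMinimalFull_setOf_isMinimal [Finite X] (φ : FreeGroup X ≃* FreeGroup X) (u : UWord X) :
    IsMinimalFull {p : MarkedUWord φ u | p.IsMinimalIdealPreimage} := by
  refine ⟨isFull_setOf_isMinimal φ u, ?_⟩
  rintro ⟨p, P, hP, hPM⟩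
  obtain ⟨o, e, hp, hall⟩ := hP.exists_hasEnds
  have hI : p.IsIdealPreimage := by
    rw [isIdealPreimage_iff]
    have hpair : ∀ y, o ∉ halfTree e y →
        (o ∈ u.sourceSide φ → IsIdealPair (u.sourceSide φ) (u.targetSide φ) o
          (e * FreeGroup.mk [y])) ∧
        (o ∈ u.targetSide φ → IsIdealPair (u.targetSide φ) (u.sourceSide φ) o
          (e * FreeGroup.mk [y])) := by
      intro y hy
      obtain ⟨q, hqP, hq⟩ := hall y hy
      exact hq.isIdealPair (hPM hqP).1
    rcases id hp with ⟨rfl, rfl⟩ | ⟨rfl, rfl⟩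
    · exact isIdealPair_of_mul_letter p.src_ne_tgt p.tgt_mem fun y hy => (hpair y hy).1 p.src_mem
    · exact (isIdealPair_of_mul_letter p.src_ne_tgt.symm p.src_mem
        fun y hy => (hpair y hy).2 p.tgt_mem).symm
  obtain ⟨y, hy⟩ := exists_notMem_halfTree hp.ne
  obtain ⟨q, hqP, hq⟩ := hall y hy
  have hpq := ((hasEnds_mul_letter_iff hp hy).1 hq).1
  rw [← (hPM hqP).2 p hI hpq] at hq
  have h1 : e = o ∨ e = e * FreeGroup.mk [y] := by
    rcases hp with ⟨h1, h2⟩ | ⟨h1, h2⟩ <;> rcases hq with ⟨h3, h4⟩ | ⟨h3, h4⟩ <;> simp_all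
  exact h1.elim hp.ne.symm (mul_letter_ne e y).symm

/-! ### Uniqueness -/

/-- The length of the base word. -/
noncomputable def length (p : MarkedUWord φ u) : ℕ := p.base.word.norm

theorem HasEnds.length_eq {p : MarkedUWord φ u} {o e : FreeGroup X} (h : p.HasEnds o e) :
    p.length = (o⁻¹ * e).norm := by
  rw [length]
  rcases h.word_eq with h | h
  · rw [h]
  · rw [h, norm_inv_eq]

theorem HasEnds.exists_ends_of_isSub {p q : MarkedUWord φ u} {o e : FreeGroup X}
    (hp : p.HasEnds o e) (h : p.IsSub q) :
    ∃ d t, q.HasEnds d t ∧ Between d e o ∧ Between e o t := by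
  have := (hp.isSub_iff q.hasEnds_start_finish).1 h
  rcases between_two_points hp.ne.symm this.2 this.1 with ⟨h1, h2⟩ | ⟨h1, h2⟩
  · exact ⟨_, _, q.hasEnds_start_finish, h1, h2⟩
  · exact ⟨_, _, q.hasEnds_finish_start, h2.symm, h1.symm⟩

theorem IsSub.length_le {p q : MarkedUWord φ u} (h : p.IsSub q) : p.length ≤ q.length := by
  obtain ⟨d, t, hq, h1, h2⟩ := p.hasEnds_start_finish.exists_ends_of_isSub h
  have h3 := ((p.hasEnds_start_finish.isSub_iff hq).1 h).2
  have h4 := h3.norm_eq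
  have h5 := h2.norm_eq
  rw [p.hasEnds_finish_start.length_eq, hq.length_eq]
  omega

/-- Each line through `p` contains a member of `S` on which `p` lies. -/
def Covers (S : Set (MarkedUWord φ u)) (p : MarkedUWord φ u) : Prop :=
  ∀ (w : CyclicWord X) (a : FreeGroup X), p.LiesOn (w.line a) →
    ∃ s ∈ S, s.LiesOn (w.line a) ∧ p.IsSub s

/-- On a line through a minimal `p` the smallest ideal pair is `p` itself, so the member of `S` on
that line contains `p`. -/
theorem IsMinimalIdealPreimage.covers [Finite X] {S : Set (MarkedUWord φ u)} (hS : IsFull S)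
    {p : MarkedUWord φ u} (hp : p.IsMinimalIdealPreimage) : Covers S p := by
  intro w a hpa
  obtain ⟨s, ⟨hs, hsa⟩, -⟩ := hS.existsUnique hp.1 hpa
  obtain ⟨q, hq, -, hmin⟩ := exists_isMinimal_liesOn (hp.1.crosses hpa)
  refine ⟨s, hs, hsa, ?_⟩
  rw [← hp.2 q hq.1 (hmin p hp.1 hpa)]
  exact hmin s (hS.1 s hs) hsa

/-- If `p` is not in `S`, then one of its ends is not an end of any larger member of `S`. -/
theorem exists_free_end [Finite X] {S : Set (MarkedUWord φ u)} (hS : IsFull S)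
    {p : MarkedUWord φ u} (hp : p.IsIdealPreimage) (hpS : p ∉ S) :
    ∃ o e, p.HasEnds o e ∧ ∀ s ∈ S, p.IsSub s → ∀ d t, s.HasEnds d t → d ≠ e := by
  by_contra! hn
  obtain ⟨s', hs', hps', d', t', hd', rfl⟩ := hn _ _ (Or.inr ⟨rfl, rfl⟩)
  obtain ⟨s, hs, hps, d, t, hd, rfl⟩ := hn _ _ (Or.inl ⟨rfl, rfl⟩)
  have h1 : s'.src = p.src := by
    rcases hd' with ⟨h, -⟩ | ⟨-, h⟩
    · exact h
    · exact (disjoint_sides φ u p.src_mem (h ▸ s'.tgt_mem)).elim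
  have h2 : s.tgt = p.tgt := by
    rcases hd with ⟨h, -⟩ | ⟨-, h⟩
    · exact (disjoint_sides φ u s.src_mem (h ▸ p.tgt_mem)).elim
    · exact h
  rw [isSub_iff] at hps hps'
  have h3 := hps.1
  have h4 := hps'.2
  rw [h2] at h3
  rw [h1] at h4
  have h5 : s.src ≠ s'.tgt := fun h => disjoint_sides φ u s.src_mem (h ▸ s'.tgt_mem)
  -- Here `s` stops at `p.tgt` and `s'` starts at `p.src`. They overlap in `p`, so a line through
  -- their outer ends contains both. Fullness then gives `s = s'`, and this common member is `p`.
  obtain ⟨w, a, hsw, hsw'⟩ := CyclicWord.exists_line_of_ne h5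
  have h6 := (w.line a).mem_range_of_between hsw hsw' (h3.trans_of_ne p.src_ne_tgt h4)
  have h7 := (w.line a).mem_range_of_between hsw hsw'
    (h4.symm.trans_of_ne p.src_ne_tgt.symm h3.symm).symm
  obtain ⟨r, -, hr⟩ := hS.existsUnique hp (w := w) (a := a) ⟨h6, h7⟩
  have h8 : s = s' := (hr s ⟨hs, hsw, h2 ▸ h7⟩).trans (hr s' ⟨hs', h1 ▸ h6, hsw'⟩).symm
  refine hpS ?_
  rw [← ext_of_src_tgt (p := s) (q := p) (h8 ▸ h1) h2]
  exact hs

theorem exists_extension {p : MarkedUWord φ u} (hp : p.IsIdealPreimage) {o e : FreeGroup X}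
    (h : p.HasEnds o e) {y : X × Bool} (hy : o ∉ halfTree e y) :
    ∃ q : MarkedUWord φ u, q.IsIdealPreimage ∧ q.HasEnds o (e * FreeGroup.mk [y]) := by
  rw [isIdealPreimage_iff] at hp
  rcases h with ⟨rfl, rfl⟩ | ⟨rfl, rfl⟩
  · have hI := hp.mul_letter hy
    obtain ⟨q, hs, ht⟩ := exists_of_mem hI.left_mem hI.right_mem
    exact ⟨q, isIdealPreimage_iff.2 (by rwa [hs, ht]), Or.inl ⟨hs, ht⟩⟩
  · have hI := hp.symm.mul_letter hy
    obtain ⟨q, hs, ht⟩ := exists_of_mem hI.right_mem hI.left_mem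
    exact ⟨q, isIdealPreimage_iff.2 (by rw [hs, ht]; exact hI.symm), Or.inr ⟨hs, ht⟩⟩

theorem HasEnds.liesOn_iff {p : MarkedUWord φ u} {o e : FreeGroup X} (h : p.HasEnds o e)
    {ℓ : Line X} : p.LiesOn ℓ ↔ o ∈ Set.range ℓ.pt ∧ e ∈ Set.range ℓ.pt :=
  h.forall_iff (Y := fun g => g ∈ Set.range ℓ.pt)

/-- A line through `q` passes through `p`. The member of `S` on it that contains `p` does not stop
at `e`, so it continues along the line past the new letter and contains `q`. -/
theorem Covers.extension {S : Set (MarkedUWord φ u)} {p q : MarkedUWord φ u} (hp : Covers S p)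
    {o e : FreeGroup X} (h : p.HasEnds o e) {y : X × Bool} (hy : o ∉ halfTree e y)
    (hq : q.HasEnds o (e * FreeGroup.mk [y]))
    (hfree : ∀ s ∈ S, p.IsSub s → ∀ d t, s.HasEnds d t → d ≠ e) : Covers S q := by
  intro w a hqa
  have hpq := ((hasEnds_mul_letter_iff h hy).1 hq).1
  have hpa := hqa.of_isSub hpq
  obtain ⟨s, hs, hsa, hps⟩ := hp w a hpa
  refine ⟨s, hs, hsa, ?_⟩
  obtain ⟨d, t, hdt, h1, h2⟩ := h.exists_ends_of_isSub hps
  have hde := hfree s hs hps d t hdt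
  have hoe := h.liesOn_iff.1 hpa
  have hsub := (h.isSub_iff hdt).1 hps
  have hd := (w.line a).mem_halfTree_of_between (hdt.liesOn_iff.1 hsa).1 hoe.2 hoe.1
    (hq.liesOn_iff.1 hqa).2 hy hde h.ne h1
  exact (hq.isSub_iff hdt).2 ⟨hsub.1, (between_mul_letter hd).symm.mono_right hsub.2⟩

/-- Descending induction on length. A covered `p` is no longer than the longest member of `S`, and
if `p ∉ S` then its extensions at a free end are covered, hence in `S`, where they form a full
paradigm. -/
theorem Covers.mem [Finite X] {S : Set (MarkedUWord φ u)} (hfin : S.Finite)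
    (hS : IsMinimalFull S) {p : MarkedUWord φ u} (hp : p.IsIdealPreimage) (hc : Covers S p) :
    p ∈ S := by
  obtain ⟨N, hN⟩ := (hfin.image length).bddAbove
  induction hn : N + 1 - p.length generalizing p with
  | zero =>
    obtain ⟨w, a, h1, h2⟩ := CyclicWord.exists_line_of_ne p.src_ne_tgt
    obtain ⟨s, hs, -, hps⟩ := hc w a ⟨h1, h2⟩
    have := hN ⟨s, hs, rfl⟩
    have := hps.length_le
    omega
  | succ n ih =>
    by_contra hpS
    obtain ⟨o, e, he, hfree⟩ := exists_free_end hS.1 hp hpS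
    obtain ⟨P, hP, hPS⟩ := exists_isFullParadigm (S := S) he fun y hy => by
      obtain ⟨q, hq, hqe⟩ := exists_extension hp he hy
      refine ⟨q, ih hq (hc.extension he hy hqe hfree) ?_, hqe⟩
      have h1 := (between_of_notMem hy).norm_eq
      rw [← he.length_eq, ← hqe.length_eq, inv_mul_cancel_left] at h1
      have h2 : (FreeGroup.mk [y]).norm = 1 := by
        rw [FreeGroup.norm, IsReduced.singleton.toWord_mk_eq, List.length_singleton]
      omega
    exact hS.2 ⟨p, P, hP, hPS⟩

theorem IsMinimalFull.eq_setOf_isMinimal [Finite X] {S : Set (MarkedUWord φ u)}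
    (hfin : S.Finite) (hS : IsMinimalFull S) : S = {p | p.IsMinimalIdealPreimage} := by
  have hsub : ∀ p : MarkedUWord φ u, p.IsMinimalIdealPreimage → p ∈ S :=
    fun p hp => Covers.mem hfin hS hp.1 (hp.covers hS.1)
  refine Set.Subset.antisymm (fun s hs => ?_) hsub
  have hI := hS.1.1 s hs
  obtain ⟨w, a, hsa⟩ := CyclicWord.exists_line_of_ne s.src_ne_tgt
  -- The minimal `q` on a line through `s` is already in `S`, so uniqueness on this line gives `s =
  -- q`.
  obtain ⟨q, hq, hqa, -⟩ := exists_isMinimal_liesOn (hI.crosses hsa)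
  obtain ⟨r, -, hr⟩ := hS.1.existsUnique hI hsa
  have : s = q := (hr s ⟨hs, hsa⟩).trans (hr q ⟨hsub q hq, hqa⟩).symm
  rwa [this]

/-! ### Counting -/

theorem finite_hom (u : UWord X) (w : CyclicWord X) : Finite (Hom u.graph w.graph) := by
  have : Finite u.graph.V := inferInstanceAs (Finite (Fin (u.word.toWord.length + 1)))
  have : Finite u.graph.E := inferInstanceAs (Finite (Fin u.word.toWord.length × Bool))
  have : Finite w.graph.V := inferInstanceAs (Finite (Fin w.word.toWord.length))
  have : Finite w.graph.E := inferInstanceAs (Finite (Fin w.word.toWord.length × Bool))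
  refine Finite.of_injective (fun f : Hom u.graph w.graph => (f.onV, f.onE)) fun f g h => ?_
  exact Hom.ext (congrArg Prod.fst h) (congrArg Prod.snd h)

theorem hom_unique (p : MarkedUWord φ u) (w : CyclicWord X) {h h' : Hom p.base.graph w.graph}
    (heq : (foldSubstMap φ.toMonoidHom h).comp p.toFold =
      (foldSubstMap φ.toMonoidHom h').comp p.toFold) : h = h' := by
  obtain ⟨a, ha⟩ := w.exists_start φ
    (((foldSubstMap φ.toMonoidHom h).comp p.toFold).onV u.first)
  have D := w.develops_dev a
  have h1 := (p.comp_eq_iff D ha h).1 rfl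
  have h2 := (p.comp_eq_iff D ha h').1 heq.symm
  exact w.folded_graph.hom_ext (z₀ := p.base.first) (connected_line p.base.word.toWord)
    (D.inj w.folded_graph h1 h2)

/-- Idealness sends a member of `S` with a morphism to `w` to a morphism `u → φ(w)`. Existence in
fullness is surjectivity, and uniqueness in fullness together with `hom_unique` is injectivity. -/
theorem IsFull.card_hom_image [Finite X] {S : Finset (MarkedUWord φ u)}
    (hS : IsFull (S : Set (MarkedUWord φ u))) (w : CyclicWord X) :
    Nat.card (Hom u.graph (w.image φ)) =
      ∑ p ∈ S, Nat.card (Hom p.base.graph w.graph) := by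
  have hex : ∀ q : (Σ p : S, Hom p.1.base.graph w.graph), ∃ f : Hom u.graph (w.image φ),
      (foldSubstMap φ.toMonoidHom q.2).comp q.1.1.toFold = (w.imageIncl φ).comp f :=
    fun q => (hS.1 q.1.1 q.1.2).exists_hom w q.2
  choose F hF using hex
  have hbij : Function.Bijective F := by
    constructor
    · rintro ⟨⟨p, hp⟩, h⟩ ⟨⟨q, hq⟩, k⟩ heq
      have h1 := hF ⟨⟨p, hp⟩, h⟩
      have h2 := hF ⟨⟨q, hq⟩, k⟩
      rw [← heq] at h2
      obtain ⟨r, -, hr⟩ := hS.2 w (F ⟨⟨p, hp⟩, h⟩)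
      obtain rfl : p = q := (hr p ⟨hp, h, h1⟩).trans (hr q ⟨hq, k, h2⟩).symm
      obtain rfl : h = k := p.hom_unique w (h1.trans h2.symm)
      rfl
    · intro f
      obtain ⟨p, ⟨hp, h, hh⟩, -⟩ := hS.2 w f
      refine ⟨⟨⟨p, hp⟩, h⟩, spanIncl_comp_injective _ ?_⟩
      exact (hF ⟨⟨p, hp⟩, h⟩).symm.trans hh
  have : ∀ p : S, Finite (Hom p.1.base.graph w.graph) := fun p => finite_hom _ w
  rw [← Nat.card_eq_of_bijective F hbij, Nat.card_sigma]
  exact Finset.sum_coe_sort S fun p => Nat.card (Hom p.base.graph w.graph)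

/-- Reconciles the two descriptions of `φ(w)`: the circle on the cyclic reduction and the core of
the folded graph. -/
theorem card_hom_map (φ : FreeGroup X ≃* FreeGroup X) (u : UWord X) (w : CyclicWord X) :
    Nat.card (Hom u.graph (w.map φ).graph) = Nat.card (Hom u.graph (w.image φ)) := by
  have D := develops_fold φ (w.develops_dev 1)
  have hP := (foldDev_vertex φ (w.develops_dev 1)).2 (w.dev_origin 1)
  refine Eq.trans ?_ ((folded_fold _).card_hom_core D (w.conj_ne_one φ 1) hP u.exists_edge)
  have h1 : (φ 1)⁻¹ * φ (1 * w.word * 1⁻¹) * φ 1 = φ w.word := by simp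
  have h2 : (w.map φ).word.toWord = reduceCyclically (φ w.word).toWord := by
    have := reduceCyclically.isCyclicallyReduced (isReduced_toWord (x := φ w.word))
    exact this.isReduced.toWord_mk_eq
  rw [h1, CyclicWord.graph, h2]

theorem IsFull.card_hom_map [Finite X] {S : Finset (MarkedUWord φ u)}
    (hS : IsFull (S : Set (MarkedUWord φ u))) (w : CyclicWord X) :
    Nat.card (Hom u.graph (w.map φ).graph) =
      ((S.val.map base).map fun v => Nat.card (Hom v.graph w.graph)).sum := by
  rw [MarkedUWord.card_hom_map, hS.card_hom_image, Multiset.map_map]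
  rfl

end MarkedUWord

/-! ### The theorem. -/

theorem mainTheorem1 {X : Type*} [DecidableEq X] [Finite X]
    (u : UWord X) (φ : FreeGroup X ≃* FreeGroup X) :
    (∃! S : Finset (MarkedUWord φ u), MarkedUWord.IsMinimalFull (S : Set (MarkedUWord φ u))) ∧
    (∀ S : Finset (MarkedUWord φ u), MarkedUWord.IsMinimalFull (S : Set (MarkedUWord φ u)) →
      (S : Set (MarkedUWord φ u)) = {p | p.IsMinimalIdealPreimage}) ∧
    (∃! M : Multiset (UWord X),
      (∃ S : Finset (MarkedUWord φ u), MarkedUWord.IsMinimalFull (S : Set (MarkedUWord φ u)) ∧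
        M = S.val.map MarkedUWord.base) ∧
      ∀ w : CyclicWord X,
        Nat.card (LabeledGraph.Hom u.graph (w.map φ).graph) =
          (M.map fun v => Nat.card (LabeledGraph.Hom v.graph w.graph)).sum) := by
  have heq : ∀ S : Finset (MarkedUWord φ u),
      MarkedUWord.IsMinimalFull (S : Set (MarkedUWord φ u)) →
      (S : Set (MarkedUWord φ u)) = {p | p.IsMinimalIdealPreimage} :=
    fun S hS => hS.eq_setOf_isMinimal S.finite_toSet
  obtain ⟨S, hS⟩ := (MarkedUWord.finite_setOf_isMinimal φ u).exists_finset_coe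
  have hmin : MarkedUWord.IsMinimalFull (S : Set (MarkedUWord φ u)) :=
    hS ▸ MarkedUWord.isMinimalFull_setOf_isMinimal φ u
  have huniq : ∀ T : Finset (MarkedUWord φ u),
      MarkedUWord.IsMinimalFull (T : Set (MarkedUWord φ u)) → T = S :=
    fun T hT => Finset.coe_injective ((heq T hT).trans hS.symm)
  refine ⟨⟨S, hmin, huniq⟩, heq, S.val.map MarkedUWord.base,
    ⟨⟨S, hmin, rfl⟩, hmin.1.card_hom_map⟩, ?_⟩
  rintro M ⟨⟨T, hT, rfl⟩, -⟩
  rw [huniq T hT]
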